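/- Let $n\ge 1$ be an integer, $s\in(0,1)$, $p>1$ and $\Lambda\ge 1$. There exist an exponent $\alpha\in(0,1)$ and a constant $C\ge 1$, depending only on $n$, $s$, $p$ and $\Lambda$, such that the following holds. Let $\Omega\subset\mathbb{R}^n$ be a bounded open set. Let $K:\mathbb{R}^n\times\mathbb{R}^n\to[0,+\infty)$ be measurable with $K(x,y)=K(y,x)$ and $$\frac{1}{\Lambda|x-y|^{n+sp}}\le K(x,y)\le\frac{\Lambda}{|x-y|^{n+sp}}\qquad\text{for a.e. }x,y\in\mathbb{R}^n.$$ Let $f\in L^\infty(\Omega)$ and $f_0\ge\|f\|_{L^\infty(\Omega)}$. Let $u:\mathbb{R}^n\to\mathbb{R}$ be a measurable function with $$\int_{\mathbb{R}^n}\frac{|u(x)|^{p-1}}{(1+|x|)^{n+sp}}\,dx<+\infty,\qquad u|_\Omega\in L^p(\Omega),\qquad \iint_{\mathbb{R}^{2n}\setminus(\mathbb{R}^n\setminus\Omega)^2}\frac{|u(x)-u(y)|^p}{|x-y|^{n+sp}}\,dx\,dy<+\infty,$$ and suppose that $u$ is a weak solution of $\mathcal{L}_{K,p}u=f$ in $\Omega$,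 that is, $$\frac12\int_{\mathbb{R}^n}\int_{\mathbb{R}^n}|u(x)-u(y)|^{p-2}(u(x)-u(y))(\varphi(x)-\varphi(y))K(x,y)\,dx\,dy=\int_{\Omega}f(x)\varphi(x)\,dx$$ for every $\varphi\in W^{s,p}(\mathbb{R}^n)$ whose support is contained in $\Omega$. Here $W^{s,p}(\mathbb{R}^n)$ is the space of $\varphi\in L^p(\mathbb{R}^n)$ with $\iint_{\mathbb{R}^{2n}}\frac{|\varphi(x)-\varphi(y)|^p}{|x-y|^{n+sp}}\,dx\,dy<+\infty$. Then, after modification on a set of measure zero, $u\in C^{\alpha}_{\mathrm{loc}}(\Omega)$ (that is, $u$ is $\alpha$-Hölder continuous on each compact subset of $\Omega$), and $$\|u\|_{L^\infty(B_R(x_0))}+R^\alpha[u]_{C^\alpha(B_R(x_0))}\le C\left(\frac{\|u\|_{L^p(B_{2R}(x_0))}}{R^{n/p}}+\mathrm{Tail}_{s,p}(u;x_0,R)+R^{\frac{sp}{p-1}}f_0^{\frac1{p-1}}\right)$$ for every $x_0\in\Omega$ and every $0<R<\operatorname{dist}(x_0,\partial\Omega)/2$, where $$[u]_{C^\alpha(B_R(x_0))}:=\sup_{\substack{x,y\in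 B_R(x_0)\\x\ne y}}\frac{|u(x)-u(y)|}{|x-y|^\alpha},\qquad \mathrm{Tail}_{s,p}(u;x_0,R):=\left(R^{sp}\int_{\mathbb{R}^n\setminus B_R(x_0)}\frac{|u(x)|^{p-1}}{|x-x_0|^{n+sp}}\,dx\right)^{\frac1{p-1}}.$$ -/

import Mathlib

open MeasureTheory Set
open scoped NNReal ENNReal

namespace NonlocalEq

/-- The Euclidean space of dimension `n`. -/
abbrev Eucl (n : ℕ) : Type := EuclideanSpace ℝ (Fin n)

/-- The Gagliardo integral of `u` over a set `D` of pairs of points: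
the integral over `D` of `|u x - u y| ^ p / |x - y| ^ (n + s p)`, with values in `[0, ∞]`. -/
noncomputable def gagliardo {n : ℕ} (s p : ℝ) (D : Set (Eucl n × Eucl n))
    (u : Eucl n → ℝ) : ℝ≥0∞ :=
  ∫⁻ z in D, ENNReal.ofReal (|u z.1 - u z.2| ^ p / ‖z.1 - z.2‖ ^ ((n : ℝ) + s * p))

/-- The fractional Sobolev space `W^{s,p}(U)`: functions in `L^p(U)` with finite Gagliardo
seminorm on `U`. -/
def MemFracSobolev {n : ℕ} (s p : ℝ) (U : Set (Eucl n)) (u : Eucl n → ℝ) : Prop :=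
  MemLp u (ENNReal.ofReal p) (volume.restrict U) ∧ gagliardo s p (U ×ˢ U) u < ⊤

/-- The energy space of functions `u` on the whole space with `u ∈ L^p(Ω)` and finite Gagliardo
integral over the set of all pairs of points that do not both lie outside `Ω`. -/
def MemEnergySpace {n : ℕ} (s p : ℝ) (Ω : Set (Eucl n)) (u : Eucl n → ℝ) : Prop :=
  AEMeasurable u ∧ MemLp u (ENNReal.ofReal p) (volume.restrict Ω) ∧
    gagliardo s p (Ωᶜ ×ˢ Ωᶜ)ᶜ u < ⊤

/-- The weighted space `L^{p-1}_s` of (Lebesgue) measurable functions `u` on the whole space for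
which `|u x| ^ (p - 1) / (1 + |x|) ^ (n + s p)` is integrable. -/
def MemTailSpace {n : ℕ} (s p : ℝ) (u : Eucl n → ℝ) : Prop :=
  AEMeasurable u ∧
    Integrable (fun x : Eucl n => |u x| ^ (p - 1) / (1 + ‖x‖) ^ ((n : ℝ) + s * p))

/-- The nonlocal tail of `u` at `x₀` and radius `R`. The integral converges for `u` in the
weighted space `L^{p-1}_s`. -/
noncomputable def tail {n : ℕ} (s p : ℝ) (u : Eucl n → ℝ) (x₀ : Eucl n) (R : ℝ) : ℝ :=
  (R ^ (s * p) * ∫ x in (Metric.ball x₀ R)ᶜ,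
    |u x| ^ (p - 1) / ‖x - x₀‖ ^ ((n : ℝ) + s * p)) ^ (1 / (p - 1))

/-- Admissible kernels: non-negative, (Lebesgue) measurable, symmetric, and comparable to
`|x - y| ^ (-(n + s p))` with constant `Λ`, almost everywhere. -/
structure IsKernel {n : ℕ} (s p Λ : ℝ) (K : Eucl n → Eucl n → ℝ) : Prop where
  aemeasurable : AEMeasurable (fun z : Eucl n × Eucl n => K z.1 z.2)
  nonneg : ∀ x y, 0 ≤ K x y
  symm : ∀ᵐ z : Eucl n × Eucl n, K z.1 z.2 = K z.2 z.1
  lower : ∀ᵐ z : Eucl n × Eucl n, 1 / (Λ * ‖z.1 - z.2‖ ^ ((n : ℝ) + s * p)) ≤ K z.1 z.2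
  upper : ∀ᵐ z : Eucl n × Eucl n, K z.1 z.2 ≤ Λ / ‖z.1 - z.2‖ ^ ((n : ℝ) + s * p)

/-- Weak solutions of `L_{K,p} u = f` in `Ω`: the test functions are the elements of
`W^{s,p}` of the whole space whose (closed) support is contained in `Ω`. For such test functions
and `u` in the energy space both integrals converge absolutely. -/
def IsWeakSolution {n : ℕ} (s p : ℝ) (K : Eucl n → Eucl n → ℝ) (Ω : Set (Eucl n))
    (f u : Eucl n → ℝ) : Prop :=
  MemEnergySpace s p Ω u ∧
    ∀ φ : Eucl n → ℝ, MemFracSobolev s p univ φ → tsupport φ ⊆ Ω →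
      (1 / 2) * (∫ z : Eucl n × Eucl n,
        |u z.1 - u z.2| ^ (p - 2) * (u z.1 - u z.2) * (φ z.1 - φ z.2) * K z.1 z.2) =
      ∫ x in Ω, f x * φ x

/-- `v ∈ C^α_loc(Ω)`: `v` is Hölder continuous with exponent `α` on each compact subset
of `Ω`. -/
def LocallyHolder {n : ℕ} (α : ℝ≥0) (Ω : Set (Eucl n)) (v : Eucl n → ℝ) : Prop :=
  ∀ Q : Set (Eucl n), IsCompact Q → Q ⊆ Ω → ∃ c : ℝ≥0, HolderOnWith c α v Q

/-- The Hölder seminorm of `v` on `U`, with values in `[0, ∞]`. -/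
noncomputable def holderSeminorm {n : ℕ} (α : ℝ≥0) (U : Set (Eucl n)) (v : Eucl n → ℝ) :
    ℝ≥0∞ :=
  eHolderNorm α (U.domRestrict v)

end NonlocalEq

namespace NonlocalEq

/-! This is De Giorgi's method for the fractional p-Laplacian. Testing the equation with η^p (u -
k)₊ gives the Caccioppoli estimate `exists_caccioppoli`. Its left side keeps two quantities: the
Gagliardo energy of η (u - k)₊ and, since the operator compares all pairs of points, the interaction
of (u - k)₊ at one point with (k - u)₊^(p-1) at another. The right side involves only the L^p and
L^1 norms of (u - k)₊ on a ball, its tail and f₀. From there on the equation is used only through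
the two inequalities of `IsDeGiorgi`, which `exists_isDeGiorgi` derives from these two quantities
for u and, as -u solves the equation with datum -f, also for -u.

The energy inequality is combined with the Faber–Krahn inequality `exists_faberKrahn`, which bounds
an L^p norm by the energy times a power of the measure of the support. It plays the role of the
Sobolev embedding and needs no comparison of sp with n. Iterating over rising levels and shrinking
balls gives `exists_forall_le_of_excess_small`: an excess over k that is small in L^p, with
controlled tail, forces u ≤ k + d on the smaller ball. At level 0 this is local boundedness.

The interaction inequality takes the place of De Giorgi's isoperimetric lemma. If u ≤ M on a ball
and u ≤ M - h on half of a smaller one, then u > M - δh only on a fraction of order δ^(p-1)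
(`exists_volume_gt_le`). For small δ the iteration then applies near M and lowers the supremum
(`exists_growth`).

To iterate this over the balls of radius R/4^j one must control the tail at every scale. The
induction in `exists_oscillation_decay` therefore carries, besides the oscillation bound on the
current ball, a growth bound of order |x - x₀|^α outside it, up to the original values of u far
away. The excess over the current supremum then has a tail with a prefactor proportional to α, so a
small α makes `exists_oscillation_step` applicable. The far values stay below the admissible
threshold because α(p - 1) ≤ sp.

Every centre z thus receives a number to which u converges geometrically on balls about z. These
essential limits form `preciseRep`. Comparing two of them on a common ball gives the Hölder estimate
and, since oscillations vanish, equality with u almost everywhere. -/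

/-! ### Pointwise inequalities for powers and truncations -/

/-- Comparison with twice the larger summand. Convexity is not used, because the exponent p - 1 may
be smaller than 1. -/
lemma add_rpow_le_two_rpow_mul {a b r : ℝ} (ha : 0 ≤ a) (hb : 0 ≤ b) (hr : 0 ≤ r) :
    (a + b) ^ r ≤ 2 ^ r * (a ^ r + b ^ r) := by
  have h1 : (a + b) ^ r ≤ (2 * max a b) ^ r := by
    apply Real.rpow_le_rpow (by positivity) _ hr
    linarith [le_max_left a b, le_max_right a b]
  rw [Real.mul_rpow (by norm_num) (le_max_of_le_left ha)] at h1
  refine h1.trans ?_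
  have h2 : (0:ℝ) ≤ a ^ r := Real.rpow_nonneg ha r
  have h3 : (0:ℝ) ≤ b ^ r := Real.rpow_nonneg hb r
  gcongr
  rcases max_choice a b with h | h <;> rw [h] <;> linarith

lemma rpow_sub_one_mul_self {t r : ℝ} (ht : 0 ≤ t) (hr : 1 < r) : t ^ (r - 1) * t = t ^ r := by
  rcases ht.eq_or_lt with rfl | h
  · rw [mul_zero, Real.zero_rpow (by linarith)]
  · rw [Real.rpow_sub_one h.ne']; field_simp

/-- The odd power `t ↦ |t| ^ (p - 2) * t`. -/
noncomputable def oddPow (p t : ℝ) : ℝ := |t| ^ (p - 2) * t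

lemma oddPow_of_nonneg {p t : ℝ} (hp : 1 < p) (ht : 0 ≤ t) : oddPow p t = t ^ (p - 1) := by
  unfold oddPow
  rcases ht.eq_or_lt with rfl | h
  · rw [mul_zero, Real.zero_rpow (by linarith)]
  · rw [abs_of_pos h, show p - 1 = p - 2 + 1 by ring, Real.rpow_add_one h.ne']

lemma oddPow_neg (p t : ℝ) : oddPow p (-t) = -oddPow p t := by
  unfold oddPow; rw [abs_neg]; ring

lemma abs_oddPow {p : ℝ} (hp : 1 < p) (t : ℝ) : |oddPow p t| = |t| ^ (p - 1) := by
  rcases le_total 0 t with h | h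
  · rw [oddPow_of_nonneg hp h, abs_of_nonneg h, abs_of_nonneg (by positivity)]
  · have h' : 0 ≤ -t := by linarith
    rw [← neg_neg t, oddPow_neg, abs_neg, oddPow_of_nonneg hp h', abs_neg, abs_of_nonneg h',
      abs_of_nonneg (by positivity)]

/-- Bernoulli's inequality for (e/f)^p, multiplied by f^p: the tangent bound at the larger endpoint.
-/
lemma rpow_sub_rpow_le {p e f : ℝ} (hp : 1 < p) (he : 0 ≤ e) (hef : e ≤ f) :
    f ^ p - e ^ p ≤ p * f ^ (p - 1) * (f - e) := by
  rcases (he.trans hef).eq_or_lt with h | hf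
  · have : e = 0 := by linarith
    simp [this, ← h]
  have h1 := one_add_mul_self_le_rpow_one_add (s := e / f - 1) (by
    have : 0 ≤ e / f := by positivity
    linarith) hp.le
  rw [add_sub_cancel, Real.div_rpow he hf.le] at h1
  have h2 : 0 < f ^ p := by positivity
  rw [le_div_iff₀ h2] at h1
  have h3 : f ^ p = f ^ (p - 1) * f := (rpow_sub_one_mul_self hf.le hp).symm
  have h4 : (1 + p * (e / f - 1)) * f ^ p = f ^ p - p * f ^ (p - 1) * (f - e) := by
    rw [h3]; field_simp; ring
  linarith

/-- Young's inequality with coefficient 1/2 on X^p, so that this term can be absorbed. Splitting at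
Y = X/2 avoids dual exponents. -/
lemma young_half {p X Y : ℝ} (hp : 1 < p) (hX : 0 ≤ X) (hY : 0 ≤ Y) :
    X ^ (p - 1) * Y ≤ X ^ p / 2 + 2 ^ p * Y ^ p := by
  have hXp : 0 ≤ X ^ p := by positivity
  have hYp : 0 ≤ Y ^ p := by positivity
  rcases le_total Y (X / 2) with h | h
  · have : X ^ (p - 1) * Y ≤ X ^ (p - 1) * (X / 2) := by gcongr
    have h2 := rpow_sub_one_mul_self hX hp
    have h3 : 0 ≤ (2:ℝ) ^ p * Y ^ p := by positivity
    nlinarith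
  · have h1 : X ^ (p - 1) ≤ (2 * Y) ^ (p - 1) :=
      Real.rpow_le_rpow hX (by linarith) (by linarith)
    have h2 : X ^ (p - 1) * Y ≤ (2 * Y) ^ (p - 1) * (2 * Y) := by gcongr; linarith
    rw [rpow_sub_one_mul_self (by positivity) hp, Real.mul_rpow (by norm_num) hY] at h2
    linarith

lemma two_rpow_neg_add_one (p : ℝ) : (2:ℝ) ^ (-(p + 1)) * 2 ^ p = 1 / 2 := by
  rw [← Real.rpow_add (by norm_num)]
  norm_num [show -(p + 1) + p = -1 by ring, Real.rpow_neg_one]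

/-- The local pointwise inequality behind the Caccioppoli estimate, for ordered values. -/
lemma oddPow_cutoff_of_le {p a b e f : ℝ} (hp : 1 < p) (hba : b ≤ a) (he : 0 ≤ e)
    (hf : 0 ≤ f) :
    2 ^ (-(p + 1)) * (|e * max a 0 - f * max b 0| ^ p +
        (max (-b) 0 ^ (p - 1) * max a 0 * e ^ p + max (-a) 0 ^ (p - 1) * max b 0 * f ^ p)) ≤
      oddPow p (a - b) * (e ^ p * max a 0 - f ^ p * max b 0) +
        (2 ^ p * p ^ p + 1) * ((max a 0 ^ p + max b 0 ^ p) * |e - f| ^ p) := by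
  have hc : (2:ℝ) ^ (-(p + 1)) ≤ 1 / 2 := by
    have := two_rpow_neg_add_one p
    have h1 : (1:ℝ) ≤ 2 ^ p := Real.one_le_rpow (by norm_num) (by linarith)
    have h2 : (0:ℝ) < 2 ^ (-(p + 1)) := by positivity
    nlinarith
  have hc0 : (0:ℝ) < 2 ^ (-(p + 1)) := by positivity
  have hp0 : p ≠ 0 := by linarith
  have hp1 : p - 1 ≠ 0 := by linarith
  have hC : (0:ℝ) ≤ 2 ^ p * p ^ p := by positivity
  rw [oddPow_of_nonneg hp (sub_nonneg.2 hba)]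
  -- Three positions relative to 0: both truncations vanish; only a is positive, and then a - b
  -- dominates both a and -b; both are positive, and then the order of the cutoff values decides.
  rcases le_or_gt a 0 with ha | ha
  · simp [max_eq_right ha, max_eq_right (hba.trans ha), Real.zero_rpow hp0]
  rcases le_or_gt b 0 with hb | hb
  · rw [max_eq_left ha.le, max_eq_right hb, max_eq_left (by linarith : 0 ≤ -b)]
    simp only [mul_zero, sub_zero, add_zero, Real.zero_rpow hp0]
    rw [abs_of_nonneg (by positivity), Real.mul_rpow he ha.le]
    have h1 : (-b) ^ (p - 1) ≤ (a - b) ^ (p - 1) :=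
      Real.rpow_le_rpow (by linarith) (by linarith) (by linarith)
    have h2 : a ^ (p - 1) ≤ (a - b) ^ (p - 1) :=
      Real.rpow_le_rpow (by linarith) (by linarith) (by linarith)
    have h3 := rpow_sub_one_mul_self ha.le hp
    have h4 : 0 ≤ (2 ^ p * p ^ p + 1) * (a ^ p * |e - f| ^ p) := by positivity
    have h5 : 0 ≤ e ^ p * a := by positivity
    have h6 : e ^ p * a ^ p + (-b) ^ (p - 1) * a * e ^ p ≤ 2 * ((a - b) ^ (p - 1) * (e ^ p * a)) := by
      rw [← h3]
      nlinarith [mul_le_mul_of_nonneg_right h1 h5, mul_le_mul_of_nonneg_right h2 h5]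
    have h7 : 0 ≤ e ^ p * a ^ p + (-b) ^ (p - 1) * a * e ^ p := by
      have : 0 ≤ (-b) ^ (p - 1) := Real.rpow_nonneg (by linarith) _
      positivity
    nlinarith [mul_le_mul_of_nonneg_right hc h7]
  rw [max_eq_left ha.le, max_eq_left hb.le, max_eq_right (by linarith : -b ≤ 0),
    max_eq_right (by linarith : -a ≤ 0)]
  simp only [Real.zero_rpow hp1, zero_mul, add_zero]
  set D := a - b with hD
  have hD0 : 0 ≤ D := sub_nonneg.2 hba
  have hDp := rpow_sub_one_mul_self hD0 hp
  have ha' : 0 ≤ a ^ p := by positivity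
  have hb' : 0 ≤ b ^ p := by positivity
  -- If the larger value carries the larger cutoff, the form bounds e^p D^p directly. Otherwise the
  -- cutoff difference enters with the wrong sign; `rpow_sub_rpow_le` and `young_half` absorb it,
  -- which produces the constant 2^p p^p.
  rcases le_total f e with hfe | hef
  · have h1 : |e * a - f * b| ≤ e * D + (e - f) * b := by
      rw [abs_of_nonneg (by nlinarith)]; rw [hD]; nlinarith
    have h2 : |e * a - f * b| ^ p ≤ 2 ^ p * ((e * D) ^ p + ((e - f) * b) ^ p) :=
      (Real.rpow_le_rpow (abs_nonneg _) h1 (by linarith)).trans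
        (add_rpow_le_two_rpow_mul (by positivity) (mul_nonneg (by linarith) hb.le) (by linarith))
    rw [Real.mul_rpow he hD0, Real.mul_rpow (by linarith) hb.le] at h2
    have h3 : f ^ p ≤ e ^ p := Real.rpow_le_rpow hf hfe (by linarith)
    have h4 : e ^ p * D ^ p ≤ D ^ (p - 1) * (e ^ p * a - f ^ p * b) := by
      rw [← hDp]
      have : 0 ≤ D ^ (p - 1) := by positivity
      have : e ^ p * D ≤ e ^ p * a - f ^ p * b := by
        rw [hD]; nlinarith
      nlinarith
    rw [abs_of_nonneg (by linarith : 0 ≤ e - f)]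
    have h5 : 0 ≤ (e - f) ^ p := Real.rpow_nonneg (by linarith) _
    have h6 := mul_le_mul_of_nonneg_left h2 hc0.le
    rw [← mul_assoc, two_rpow_neg_add_one] at h6
    have h7 : 0 ≤ e ^ p * D ^ p := by positivity
    have h8 : 0 ≤ a ^ p * (e - f) ^ p := by positivity
    have h9 : 0 ≤ b ^ p * (e - f) ^ p := by positivity
    nlinarith [mul_nonneg hC h8, mul_nonneg hC h9]
  · have h1 : |e * a - f * b| ≤ f * D + (f - e) * a := by
      have h0 : e * a - f * b = f * D - (f - e) * a := by rw [hD]; ring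
      have h01 : 0 ≤ f * D := by positivity
      have h02 : 0 ≤ (f - e) * a := mul_nonneg (by linarith) ha.le
      rw [h0, abs_le]; constructor <;> linarith
    have h2 : |e * a - f * b| ^ p ≤ 2 ^ p * ((f * D) ^ p + ((f - e) * a) ^ p) :=
      (Real.rpow_le_rpow (abs_nonneg _) h1 (by linarith)).trans
        (add_rpow_le_two_rpow_mul (by positivity) (mul_nonneg (by linarith) ha.le) (by linarith))
    have h3 := rpow_sub_rpow_le hp he hef
    have h4 := young_half hp (mul_nonneg hf hD0)
      (mul_nonneg (by linarith : 0 ≤ p) (mul_nonneg (by linarith : 0 ≤ f - e) ha.le))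
    rw [Real.mul_rpow (by linarith) (mul_nonneg (by linarith) ha.le)] at h4
    rw [Real.mul_rpow hf hD0 (z := p - 1)] at h4
    have h5 : D ^ (p - 1) * (f ^ p * D - p * f ^ (p - 1) * (f - e) * a) ≤
        D ^ (p - 1) * (e ^ p * a - f ^ p * b) := by
      have h51 : e ^ p * a - f ^ p * b = f ^ p * D - (f ^ p - e ^ p) * a := by rw [hD]; ring
      rw [h51]; gcongr
    have h6 : (f * D) ^ p = f ^ p * (D ^ (p - 1) * D) := by rw [Real.mul_rpow hf hD0, hDp]
    have h7 := mul_le_mul_of_nonneg_left h2 hc0.le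
    rw [← mul_assoc, two_rpow_neg_add_one] at h7
    have h8 : ((f - e) * a) ^ p = (f - e) ^ p * a ^ p := Real.mul_rpow (by linarith) ha.le
    rw [abs_sub_comm e f, abs_of_nonneg (by linarith : 0 ≤ f - e)]
    have h9 : 0 ≤ (f - e) ^ p := Real.rpow_nonneg (by linarith) _
    have h10 : 0 ≤ (2 ^ p * p ^ p + 1) * (b ^ p * (f - e) ^ p) := by positivity
    have h11 : 0 ≤ (f - e) ^ p * a ^ p := by positivity
    rw [h8] at h4 h7
    nlinarith

lemma oddPow_cutoff {p e f : ℝ} (a b : ℝ) (hp : 1 < p) (he : 0 ≤ e)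
    (hf : 0 ≤ f) :
    2 ^ (-(p + 1)) * (|e * max a 0 - f * max b 0| ^ p +
        (max (-b) 0 ^ (p - 1) * max a 0 * e ^ p + max (-a) 0 ^ (p - 1) * max b 0 * f ^ p)) ≤
      oddPow p (a - b) * (e ^ p * max a 0 - f ^ p * max b 0) +
        (2 ^ p * p ^ p + 1) * ((max a 0 ^ p + max b 0 ^ p) * |e - f| ^ p) := by
  rcases le_total b a with h | h
  · exact oddPow_cutoff_of_le hp h he hf
  · have := oddPow_cutoff_of_le hp h hf he
    rw [← neg_sub a b, oddPow_neg, abs_sub_comm, abs_sub_comm f e] at this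
    linarith

/-- The pointwise inequality behind the tail term of the Caccioppoli estimate. -/
lemma oddPow_cutoff_tail {p e : ℝ} (a b : ℝ) (hp : 1 < p) (he : 0 ≤ e) :
    2 ^ (-(p + 1)) * ((e * max a 0) ^ p + max (-b) 0 ^ (p - 1) * max a 0 * e ^ p) ≤
      oddPow p (a - b) * (e ^ p * max a 0) +
        2 * (max b 0 ^ (p - 1) * max a 0 * e ^ p) := by
  have hc : (2:ℝ) ^ (-(p + 1)) ≤ 1 / 2 := by
    have := two_rpow_neg_add_one p
    have h1 : (1:ℝ) ≤ 2 ^ p := Real.one_le_rpow (by norm_num) (by linarith)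
    have h2 : (0:ℝ) < 2 ^ (-(p + 1)) := by positivity
    nlinarith
  have hc0 : (0:ℝ) < 2 ^ (-(p + 1)) := by positivity
  have hp0 : p ≠ 0 := by linarith
  have hp1 : p - 1 ≠ 0 := by linarith
  rcases le_or_gt a 0 with ha | ha
  · simp [max_eq_right ha, Real.zero_rpow hp0]
  rw [max_eq_left ha.le, Real.mul_rpow he ha.le, ← rpow_sub_one_mul_self ha.le hp]
  suffices h : 2 ^ (-(p + 1)) * (a ^ (p - 1) + max (-b) 0 ^ (p - 1)) ≤
      oddPow p (a - b) + 2 * max b 0 ^ (p - 1) by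
    have := mul_le_mul_of_nonneg_right h (by positivity : 0 ≤ e ^ p * a)
    linarith
  have hap : 0 ≤ a ^ (p - 1) := by positivity
  rcases le_or_gt b 0 with hb | hb
  · rw [max_eq_right hb, max_eq_left (by linarith : 0 ≤ -b),
      oddPow_of_nonneg hp (by linarith), Real.zero_rpow hp1]
    have h1 : (-b) ^ (p - 1) ≤ (a - b) ^ (p - 1) :=
      Real.rpow_le_rpow (by linarith) (by linarith) (by linarith)
    have h2 : a ^ (p - 1) ≤ (a - b) ^ (p - 1) :=
      Real.rpow_le_rpow (by linarith) (by linarith) (by linarith)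
    have h3 : 0 ≤ (-b) ^ (p - 1) := Real.rpow_nonneg (by linarith) _
    nlinarith
  rw [max_eq_right (by linarith : -b ≤ 0), max_eq_left hb.le, Real.zero_rpow hp1, add_zero]
  have hbp : 0 ≤ b ^ (p - 1) := by positivity
  have h2p : (2:ℝ) ^ (p - 1) ≤ 2 ^ p := Real.rpow_le_rpow_of_exponent_le (by norm_num) (by linarith)
  have hcc : (2:ℝ) ^ (-(p + 1)) * 2 ^ (p - 1) ≤ 1 / 2 := by
    rw [← two_rpow_neg_add_one p]; gcongr
  -- For b ≤ a/2 one has a ≤ 2(a - b), so the form controls a^(p-1). Otherwise a ≤ 2b, and the form,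
  -- which is at least -b^(p-1), is compensated by the added term.
  rcases le_total b (a / 2) with h | h
  · rw [oddPow_of_nonneg hp (by linarith)]
    have h1 : a ^ (p - 1) ≤ (2 * (a - b)) ^ (p - 1) :=
      Real.rpow_le_rpow ha.le (by linarith) (by linarith)
    rw [Real.mul_rpow (by norm_num) (by linarith)] at h1
    have h2 : 0 ≤ (a - b) ^ (p - 1) := Real.rpow_nonneg (by linarith) _
    nlinarith [mul_le_mul_of_nonneg_left h1 hc0.le, mul_le_mul_of_nonneg_right hcc h2]
  · have h1 : a ^ (p - 1) ≤ (2 * b) ^ (p - 1) :=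
      Real.rpow_le_rpow ha.le (by linarith) (by linarith)
    rw [Real.mul_rpow (by norm_num) hb.le] at h1
    have h2 : -b ^ (p - 1) ≤ oddPow p (a - b) := by
      rcases le_total b a with hab | hab
      · rw [oddPow_of_nonneg hp (by linarith)]
        have : 0 ≤ (a - b) ^ (p - 1) := Real.rpow_nonneg (by linarith) _
        linarith
      · rw [← neg_sub b a, oddPow_neg, oddPow_of_nonneg hp (by linarith), neg_le_neg_iff]
        exact Real.rpow_le_rpow (by linarith) (by linarith) (by linarith)
    nlinarith [mul_le_mul_of_nonneg_left h1 hc0.le, mul_le_mul_of_nonneg_right hcc hbp]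

/-! ### Scaling and integrals of the kernel -/

/-- The volume of the Euclidean unit ball. -/
noncomputable def unitVol (n : ℕ) : ℝ := volume.real (Metric.ball (0 : Eucl n) 1)

lemma unitVol_pos (n : ℕ) : 0 < unitVol n :=
  ENNReal.toReal_pos (Metric.measure_ball_pos _ _ one_pos).ne' measure_ball_lt_top.ne

lemma volume_ball_eq {n : ℕ} (x : Eucl n) {r : ℝ} (hr : 0 < r) :
    volume (Metric.ball x r) = ENNReal.ofReal (unitVol n * r ^ (n : ℝ)) := by
  rw [Measure.addHaar_ball_of_pos volume x hr, finrank_euclideanSpace_fin, Real.rpow_natCast,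
    mul_comm, ENNReal.ofReal_mul (unitVol_pos n).le, unitVol, measureReal_def,
    ENNReal.ofReal_toReal measure_ball_lt_top.ne]

lemma lintegral_comp_smul_pos {n : ℕ} (F : Eucl n → ℝ≥0∞) {r : ℝ} (hr : 0 < r) :
    ∫⁻ y, F y = ENNReal.ofReal (r ^ (n : ℝ)) * ∫⁻ z, F (r • z) := by
  have h := Measure.map_addHaar_smul (volume : Measure (Eucl n)) hr.ne'
  have h2 : ∫⁻ z, F (r • z) = ∫⁻ y, F y ∂(Measure.map (r • ·) volume) := by
    let e : Eucl n ≃ᵐ Eucl n := (Homeomorph.smulOfNeZero r hr.ne').toMeasurableEquiv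
    exact (lintegral_map_equiv F e).symm
  rw [h2, h, lintegral_smul_measure, smul_eq_mul, ← mul_assoc, finrank_euclideanSpace_fin,
    Real.rpow_natCast, ← ENNReal.ofReal_mul (by positivity), abs_of_pos (by positivity),
    mul_inv_cancel₀ (by positivity), ENNReal.ofReal_one, one_mul]

/-- Homogeneity of the weight. For q = n + sp the factor is r^(-sp), the scaling behind all kernel
estimates. -/
lemma lintegral_radial_scale {n : ℕ} (g : ℝ → ℝ≥0∞) (q : ℝ) (x₀ : Eucl n) {r : ℝ} (hr : 0 < r) :
    ∫⁻ y, g (‖y - x₀‖ / r) * ENNReal.ofReal (‖y - x₀‖ ^ (-q)) =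
      ENNReal.ofReal (r ^ ((n : ℝ) - q)) *
        ∫⁻ z : Eucl n, g ‖z‖ * ENNReal.ofReal (‖z‖ ^ (-q)) := by
  rw [lintegral_sub_right_eq_self (fun y => g (‖y‖ / r) * ENNReal.ofReal (‖y‖ ^ (-q))) x₀,
    lintegral_comp_smul_pos _ hr, sub_eq_add_neg, Real.rpow_add hr,
    ENNReal.ofReal_mul (by positivity), mul_assoc]
  congr 1
  rw [← lintegral_const_mul' _ _ ENNReal.ofReal_ne_top]
  refine lintegral_congr fun z => ?_
  rw [norm_smul, Real.norm_of_nonneg hr.le, mul_div_cancel_left₀ _ hr.ne',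
    Real.mul_rpow hr.le (norm_nonneg _), ENNReal.ofReal_mul (by positivity)]
  ring

lemma integrable_radial {n : ℕ} (hn : 1 ≤ n) {G : ℝ → ℝ}
    (h : IntegrableOn (fun t => t ^ ((n : ℝ) - 1) * G t) (Ioi 0)) :
    Integrable (fun z : Eucl n => G ‖z‖) := by
  have : Nontrivial (Eucl n) := by
    have : Nonempty (Fin n) := ⟨⟨0, hn⟩⟩
    infer_instance
  rw [integrable_fun_norm_addHaar, finrank_euclideanSpace_fin]
  refine h.congr_fun (fun t _ => ?_) measurableSet_Ioi
  rw [smul_eq_mul, ← Real.rpow_natCast, Nat.cast_sub hn, Nat.cast_one]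

/-- In polar coordinates the density is t^(p - sp - 1) near 0, integrable because s < 1, and t^(-1 -
sp) at infinity, integrable because sp > 0. -/
lemma lintegral_min_kernel_lt_top {n : ℕ} (hn : 1 ≤ n) {s p : ℝ} (hs0 : 0 < s) (hs1 : s < 1)
    (hp : 1 < p) :
    ∫⁻ z : Eucl n, ENNReal.ofReal (min 1 ‖z‖ ^ p) *
      ENNReal.ofReal (‖z‖ ^ (-((n : ℝ) + s * p))) < ⊤ := by
  have hsp : 0 < s * p := by positivity
  have hI : Integrable (fun z : Eucl n => (fun t : ℝ => min 1 t ^ p * t ^ (-((n : ℝ) + s * p))) ‖z‖) := by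
    refine integrable_radial hn (G := fun t : ℝ => min 1 t ^ p * t ^ (-((n : ℝ) + s * p))) ?_
    rw [← Ioc_union_Ioi_eq_Ioi zero_le_one, integrableOn_union]
    constructor
    · have h1 : IntegrableOn (fun t : ℝ => t ^ (p - s * p - 1)) (Ioc 0 1) := by
        rw [← intervalIntegrable_iff_integrableOn_Ioc_of_le zero_le_one]
        exact intervalIntegral.intervalIntegrable_rpow' (by nlinarith)
      refine h1.congr_fun (fun t ht => ?_) measurableSet_Ioc
      have ht0 : 0 < t := ht.1
      simp only
      rw [min_eq_right ht.2, ← Real.rpow_add ht0, ← Real.rpow_add ht0]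
      congr 1; ring
    · have h1 : IntegrableOn (fun t : ℝ => t ^ (-1 - s * p)) (Ioi 1) :=
        integrableOn_Ioi_rpow_of_lt (by linarith) one_pos
      refine h1.congr_fun (fun t ht => ?_) measurableSet_Ioi
      have ht0 : 0 < t := one_pos.trans ht
      simp only
      rw [min_eq_left (le_of_lt ht), Real.one_rpow, one_mul, ← Real.rpow_add ht0]
      congr 1; ring
  have := hI.lintegral_lt_top
  refine lt_of_eq_of_lt (lintegral_congr fun z => ?_) this
  rw [ENNReal.ofReal_mul (by positivity)]

/-- The radial density is t^(γ - sp - 1) beyond radius 1. Positive γ is allowed, which is what later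
permits tails of functions of slow growth. -/
lemma lintegral_growth_kernel_lt_top {n : ℕ} (hn : 1 ≤ n) {s p γ : ℝ} (hγ : γ < s * p) :
    ∫⁻ z : Eucl n, (Ici (1:ℝ)).indicator (fun t => ENNReal.ofReal (t ^ γ)) ‖z‖ *
      ENNReal.ofReal (‖z‖ ^ (-((n : ℝ) + s * p))) < ⊤ := by
  have hI : Integrable (fun z : Eucl n => ((Ici (1:ℝ)).indicator
      fun t => t ^ (γ + -((n : ℝ) + s * p))) ‖z‖) := by
    apply integrable_radial hn
    have h1 : IntegrableOn (fun t : ℝ => t ^ (-1 + (γ - s * p))) (Ici 1) := by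
      rw [integrableOn_Ici_iff_integrableOn_Ioi]
      exact integrableOn_Ioi_rpow_of_lt (by linarith) one_pos
    rw [← integrable_indicator_iff measurableSet_Ici] at h1
    refine h1.integrableOn.congr_fun (fun t ht => ?_) measurableSet_Ioi
    have ht0 : 0 < t := ht
    by_cases h : t ∈ Ici (1:ℝ)
    · simp only [indicator_of_mem h]
      rw [← Real.rpow_add ht0]; congr 1; ring
    · simp [indicator_of_notMem h]
  have := hI.lintegral_lt_top
  refine lt_of_eq_of_lt (lintegral_congr fun z => ?_) this
  by_cases h : ‖z‖ ∈ Ici (1:ℝ)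
  · have h0 : 0 < ‖z‖ := one_pos.trans_le h
    rw [indicator_of_mem h, indicator_of_mem h, ← ENNReal.ofReal_mul (by positivity),
      Real.rpow_add h0]
  · simp [indicator_of_notMem h]

/-- The truncated kernel has integral bounded by a multiple of `L ^ (s p)`. -/
lemma exists_lintegral_min_kernel_le {n : ℕ} (hn : 1 ≤ n) {s p : ℝ} (hs0 : 0 < s) (hs1 : s < 1)
    (hp : 1 < p) :
    ∃ C : ℝ, 1 ≤ C ∧ ∀ (x : Eucl n) (L : ℝ), 0 < L →
      ∫⁻ y, ENNReal.ofReal (min 1 (L * ‖y - x‖) ^ p * ‖y - x‖ ^ (-((n : ℝ) + s * p))) ≤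
        ENNReal.ofReal (C * L ^ (s * p)) := by
  have hfin := lintegral_min_kernel_lt_top hn hs0 hs1 hp (n := n)
  refine ⟨max 1 (∫⁻ z : Eucl n, ENNReal.ofReal (min 1 ‖z‖ ^ p) *
      ENNReal.ofReal (‖z‖ ^ (-((n : ℝ) + s * p)))).toReal, le_max_left _ _, fun x L hL => ?_⟩
  have h := lintegral_radial_scale (fun t => ENNReal.ofReal (min 1 t ^ p)) ((n : ℝ) + s * p) x
    (inv_pos.2 hL)
  have h2 : ∀ y, ENNReal.ofReal (min 1 (L * ‖y - x‖) ^ p * ‖y - x‖ ^ (-((n : ℝ) + s * p))) =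
      ENNReal.ofReal (min 1 (‖y - x‖ / L⁻¹) ^ p) *
        ENNReal.ofReal (‖y - x‖ ^ (-((n : ℝ) + s * p))) := fun y => by
    rw [div_inv_eq_mul, mul_comm L, ENNReal.ofReal_mul (by positivity)]
  simp_rw [h2]
  rw [h, mul_comm, ENNReal.ofReal_mul (by positivity), Real.inv_rpow hL.le, ← Real.rpow_neg hL.le]
  have h3 : -((n : ℝ) - (n + s * p)) = s * p := by ring
  rw [h3]
  gcongr
  refine (ENNReal.ofReal_toReal hfin.ne).symm.le.trans ?_
  exact ENNReal.ofReal_le_ofReal (le_max_right _ _)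

/-- Integrals of `|y - x₀| ^ (γ - n - s p)` over complements of balls. -/
lemma exists_lintegral_growth_kernel_le {n : ℕ} (hn : 1 ≤ n) {s p γ : ℝ} (hγ : γ < s * p) :
    ∃ C : ℝ, 1 ≤ C ∧ ∀ (x₀ : Eucl n) (r : ℝ), 0 < r →
      ∫⁻ y in (Metric.ball x₀ r)ᶜ,
        ENNReal.ofReal ((‖y - x₀‖ / r) ^ γ * ‖y - x₀‖ ^ (-((n : ℝ) + s * p))) ≤
        ENNReal.ofReal (C * r ^ (-(s * p))) := by
  have hfin := lintegral_growth_kernel_lt_top hn hγ (n := n)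
  refine ⟨max 1 (∫⁻ z : Eucl n, (Ici (1:ℝ)).indicator (fun t => ENNReal.ofReal (t ^ γ)) ‖z‖ *
      ENNReal.ofReal (‖z‖ ^ (-((n : ℝ) + s * p)))).toReal, le_max_left _ _, fun x r hr => ?_⟩
  have h := lintegral_radial_scale ((Ici (1:ℝ)).indicator fun t => ENNReal.ofReal (t ^ γ))
    ((n : ℝ) + s * p) x hr
  rw [← lintegral_indicator Metric.isOpen_ball.measurableSet.compl]
  have h2 : ∀ y, (Metric.ball x r)ᶜ.indicator (fun y =>
      ENNReal.ofReal ((‖y - x‖ / r) ^ γ * ‖y - x‖ ^ (-((n : ℝ) + s * p)))) y =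
      (Ici (1:ℝ)).indicator (fun t => ENNReal.ofReal (t ^ γ)) (‖y - x‖ / r) *
        ENNReal.ofReal (‖y - x‖ ^ (-((n : ℝ) + s * p))) := fun y => by
    by_cases hy : y ∈ Metric.ball x r
    · rw [indicator_of_notMem (by simpa using hy), indicator_of_notMem, zero_mul]
      rw [mem_ball_iff_norm] at hy
      rw [mem_Ici, not_le, div_lt_one hr]; exact hy
    · rw [indicator_of_mem (by simpa using hy), indicator_of_mem,
        ENNReal.ofReal_mul (by positivity)]
      rw [mem_ball_iff_norm, not_lt] at hy
      rw [mem_Ici, one_le_div hr]; exact hy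
  simp_rw [h2]
  rw [h, mul_comm, ENNReal.ofReal_mul (by positivity)]
  have h3 : (n : ℝ) - (n + s * p) = -(s * p) := by ring
  rw [h3]
  gcongr
  refine (ENNReal.ofReal_toReal hfin.ne).symm.le.trans ?_
  exact ENNReal.ofReal_le_ofReal (le_max_right _ _)

lemma exists_lintegral_kernel_compl_ball_le {n : ℕ} (hn : 1 ≤ n) {s p : ℝ} (hsp : 0 < s * p) :
    ∃ C : ℝ, 1 ≤ C ∧ ∀ (x₀ : Eucl n) (r : ℝ), 0 < r →
      ∫⁻ y in (Metric.ball x₀ r)ᶜ, ENNReal.ofReal (‖y - x₀‖ ^ (-((n : ℝ) + s * p))) ≤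
        ENNReal.ofReal (C * r ^ (-(s * p))) := by
  obtain ⟨C, hC, h⟩ := exists_lintegral_growth_kernel_le hn hsp (n := n)
  exact ⟨C, hC, fun x r hr => by simpa using h x r hr⟩

/-! ### The Faber–Krahn inequality -/

/-- Fractional Faber–Krahn inequality. -/
lemma exists_faberKrahn {n : ℕ} (hn : 1 ≤ n) {s p : ℝ} (hsp : 0 < s * p) (hp : 1 < p) :
    ∃ C : ℝ, 1 ≤ C ∧ ∀ (h : Eucl n → ℝ), Measurable h → ∀ a : ℝ, 0 < a →
      volume {x | h x ≠ 0} ≤ ENNReal.ofReal a →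
      ∫⁻ x, ENNReal.ofReal (|h x| ^ p) ≤ ENNReal.ofReal (C * a ^ (s * p / n)) *
        ∫⁻ x, ∫⁻ y, ENNReal.ofReal (|h x - h y| ^ p * ‖x - y‖ ^ (-((n : ℝ) + s * p))) := by
  have hn0 : (0:ℝ) < n := by exact_mod_cast hn
  set ω := unitVol n with hω
  have hω0 : 0 < ω := unitVol_pos n
  have hq : 0 < (n : ℝ) + s * p := by positivity
  refine ⟨max 1 ((2 / ω) ^ (((n : ℝ) + s * p) / n)), le_max_left _ _, fun h hm a ha hA => ?_⟩
  -- A ball of this radius has volume 2a. As the support has measure at most a, the zero set of h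
  -- fills at least measure a of the ball about any x, and there |h x - h y| = |h x|.
  set r := (2 * a / ω) ^ (1 / (n : ℝ)) with hr
  have hr0 : 0 < r := by positivity
  have hrn : r ^ (n : ℝ) = 2 * a / ω := by
    rw [hr, ← Real.rpow_mul (by positivity), one_div_mul_cancel hn0.ne', Real.rpow_one]
  have hrq : r ^ ((n : ℝ) + s * p) = (2 / ω) ^ (((n : ℝ) + s * p) / n) * a ^ (s * p / n) * a := by
    rw [hr, ← Real.rpow_mul (by positivity), show 2 * a / ω = 2 / ω * a by ring,
      Real.mul_rpow (by positivity) ha.le, mul_assoc, ← Real.rpow_add_one ha.ne']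
    congr 2
    · ring
    · field_simp
      ring
  have hne : MeasurableSet {x | h x ≠ 0} := (measurableSet_singleton (0:ℝ)).compl.preimage hm
  have key : ∀ x, ENNReal.ofReal (|h x| ^ p) ≤ ENNReal.ofReal (r ^ ((n : ℝ) + s * p) / a) *
      ∫⁻ y, ENNReal.ofReal (|h x - h y| ^ p * ‖x - y‖ ^ (-((n : ℝ) + s * p))) := by
    intro x
    by_cases hx : h x = 0
    · simp [hx, Real.zero_rpow (by linarith : p ≠ 0)]
    have hvol : ENNReal.ofReal a ≤ volume (Metric.ball x r \ {x | h x ≠ 0}) := by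
      have h1 : volume (Metric.ball x r) = ENNReal.ofReal (2 * a) := by
        rw [volume_ball_eq x hr0, hrn, ← hω]; congr 1; field_simp
      calc ENNReal.ofReal a = ENNReal.ofReal (2 * a) - ENNReal.ofReal a := by
            rw [← ENNReal.ofReal_sub _ ha.le]; congr 1; ring
        _ ≤ volume (Metric.ball x r) - volume {x | h x ≠ 0} := by rw [h1]; gcongr
        _ ≤ _ := le_measure_sdiff
    have h2 : ENNReal.ofReal (|h x| ^ p * r ^ (-((n : ℝ) + s * p))) * ENNReal.ofReal a ≤
        ∫⁻ y, ENNReal.ofReal (|h x - h y| ^ p * ‖x - y‖ ^ (-((n : ℝ) + s * p))) := by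
      calc _ ≤ ENNReal.ofReal (|h x| ^ p * r ^ (-((n : ℝ) + s * p))) *
            volume (Metric.ball x r \ {x | h x ≠ 0}) := by gcongr
        _ = ∫⁻ y in Metric.ball x r \ {x | h x ≠ 0},
            ENNReal.ofReal (|h x| ^ p * r ^ (-((n : ℝ) + s * p))) := by rw [setLIntegral_const]
        _ ≤ ∫⁻ y in Metric.ball x r \ {x | h x ≠ 0},
            ENNReal.ofReal (|h x - h y| ^ p * ‖x - y‖ ^ (-((n : ℝ) + s * p))) := by
          refine setLIntegral_mono' (Metric.isOpen_ball.measurableSet.diff hne) fun y hy => ?_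
          have hy0 : h y = 0 := by simpa using hy.2
          have hxy : 0 < ‖x - y‖ := by
            rw [norm_pos_iff, sub_ne_zero]; rintro rfl; exact hx hy0
          have hlt : ‖x - y‖ < r := by
            have := hy.1
            rwa [mem_ball_iff_norm, norm_sub_rev] at this
          rw [hy0, sub_zero]
          gcongr ENNReal.ofReal (_ * ?_)
          exact Real.rpow_le_rpow_of_nonpos hxy hlt.le (by linarith)
        _ ≤ _ := setLIntegral_le_lintegral _ _
    calc ENNReal.ofReal (|h x| ^ p) = ENNReal.ofReal (r ^ ((n : ℝ) + s * p) / a) *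
          (ENNReal.ofReal (|h x| ^ p * r ^ (-((n : ℝ) + s * p))) * ENNReal.ofReal a) := by
          rw [← ENNReal.ofReal_mul (by positivity), ← ENNReal.ofReal_mul (by positivity)]
          congr 1
          rw [Real.rpow_neg hr0.le]
          have : r ^ ((n : ℝ) + s * p) ≠ 0 := by positivity
          field_simp
      _ ≤ _ := by gcongr
  calc ∫⁻ x, ENNReal.ofReal (|h x| ^ p) ≤ ∫⁻ x, ENNReal.ofReal (r ^ ((n : ℝ) + s * p) / a) *
      ∫⁻ y, ENNReal.ofReal (|h x - h y| ^ p * ‖x - y‖ ^ (-((n : ℝ) + s * p))) :=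
        lintegral_mono key
    _ = ENNReal.ofReal (r ^ ((n : ℝ) + s * p) / a) * ∫⁻ x, 
      ∫⁻ y, ENNReal.ofReal (|h x - h y| ^ p * ‖x - y‖ ^ (-((n : ℝ) + s * p))) :=
        lintegral_const_mul' _ _ ENNReal.ofReal_ne_top
    _ ≤ _ := by
      gcongr
      rw [hrq, mul_div_assoc, div_self ha.ne', mul_one]
      gcongr
      exact le_max_right _ _

/-! ### Cutoffs, the weak form and admissible test functions -/

/-- A Lipschitz cutoff function: it vanishes outside the ball of radius `m` about `x₀`, has
Lipschitz constant `L` and equals `1` on the ball of radius `m - 1 / L`. -/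
noncomputable def cutoff {n : ℕ} (x₀ : Eucl n) (m L : ℝ) (x : Eucl n) : ℝ :=
  max 0 (min 1 (L * (m - ‖x - x₀‖)))

section cutoff
variable {n : ℕ} (x₀ : Eucl n) (m L : ℝ)

lemma cutoff_nonneg (x : Eucl n) : 0 ≤ cutoff x₀ m L x := le_max_left _ _

lemma cutoff_le_one (x : Eucl n) : cutoff x₀ m L x ≤ 1 :=
  max_le zero_le_one (min_le_left _ _)

lemma measurable_cutoff : Measurable (cutoff x₀ m L) := by
  unfold cutoff; fun_prop

variable {m L}

lemma cutoff_eq_zero (hL : 0 < L) {x : Eucl n} (hx : m ≤ ‖x - x₀‖) : cutoff x₀ m L x = 0 := by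
  apply max_eq_left
  exact (min_le_right _ _).trans (mul_nonpos_of_nonneg_of_nonpos hL.le (by linarith))

lemma cutoff_eq_one {x : Eucl n} (hx : 1 ≤ L * (m - ‖x - x₀‖)) : cutoff x₀ m L x = 1 := by
  rw [cutoff, min_eq_left hx, max_eq_right zero_le_one]

/-- The p-th power of the bound must be integrable against the kernel: the Lipschitz bound serves
near the diagonal, the bound 1 at infinity. -/
lemma abs_cutoff_sub_le (hL : 0 < L) (x y : Eucl n) :
    |cutoff x₀ m L x - cutoff x₀ m L y| ≤ min 1 (L * ‖y - x‖) := by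
  apply le_min
  · rw [abs_le]
    constructor <;> linarith [cutoff_nonneg x₀ m L x, cutoff_nonneg x₀ m L y,
      cutoff_le_one x₀ m L x, cutoff_le_one x₀ m L y]
  · unfold cutoff
    refine (abs_max_sub_max_le_max _ _ _ _).trans (max_le (by simp; positivity) ?_)
    refine (abs_min_sub_min_le_max _ _ _ _).trans (max_le (by simp; positivity) ?_)
    rw [← mul_sub, abs_mul, abs_of_pos hL]
    gcongr
    have := abs_norm_sub_norm_le (y - x₀) (x - x₀)
    rwa [show m - ‖x - x₀‖ - (m - ‖y - x₀‖) = ‖y - x₀‖ - ‖x - x₀‖ by ring,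
      show y - x = y - x₀ - (x - x₀) by abel]

end cutoff

lemma gagliardo_eq {n : ℕ} (s p : ℝ) (D : Set (Eucl n × Eucl n)) (u : Eucl n → ℝ) :
    gagliardo s p D u = ∫⁻ z in D,
      ENNReal.ofReal (|u z.1 - u z.2| ^ p * ‖z.1 - z.2‖ ^ (-((n : ℝ) + s * p))) := by
  simp only [gagliardo, Real.rpow_neg (norm_nonneg _), div_eq_mul_inv]

lemma lintegral_fst_mul_min_kernel_le {n : ℕ} (hn : 1 ≤ n) {s p : ℝ} (hs0 : 0 < s) (hs1 : s < 1)
    (hp : 1 < p) :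
    ∃ C : ℝ, 1 ≤ C ∧ ∀ (W : Eucl n → ℝ≥0∞), Measurable W → ∀ L : ℝ, 0 < L →
      ∫⁻ z : Eucl n × Eucl n, W z.1 * ENNReal.ofReal
        (min 1 (L * ‖z.2 - z.1‖) ^ p * ‖z.1 - z.2‖ ^ (-((n : ℝ) + s * p))) ≤
      ENNReal.ofReal (C * L ^ (s * p)) * ∫⁻ x, W x := by
  obtain ⟨C, hC, h⟩ := exists_lintegral_min_kernel_le hn hs0 hs1 hp
  refine ⟨C, hC, fun W hW L hL => ?_⟩
  rw [Measure.volume_eq_prod, lintegral_prod _ (by fun_prop), mul_comm (ENNReal.ofReal _),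
    ← lintegral_mul_const' _ _ ENNReal.ofReal_ne_top]
  refine lintegral_mono fun x => ?_
  simp only
  rw [lintegral_const_mul _ (by fun_prop)]
  gcongr
  refine le_of_eq_of_le (lintegral_congr fun y => ?_) (h x L hL)
  rw [norm_sub_rev x y]

lemma lintegral_snd_mul_eq_fst {n : ℕ} (W : Eucl n → ℝ≥0∞) (H : Eucl n × Eucl n → ℝ≥0∞)
    (hH : ∀ z, H z.swap = H z) :
    ∫⁻ z : Eucl n × Eucl n, W z.2 * H z = ∫⁻ z : Eucl n × Eucl n, W z.1 * H z := by
  rw [Measure.volume_eq_prod, ← lintegral_prod_swap]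
  simp [hH]

/-- The integrand of the weak formulation is integrable. -/
lemma integrable_form {n : ℕ} {s p Λ : ℝ} (hp : 1 < p) (hΛ : 1 ≤ Λ)
    {K : Eucl n → Eucl n → ℝ} (hK : IsKernel s p Λ K) {Ω : Set (Eucl n)}
    (hΩ : MeasurableSet Ω) {u φ : Eucl n → ℝ} (hu : Measurable u) (hφ : Measurable φ)
    (hE : gagliardo s p (Ωᶜ ×ˢ Ωᶜ)ᶜ u < ⊤) (hG : gagliardo s p (univ ×ˢ univ) φ < ⊤)
    (h0 : ∀ x ∉ Ω, φ x = 0) :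
    Integrable (fun z : Eucl n × Eucl n =>
      oddPow p (u z.1 - u z.2) * (φ z.1 - φ z.2) * K z.1 z.2) := by
  rw [gagliardo_eq] at hE hG
  rw [← lintegral_indicator (hΩ.compl.prod hΩ.compl).compl] at hE
  rw [univ_prod_univ, setLIntegral_univ] at hG
  refine ⟨?_, ?_⟩
  · refine (AEMeasurable.mul (Measurable.aemeasurable ?_) hK.aemeasurable).aestronglyMeasurable
    unfold oddPow
    fun_prop
  · rw [hasFiniteIntegral_iff_norm]
    have hfin : ENNReal.ofReal Λ * (∫⁻ z, ((Ωᶜ ×ˢ Ωᶜ)ᶜ.indicator (fun z : Eucl n × Eucl n =>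
        ENNReal.ofReal (|u z.1 - u z.2| ^ p * ‖z.1 - z.2‖ ^ (-((n : ℝ) + s * p)))) z +
        ENNReal.ofReal (|φ z.1 - φ z.2| ^ p * ‖z.1 - z.2‖ ^ (-((n : ℝ) + s * p))))) < ⊤ := by
      rw [lintegral_add_right _ (by fun_prop)]
      exact ENNReal.mul_lt_top ENNReal.ofReal_lt_top (ENNReal.add_lt_top.2 ⟨hE, hG⟩)
    refine lt_of_le_of_lt ?_ hfin
    rw [← lintegral_const_mul' _ _ ENNReal.ofReal_ne_top]
    refine lintegral_mono_ae ?_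
    filter_upwards [hK.upper] with z hz
    -- Nothing is known about the energy of u on pairs lying outside Ω, but φ vanishes at both
    -- points there. On all other pairs X^(p-1) Y ≤ X^p + Y^p.
    by_cases hzD : z ∈ (Ωᶜ ×ˢ Ωᶜ)
    · have h1 := h0 z.1 hzD.1
      have h2 := h0 z.2 hzD.2
      simp [h1, h2]
    · rw [indicator_of_mem hzD, ← ENNReal.ofReal_add (by positivity) (by positivity),
        ← ENNReal.ofReal_mul (by linarith)]
      apply ENNReal.ofReal_le_ofReal
      rw [norm_mul, norm_mul, Real.norm_eq_abs, Real.norm_eq_abs, Real.norm_eq_abs,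
        abs_oddPow hp, abs_of_nonneg (hK.nonneg _ _)]
      have hz' : K z.1 z.2 ≤ Λ * ‖z.1 - z.2‖ ^ (-((n : ℝ) + s * p)) := by
        rwa [Real.rpow_neg (norm_nonneg _), ← div_eq_mul_inv]
      have hy : |u z.1 - u z.2| ^ (p - 1) * |φ z.1 - φ z.2| ≤
          |u z.1 - u z.2| ^ p + |φ z.1 - φ z.2| ^ p := by
        rcases le_total |u z.1 - u z.2| |φ z.1 - φ z.2| with h | h
        · have : |u z.1 - u z.2| ^ (p - 1) * |φ z.1 - φ z.2| ≤
              |φ z.1 - φ z.2| ^ (p - 1) * |φ z.1 - φ z.2| := by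
            gcongr
          rw [rpow_sub_one_mul_self (abs_nonneg _) hp] at this
          have h3 : 0 ≤ |u z.1 - u z.2| ^ p := by positivity
          linarith
        · have : |u z.1 - u z.2| ^ (p - 1) * |φ z.1 - φ z.2| ≤
              |u z.1 - u z.2| ^ (p - 1) * |u z.1 - u z.2| := by
            gcongr
          rw [rpow_sub_one_mul_self (abs_nonneg _) hp] at this
          have h3 : 0 ≤ |φ z.1 - φ z.2| ^ p := by positivity
          linarith
      calc _ ≤ (|u z.1 - u z.2| ^ p + |φ z.1 - φ z.2| ^ p) *
            (Λ * ‖z.1 - z.2‖ ^ (-((n : ℝ) + s * p))) :=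
          mul_le_mul hy hz' (hK.nonneg _ _) (by positivity)
        _ = _ := by ring

/-- The truncation `(u - k)₊`. -/
noncomputable def excess {n : ℕ} (u : Eucl n → ℝ) (k : ℝ) (x : Eucl n) : ℝ := max (u x - k) 0

lemma excess_nonneg {n : ℕ} (u : Eucl n → ℝ) (k : ℝ) (x : Eucl n) : 0 ≤ excess u k x :=
  le_max_right _ _

lemma measurable_excess {n : ℕ} {u : Eucl n → ℝ} (hu : Measurable u) (k : ℝ) :
    Measurable (excess u k) := by
  unfold excess; fun_prop

lemma abs_excess_sub_le {n : ℕ} (u : Eucl n → ℝ) (k : ℝ) (x y : Eucl n) :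
    |excess u k x - excess u k y| ≤ |u x - u y| := by
  unfold excess
  refine (abs_max_sub_max_le_abs _ _ _).trans (le_of_eq ?_)
  congr 1; ring

/-- `η ^ p (u - k)₊` is an admissible test function. -/
lemma memFracSobolev_cutoff_mul_excess {n : ℕ} (hn : 1 ≤ n) {s p : ℝ} (hs0 : 0 < s) (hs1 : s < 1)
    (hp : 1 < p) {Ω : Set (Eucl n)} (hΩ : MeasurableSet Ω) (hb : Bornology.IsBounded Ω)
    {u : Eucl n → ℝ} (hu : Measurable u) (hE : MemEnergySpace s p Ω u) (k : ℝ)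
    (x₀ : Eucl n) {m L : ℝ} (hL : 0 < L) (hm : Metric.closedBall x₀ m ⊆ Ω) :
    MemFracSobolev s p univ (fun x => cutoff x₀ m L x ^ p * excess u k x) := by
  have hp0 : 0 < p := by linarith
  set η := cutoff x₀ m L with hη
  have hηm : Measurable η := measurable_cutoff x₀ m L
  set w := excess u k with hw
  have hwm : Measurable w := measurable_excess hu k
  have hw0 : ∀ x, 0 ≤ w x := excess_nonneg u k
  have hη0 : ∀ x, 0 ≤ η x := cutoff_nonneg x₀ m L
  have hη1 : ∀ x, η x ≤ 1 := cutoff_le_one x₀ m L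
  have hξ0 : ∀ x, 0 ≤ η x ^ p := fun x => Real.rpow_nonneg (hη0 x) p
  have hξ1 : ∀ x, η x ^ p ≤ 1 := fun x => Real.rpow_le_one (hη0 x) (hη1 x) hp0.le
  have hηz : ∀ x ∉ Ω, η x = 0 := fun x hx => by
    apply cutoff_eq_zero x₀ hL
    by_contra h
    exact hx (hm (by rw [mem_closedBall_iff_norm]; linarith))
  have : IsFiniteMeasure (volume.restrict Ω) := ⟨by
    rw [Measure.restrict_apply_univ]; exact hb.measure_lt_top⟩
  have hwL : MemLp w (ENNReal.ofReal p) (volume.restrict Ω) := by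
    have h1 : MemLp (fun x => u x - k) (ENNReal.ofReal p) (volume.restrict Ω) :=
      hE.2.1.sub (memLp_const k)
    refine h1.of_le hwm.aestronglyMeasurable (Filter.Eventually.of_forall fun x => ?_)
    rw [Real.norm_of_nonneg (hw0 x), Real.norm_eq_abs, hw]
    exact max_le (le_abs_self _) (abs_nonneg _)
  have hφm : Measurable fun x => η x ^ p * w x := by fun_prop
  refine ⟨?_, ?_⟩
  · rw [Measure.restrict_univ]
    have h1 : (fun x => η x ^ p * w x) = Ω.indicator fun x => η x ^ p * w x := by
      ext x
      by_cases hx : x ∈ Ω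
      · rw [indicator_of_mem hx]
      · rw [indicator_of_notMem hx, hηz x hx, Real.zero_rpow hp0.ne', zero_mul]
    rw [h1, memLp_indicator_iff_restrict hΩ]
    refine hwL.of_le hφm.aestronglyMeasurable (Filter.Eventually.of_forall fun x => ?_)
    rw [norm_mul, Real.norm_of_nonneg (hξ0 x)]
    exact mul_le_of_le_one_left (norm_nonneg _) (hξ1 x)
  · have hE3 := hE.2.2
    rw [gagliardo_eq, ← lintegral_indicator (hΩ.compl.prod hΩ.compl).compl] at hE3
    rw [gagliardo_eq, univ_prod_univ, setLIntegral_univ]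
    set W : Eucl n → ℝ≥0∞ := Ω.indicator fun x => ENNReal.ofReal (w x ^ p) with hW
    have hWm : Measurable W := Measurable.indicator (by fun_prop) hΩ
    have hWfin : ∫⁻ x, W x < ⊤ := by
      rw [hW, lintegral_indicator hΩ]
      have := lintegral_rpow_enorm_lt_top_of_eLpNorm_lt_top (by simpa using hp0)
        ENNReal.ofReal_ne_top hwL.2
      refine lt_of_eq_of_lt (lintegral_congr fun x => ?_) this
      rw [Real.enorm_of_nonneg (hw0 x), ENNReal.toReal_ofReal hp0.le,
        ENNReal.ofReal_rpow_of_nonneg (hw0 x) hp0.le]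
    obtain ⟨C, -, hC⟩ := lintegral_fst_mul_min_kernel_le hn hs0 hs1 hp (n := n)
    set H : Eucl n × Eucl n → ℝ≥0∞ := fun z => ENNReal.ofReal
        (min 1 (L * ‖z.2 - z.1‖) ^ p * ‖z.1 - z.2‖ ^ (-((n : ℝ) + s * p))) with hH
    have hHm : Measurable H := by fun_prop
    have hHs : ∀ z, H z.swap = H z := fun z => by
      simp [hH, norm_sub_rev z.1 z.2]
    have h1 : ∫⁻ z : Eucl n × Eucl n, W z.1 * H z < ⊤ :=
      (hC W hWm L hL).trans_lt (ENNReal.mul_lt_top ENNReal.ofReal_lt_top hWfin)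
    have h2 : ∫⁻ z : Eucl n × Eucl n, W z.2 * H z < ⊤ := by
      rwa [lintegral_snd_mul_eq_fst W H hHs]
    have hfin : ENNReal.ofReal (2 ^ p) * ∫⁻ z, ((Ωᶜ ×ˢ Ωᶜ)ᶜ.indicator (fun z : Eucl n × Eucl n =>
        ENNReal.ofReal (|u z.1 - u z.2| ^ p * ‖z.1 - z.2‖ ^ (-((n : ℝ) + s * p)))) z +
        ENNReal.ofReal (p ^ p) * (W z.1 * H z + W z.2 * H z)) < ⊤ := by
      rw [lintegral_add_right _ (by fun_prop), lintegral_const_mul' _ _ ENNReal.ofReal_ne_top,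
        lintegral_add_right _ (by fun_prop)]
      exact ENNReal.mul_lt_top ENNReal.ofReal_lt_top (ENNReal.add_lt_top.2 ⟨hE3,
        ENNReal.mul_lt_top ENNReal.ofReal_lt_top (ENNReal.add_lt_top.2 ⟨h1, h2⟩)⟩)
    refine lt_of_le_of_lt ?_ hfin
    rw [← lintegral_const_mul' _ _ ENNReal.ofReal_ne_top]
    refine lintegral_mono fun z => ?_
    obtain ⟨x, y⟩ := z
    simp only
    -- The power p is p-Lipschitz on [0, 1], so η^p inherits the bound for η with a factor p.
    have hξ : |η x ^ p - η y ^ p| ≤ p * min 1 (L * ‖y - x‖) := by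
      have hd := abs_cutoff_sub_le x₀ (m := m) hL x y
      rw [← hη] at hd
      have aux : ∀ a b : ℝ, 0 ≤ a → a ≤ b → b ≤ 1 → |a ^ p - b ^ p| ≤ p * |a - b| := by
        intro a b ha hab hb1
        have h1 := rpow_sub_rpow_le hp ha hab
        have h2 : a ^ p ≤ b ^ p := Real.rpow_le_rpow ha hab hp0.le
        rw [abs_of_nonpos (by linarith), abs_of_nonpos (by linarith)]
        have h3 : b ^ (p - 1) ≤ 1 := Real.rpow_le_one (ha.trans hab) hb1 (by linarith)
        have h4 : p * b ^ (p - 1) * (b - a) ≤ p * 1 * (b - a) := by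
          have : 0 ≤ b - a := by linarith
          gcongr
        linarith
      refine le_trans ?_ (mul_le_mul_of_nonneg_left hd hp0.le)
      rcases le_total (η x) (η y) with h | h
      · exact aux _ _ (hη0 x) h (hη1 y)
      · rw [abs_sub_comm, abs_sub_comm (η x)]; exact aux _ _ (hη0 y) h (hη1 x)
    have hmin0 : 0 ≤ min 1 (L * ‖y - x‖) := le_min zero_le_one (by positivity)
    have hκ : 0 ≤ ‖x - y‖ ^ (-((n : ℝ) + s * p)) := by positivity
    have key : ∀ a : ℝ, 0 ≤ a →
        |η x ^ p * w x - η y ^ p * w y| ≤ |u x - u y| + a * (p * min 1 (L * ‖y - x‖)) →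
        ENNReal.ofReal (|η x ^ p * w x - η y ^ p * w y| ^ p * ‖x - y‖ ^ (-((n : ℝ) + s * p))) ≤
        ENNReal.ofReal (2 ^ p) * (ENNReal.ofReal (|u x - u y| ^ p * ‖x - y‖ ^ (-((n : ℝ) + s * p))) +
        ENNReal.ofReal (p ^ p) * (ENNReal.ofReal (a ^ p) * H (x, y))) := by
      intro a ha h
      rw [hH]
      simp only
      rw [← ENNReal.ofReal_mul (by positivity), ← ENNReal.ofReal_mul (by positivity),
        ← ENNReal.ofReal_add (by positivity) (by positivity), ← ENNReal.ofReal_mul (by positivity)]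
      apply ENNReal.ofReal_le_ofReal
      have h3 := (Real.rpow_le_rpow (abs_nonneg _) h hp0.le).trans
        (add_rpow_le_two_rpow_mul (abs_nonneg _) (by positivity) hp0.le)
      rw [Real.mul_rpow ha (by positivity), Real.mul_rpow hp0.le hmin0] at h3
      refine (mul_le_mul_of_nonneg_right h3 hκ).trans (le_of_eq (by ring))
    by_cases hxy : (x, y) ∈ Ωᶜ ×ˢ Ωᶜ
    · rw [hηz x hxy.1, hηz y hxy.2]
      simp [Real.zero_rpow hp0.ne']
    rw [indicator_of_mem hxy]
    have hd := abs_excess_sub_le u k x y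
    rw [← hw] at hd
    -- The product rule puts the factor w at x or at y. It has to be put at a point of Ω, because w
    -- is p-integrable only there.
    by_cases hx : x ∈ Ω
    · refine (key (w x) (hw0 x) ?_).trans ?_
      · have e1 : η x ^ p * w x - η y ^ p * w y =
            η y ^ p * (w x - w y) + w x * (η x ^ p - η y ^ p) := by ring
        rw [e1]
        refine (abs_add_le _ _).trans ?_
        rw [abs_mul, abs_mul, abs_of_nonneg (hξ0 y), abs_of_nonneg (hw0 x)]
        exact add_le_add ((mul_le_of_le_one_left (abs_nonneg _) (hξ1 y)).trans hd)
          (mul_le_mul_of_nonneg_left hξ (hw0 x))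
      · have : ENNReal.ofReal (w x ^ p) = W x := by rw [hW, indicator_of_mem hx]
        rw [this]
        gcongr
        exact le_self_add
    · have hy : y ∈ Ω := by
        by_contra hy; exact hxy ⟨hx, hy⟩
      refine (key (w y) (hw0 y) ?_).trans ?_
      · have e1 : η x ^ p * w x - η y ^ p * w y =
            η x ^ p * (w x - w y) + w y * (η x ^ p - η y ^ p) := by ring
        rw [e1]
        refine (abs_add_le _ _).trans ?_
        rw [abs_mul, abs_mul, abs_of_nonneg (hξ0 x), abs_of_nonneg (hw0 y)]
        exact add_le_add ((mul_le_of_le_one_left (abs_nonneg _) (hξ1 x)).trans hd)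
          (mul_le_mul_of_nonneg_left hξ (hw0 y))
      · have : ENNReal.ofReal (w y ^ p) = W y := by rw [hW, indicator_of_mem hy]
        rw [this]
        gcongr
        exact le_add_self

/-! ### The Caccioppoli estimate -/

/-- The weak formulation gives only the Bochner integral of F, which may change sign. Since F + E
dominates G ≥ 0, it is nonnegative almost everywhere, and its Bochner integral can be read as a
Lebesgue integral. -/
lemma lintegral_ofReal_le_of_le_add {α : Type*} [MeasurableSpace α] {μ : Measure α}
    {F E G : α → ℝ} (hF : Integrable F μ) (hE : AEStronglyMeasurable E μ) (hE0 : ∀ x, 0 ≤ E x)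
    (hG0 : ∀ x, 0 ≤ G x)
    (h : ∀ᵐ x ∂μ, G x ≤ F x + E x) {e f : ℝ} (he : 0 ≤ e)
    (hEe : ∫⁻ x, ENNReal.ofReal (E x) ∂μ ≤ ENNReal.ofReal e) (hFf : ∫ x, F x ∂μ ≤ f) :
    ∫⁻ x, ENNReal.ofReal (G x) ∂μ ≤ ENNReal.ofReal (f + e) := by
  have hEi : Integrable E μ := by
    refine ⟨hE, ?_⟩
    rw [hasFiniteIntegral_iff_ofReal (Filter.Eventually.of_forall hE0)]
    exact hEe.trans_lt ENNReal.ofReal_lt_top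
  have hEint : ∫ x, E x ∂μ ≤ e := by
    rw [integral_eq_lintegral_of_nonneg_ae (Filter.Eventually.of_forall hE0) hE]
    exact ENNReal.toReal_le_of_le_ofReal he hEe
  calc ∫⁻ x, ENNReal.ofReal (G x) ∂μ ≤ ∫⁻ x, ENNReal.ofReal (F x + E x) ∂μ := by
        refine lintegral_mono_ae ?_
        filter_upwards [h] with x hx using ENNReal.ofReal_le_ofReal hx
    _ = ENNReal.ofReal (∫ x, (F x + E x) ∂μ) := by
        refine (ofReal_integral_eq_lintegral_ofReal (f := fun x => F x + E x) (hF.add hEi) ?_).symm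
        filter_upwards [h] with x hx using (hG0 x).trans hx
    _ ≤ _ := by
        rw [integral_add hF hEi]
        exact ENNReal.ofReal_le_ofReal (add_le_add hFf hEint)

/-- The error density in the Caccioppoli estimate. -/
noncomputable def cutoffError {n : ℕ} (p : ℝ) (B : Set (Eucl n)) (w η : Eucl n → ℝ) (L : ℝ)
    (x y : Eucl n) : ℝ :=
  B.indicator (fun x => w x ^ p) x * min 1 (L * ‖y - x‖) ^ p +
    Bᶜ.indicator (fun y => w y ^ (p - 1)) y * (w x * η x ^ p)

lemma cutoffError_nonneg {n : ℕ} {p : ℝ} {B : Set (Eucl n)} {w η : Eucl n → ℝ} {L : ℝ}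
    (hL : 0 < L) (hw : ∀ x, 0 ≤ w x) (hη : ∀ x, 0 ≤ η x) (x y : Eucl n) :
    0 ≤ cutoffError p B w η L x y := by
  have h1 : 0 ≤ min 1 (L * ‖y - x‖) := le_min zero_le_one (by positivity)
  have h2 : 0 ≤ B.indicator (fun x => w x ^ p) x :=
    indicator_nonneg (fun x _ => Real.rpow_nonneg (hw x) _) _
  have h3 : 0 ≤ Bᶜ.indicator (fun y => w y ^ (p - 1)) y :=
    indicator_nonneg (fun x _ => Real.rpow_nonneg (hw x) _) _
  have h4 := hw x
  have h5 := hη x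
  unfold cutoffError
  positivity

/-- Inside B this is `oddPow_cutoff`. If one point lies outside B its cutoff value is 0 and
`oddPow_cutoff_tail` applies at the other point. Only one of the two symmetric interaction terms is
kept, as the other is nonnegative. -/
lemma caccioppoli_pointwise {n : ℕ} {p : ℝ} (hp : 1 < p) {B : Set (Eucl n)} {η : Eucl n → ℝ}
    {L : ℝ} (hL : 0 < L) (hη : ∀ x, 0 ≤ η x) (hηB : ∀ x ∉ B, η x = 0)
    (hηL : ∀ x y, |η x - η y| ≤ min 1 (L * ‖y - x‖)) (u : Eucl n → ℝ) (k : ℝ) (x y : Eucl n) :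
    2 ^ (-(p + 1)) * (|η x * excess u k x - η y * excess u k y| ^ p +
        max (k - u y) 0 ^ (p - 1) * excess u k x * η x ^ p) ≤
      oddPow p (u x - u y) * (η x ^ p * excess u k x - η y ^ p * excess u k y) +
        (2 ^ p * p ^ p + 2) *
          (cutoffError p B (excess u k) η L x y + cutoffError p B (excess u k) η L y x) := by
  have hw := excess_nonneg u k
  have hp0 : p ≠ 0 := by linarith
  have hp1 : p - 1 ≠ 0 := by linarith
  have hC : (0:ℝ) ≤ 2 ^ p * p ^ p := by positivity
  have hc0 : (0:ℝ) < 2 ^ (-(p + 1)) := by positivity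
  have hxy := cutoffError_nonneg (p := p) (B := B) hL hw hη x y
  have hyx := cutoffError_nonneg (p := p) (B := B) hL hw hη y x
  have hsub : u x - u y = (u x - k) - (u y - k) := by ring
  by_cases hy : y ∈ B
  · by_cases hx : x ∈ B
    · have h := oddPow_cutoff (u x - k) (u y - k) hp (hη x) (hη y)
      rw [← hsub, neg_sub, neg_sub] at h
      have h1 : 0 ≤ max (k - u x) 0 ^ (p - 1) * max (u y - k) 0 * η y ^ p := by
        have := hη y; positivity
      have hmin : |η x - η y| ^ p ≤ min 1 (L * ‖y - x‖) ^ p :=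
        Real.rpow_le_rpow (abs_nonneg _) (hηL x y) (by linarith)
      have e1 : cutoffError p B (excess u k) η L x y =
          max (u x - k) 0 ^ p * min 1 (L * ‖y - x‖) ^ p := by
        simp [cutoffError, hx, hy, excess]
      have e2 : cutoffError p B (excess u k) η L y x =
          max (u y - k) 0 ^ p * min 1 (L * ‖y - x‖) ^ p := by
        simp [cutoffError, hx, hy, excess, norm_sub_rev x y]
      have h2 : (max (u x - k) 0 ^ p + max (u y - k) 0 ^ p) * |η x - η y| ^ p ≤
          cutoffError p B (excess u k) η L x y + cutoffError p B (excess u k) η L y x := by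
        rw [e1, e2, ← add_mul]
        gcongr
      have h3 : (2 ^ p * p ^ p + 1) * ((max (u x - k) 0 ^ p + max (u y - k) 0 ^ p) *
          |η x - η y| ^ p) ≤ (2 ^ p * p ^ p + 2) * (cutoffError p B (excess u k) η L x y +
            cutoffError p B (excess u k) η L y x) :=
        mul_le_mul (by linarith) h2 (by positivity) (by linarith)
      unfold excess at *
      nlinarith [mul_nonneg hc0.le h1]
    · have h := oddPow_cutoff_tail (u y - k) (u x - k) hp (hη y)
      rw [neg_sub] at h
      have e2 : max (u x - k) 0 ^ (p - 1) * max (u y - k) 0 * η y ^ p ≤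
          cutoffError p B (excess u k) η L y x := by
        have : cutoffError p B (excess u k) η L y x = _ := rfl
        rw [this]
        unfold cutoffError excess
        rw [indicator_of_mem (by simpa using hx : x ∈ Bᶜ)]
        have : 0 ≤ B.indicator (fun x => max (u x - k) 0 ^ p) y :=
          indicator_nonneg (fun x _ => by positivity) _
        have h1 : 0 ≤ min 1 (L * ‖x - y‖) := le_min zero_le_one (by positivity)
        have : 0 ≤ B.indicator (fun x => max (u x - k) 0 ^ p) y * min 1 (L * ‖x - y‖) ^ p := by
          positivity
        linarith
      have h4 : 0 ≤ max (k - u x) 0 ^ (p - 1) * max (u y - k) 0 * η y ^ p := by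
        have := hη y; positivity
      rw [hηB x hx, zero_mul, zero_sub, abs_neg, abs_of_nonneg (mul_nonneg (hη y) (hw y)),
        Real.zero_rpow hp0, mul_zero, add_zero, zero_mul, zero_sub, hsub,
        ← neg_sub (u y - k), oddPow_neg]
      have h3 : 2 * (max (u x - k) 0 ^ (p - 1) * max (u y - k) 0 * η y ^ p) ≤
          (2 ^ p * p ^ p + 2) * (cutoffError p B (excess u k) η L x y +
            cutoffError p B (excess u k) η L y x) := by
        refine mul_le_mul (by linarith) (by linarith) ?_ (by linarith)
        have := hη y; positivity
      unfold excess at *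
      nlinarith [mul_nonneg hc0.le h4]
  · have h := oddPow_cutoff_tail (u x - k) (u y - k) hp (hη x)
    rw [neg_sub] at h
    have e2 : max (u y - k) 0 ^ (p - 1) * max (u x - k) 0 * η x ^ p ≤
        cutoffError p B (excess u k) η L x y := by
      unfold cutoffError excess
      rw [indicator_of_mem (by simpa using hy : y ∈ Bᶜ)]
      have : 0 ≤ B.indicator (fun x => max (u x - k) 0 ^ p) x :=
        indicator_nonneg (fun x _ => by positivity) _
      have h1 : 0 ≤ min 1 (L * ‖y - x‖) := le_min zero_le_one (by positivity)
      have : 0 ≤ B.indicator (fun x => max (u x - k) 0 ^ p) x * min 1 (L * ‖y - x‖) ^ p := by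
        positivity
      linarith
    rw [hηB y hy, zero_mul, sub_zero, abs_of_nonneg (mul_nonneg (hη x) (hw x)),
      Real.zero_rpow hp0, zero_mul, sub_zero, hsub]
    have h3 : 2 * (max (u y - k) 0 ^ (p - 1) * max (u x - k) 0 * η x ^ p) ≤
        (2 ^ p * p ^ p + 2) * (cutoffError p B (excess u k) η L x y +
          cutoffError p B (excess u k) η L y x) := by
      refine mul_le_mul (by linarith) (by linarith) ?_ (by linarith)
      have := hη x; positivity
    unfold excess at *
    linarith

/-- The right-hand side of the Caccioppoli estimate. -/
noncomputable def energyBound (n : ℕ) (s p r ρ f₀ Y W T : ℝ) : ℝ :=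
  (ρ - r) ^ (-(s * p)) * Y + ((ρ / (ρ - r)) ^ ((n : ℝ) + s * p) * T + f₀) * W

lemma energyBound_nonneg {n : ℕ} {s p r ρ f₀ Y W T : ℝ} (hr : 0 < r) (hrρ : r < ρ) (hf : 0 ≤ f₀)
    (hY : 0 ≤ Y) (hW : 0 ≤ W) (hT : 0 ≤ T) : 0 ≤ energyBound n s p r ρ f₀ Y W T := by
  have h1 : 0 < ρ - r := by linarith
  have h2 : 0 < ρ := by linarith
  unfold energyBound
  positivity

/-- The near part is a truncated-kernel integral, of order (ρ - r)^(-sp) Y. In the far part the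
support of η stays away from the complement of B, so |x - y| can be replaced by |y - x₀| and the
double integral factors into W times T. -/
lemma exists_lintegral_cutoffError_le {n : ℕ} (hn : 1 ≤ n) {s p : ℝ} (hs0 : 0 < s) (hs1 : s < 1)
    (hp : 1 < p) :
    ∃ C : ℝ, 1 ≤ C ∧ ∀ (w : Eucl n → ℝ), Measurable w → (∀ x, 0 ≤ w x) →
      ∀ (x₀ : Eucl n) (r ρ : ℝ), 0 < r → r < ρ → ∀ Y W T f₀ : ℝ, 0 ≤ Y → 0 ≤ W → 0 ≤ T → 0 ≤ f₀ →
      ∫⁻ x in Metric.ball x₀ ρ, ENNReal.ofReal (w x ^ p) ≤ ENNReal.ofReal Y →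
      ∫⁻ x in Metric.ball x₀ ρ, ENNReal.ofReal (w x) ≤ ENNReal.ofReal W →
      ∫⁻ y in (Metric.ball x₀ ρ)ᶜ, ENNReal.ofReal
        (w y ^ (p - 1) * ‖y - x₀‖ ^ (-((n : ℝ) + s * p))) ≤ ENNReal.ofReal T →
      ∫⁻ z : Eucl n × Eucl n, ENNReal.ofReal (cutoffError p (Metric.ball x₀ ρ) w
        (cutoff x₀ ((r + ρ) / 2) (2 / (ρ - r))) (2 / (ρ - r)) z.1 z.2 *
          ‖z.1 - z.2‖ ^ (-((n : ℝ) + s * p))) ≤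
      ENNReal.ofReal (C * energyBound n s p r ρ f₀ Y W T) := by
  obtain ⟨C, hC, h⟩ := lintegral_fst_mul_min_kernel_le hn hs0 hs1 hp (n := n)
  set q := (n : ℝ) + s * p with hq
  have hq0 : 0 < q := by positivity
  refine ⟨max (C * 2 ^ (s * p)) (2 ^ q), le_max_of_le_right
    (Real.one_le_rpow (by norm_num) hq0.le), ?_⟩
  intro w hwm hw0 x₀ r ρ hr hrρ Y W T f₀ hY hW hT hf hYb hWb hTb
  set B := Metric.ball x₀ ρ with hB
  have hBm : MeasurableSet B := Metric.isOpen_ball.measurableSet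
  have hρr : 0 < ρ - r := by linarith
  have hρ : 0 < ρ := by linarith
  set L := 2 / (ρ - r) with hL
  have hL0 : 0 < L := by positivity
  set m := (r + ρ) / 2 with hm
  set η := cutoff x₀ m L with hη
  have hηm : Measurable η := measurable_cutoff x₀ m L
  have hη0 : ∀ x, 0 ≤ η x := cutoff_nonneg x₀ m L
  have hη1 : ∀ x, η x ≤ 1 := cutoff_le_one x₀ m L
  set W1 : Eucl n → ℝ≥0∞ := B.indicator fun x => ENNReal.ofReal (w x ^ p) with hW1
  set W2 : Eucl n → ℝ≥0∞ := B.indicator fun x => ENNReal.ofReal (w x) with hW2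
  set T1 : Eucl n → ℝ≥0∞ := Bᶜ.indicator fun y => ENNReal.ofReal
    (w y ^ (p - 1) * ‖y - x₀‖ ^ (-q)) with hT1
  have hW1m : Measurable W1 := Measurable.indicator (by fun_prop) hBm
  have hW2m : Measurable W2 := Measurable.indicator (by fun_prop) hBm
  have hT1m : Measurable T1 := Measurable.indicator (by fun_prop) hBm.compl
  have key : ∀ z : Eucl n × Eucl n,
      ENNReal.ofReal (cutoffError p B w η L z.1 z.2 * ‖z.1 - z.2‖ ^ (-q)) ≤
      W1 z.1 * ENNReal.ofReal (min 1 (L * ‖z.2 - z.1‖) ^ p * ‖z.1 - z.2‖ ^ (-q)) +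
        ENNReal.ofReal ((2 * (ρ / (ρ - r))) ^ q) * (W2 z.1 * T1 z.2) := by
    rintro ⟨x, y⟩
    simp only
    have hmin0 : 0 ≤ min 1 (L * ‖y - x‖) := le_min zero_le_one (by positivity)
    have hκ : 0 ≤ ‖x - y‖ ^ (-q) := by positivity
    unfold cutoffError
    rw [add_mul]
    refine ENNReal.ofReal_add_le.trans (add_le_add ?_ ?_)
    · by_cases hx : x ∈ B
      · rw [hW1, indicator_of_mem hx, indicator_of_mem hx,
          ← ENNReal.ofReal_mul (Real.rpow_nonneg (hw0 x) _), mul_assoc]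
      · simp [indicator_of_notMem hx]
    · by_cases hy : y ∈ B
      · simp [hy]
      have hy' : y ∈ Bᶜ := hy
      rw [hB, mem_ball_iff_norm, not_lt] at hy
      by_cases hx : ‖x - x₀‖ < m
      · have hxB : x ∈ B := by rw [hB, mem_ball_iff_norm]; linarith
        rw [hW2, hT1, indicator_of_mem hxB, indicator_of_mem hy', indicator_of_mem hy',
          ← ENNReal.ofReal_mul (hw0 x), ← ENNReal.ofReal_mul (by positivity)]
        apply ENNReal.ofReal_le_ofReal
        -- Here |x - y| ≥ ρ - m = (ρ - r)/2 while |x - x₀| < m = (ρ + r)/2, and 1 + (ρ + r)/(ρ - r)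
        -- = 2ρ/(ρ - r).
        have hd : ‖y - x₀‖ ≤ 2 * (ρ / (ρ - r)) * ‖x - y‖ := by
          have h1 : ‖y - x₀‖ ≤ ‖x - y‖ + ‖x - x₀‖ := by
            have := norm_sub_le_norm_sub_add_norm_sub y x x₀
            rwa [norm_sub_rev y x] at this
          rw [show 2 * (ρ / (ρ - r)) * ‖x - y‖ = 2 * ρ * ‖x - y‖ / (ρ - r) by ring,
            le_div_iff₀ hρr]
          nlinarith
        have hy0 : 0 < ‖y - x₀‖ := hρ.trans_le hy
        have hxy0 : 0 < ‖x - y‖ := by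
          by_contra hcon
          have : ‖x - y‖ = 0 := le_antisymm (not_lt.1 hcon) (norm_nonneg _)
          rw [this, mul_zero] at hd
          linarith
        have hκ2 : ‖x - y‖ ^ (-q) ≤ (2 * (ρ / (ρ - r))) ^ q * ‖y - x₀‖ ^ (-q) := by
          have h2 := Real.rpow_le_rpow_of_nonpos hy0 hd (z := -q) (by linarith)
          rw [Real.mul_rpow (by positivity) (norm_nonneg _), Real.rpow_neg (by positivity)] at h2
          have h3 : 0 < (2 * (ρ / (ρ - r))) ^ q := by positivity
          calc ‖x - y‖ ^ (-q) = (2 * (ρ / (ρ - r))) ^ q *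
                (((2 * (ρ / (ρ - r))) ^ q)⁻¹ * ‖x - y‖ ^ (-q)) := by field_simp
            _ ≤ _ := by gcongr
        have hηp : η x ^ p ≤ 1 := Real.rpow_le_one (hη0 x) (hη1 x) (by linarith)
        have hηp0 : 0 ≤ η x ^ p := Real.rpow_nonneg (hη0 x) _
        have hwx := hw0 x
        have hwy : 0 ≤ w y ^ (p - 1) := Real.rpow_nonneg (hw0 y) _
        calc w y ^ (p - 1) * (w x * η x ^ p) * ‖x - y‖ ^ (-q) ≤
              w y ^ (p - 1) * (w x * 1) * ((2 * (ρ / (ρ - r))) ^ q * ‖y - x₀‖ ^ (-q)) := by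
              gcongr
          _ = _ := by ring
      · rw [hη, cutoff_eq_zero x₀ hL0 (not_lt.1 hx), Real.zero_rpow (by linarith)]
        simp
  refine (lintegral_mono key).trans ?_
  rw [lintegral_add_left (by fun_prop), lintegral_const_mul' _ _ ENNReal.ofReal_ne_top]
  have i1 := (h W1 hW1m L hL0)
  rw [hW1, lintegral_indicator hBm] at i1
  have i2 : ∫⁻ z : Eucl n × Eucl n, W2 z.1 * T1 z.2 ≤ ENNReal.ofReal (W * T) := by
    rw [Measure.volume_eq_prod, lintegral_prod_mul hW2m.aemeasurable hT1m.aemeasurable, hW2, hT1,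
      lintegral_indicator hBm, lintegral_indicator hBm.compl, ENNReal.ofReal_mul hW]
    exact mul_le_mul' hWb hTb
  have hLsp : L ^ (s * p) = 2 ^ (s * p) * (ρ - r) ^ (-(s * p)) := by
    rw [hL, Real.div_rpow (by norm_num) hρr.le, Real.rpow_neg hρr.le, div_eq_mul_inv]
  calc _ ≤ ENNReal.ofReal (C * L ^ (s * p)) * ENNReal.ofReal Y +
        ENNReal.ofReal ((2 * (ρ / (ρ - r))) ^ q) * ENNReal.ofReal (W * T) := by
        gcongr
        exact i1.trans (by gcongr)
    _ ≤ _ := by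
        rw [← ENNReal.ofReal_mul (by positivity), ← ENNReal.ofReal_mul (by positivity),
          ← ENNReal.ofReal_add (by positivity) (by positivity)]
        apply ENNReal.ofReal_le_ofReal
        rw [hLsp, Real.mul_rpow (by norm_num) (by positivity), energyBound, ← hq, mul_add]
        apply add_le_add
        · have : C * (2 ^ (s * p) * (ρ - r) ^ (-(s * p))) * Y =
              C * 2 ^ (s * p) * ((ρ - r) ^ (-(s * p)) * Y) := by ring
          rw [this]
          gcongr
          exact le_max_left _ _
        · have e1 : 2 ^ q * (ρ / (ρ - r)) ^ q * (W * T) =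
              2 ^ q * (((ρ / (ρ - r)) ^ q * T) * W) := by ring
          rw [e1]
          gcongr
          · exact le_max_right _ _
          · linarith

/-- The Caccioppoli estimate for weak solutions. -/
theorem exists_caccioppoli {n : ℕ} (hn : 1 ≤ n) {s p Λ : ℝ} (hs0 : 0 < s) (hs1 : s < 1)
    (hp : 1 < p) (hΛ : 1 ≤ Λ) :
    ∃ C : ℝ, 1 ≤ C ∧ ∀ (Ω : Set (Eucl n)), IsOpen Ω → Bornology.IsBounded Ω →
      ∀ (K : Eucl n → Eucl n → ℝ), IsKernel s p Λ K →
      ∀ (f : Eucl n → ℝ) (f₀ : ℝ), MemLp f ⊤ (volume.restrict Ω) →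
        (eLpNorm f ⊤ (volume.restrict Ω)).toReal ≤ f₀ →
      ∀ (u : Eucl n → ℝ), Measurable u → IsWeakSolution s p K Ω f u →
      ∀ (x₀ : Eucl n) (r ρ k : ℝ), 0 < r → r < ρ → Metric.ball x₀ ρ ⊆ Ω →
      ∀ Y W T : ℝ, 0 ≤ Y → 0 ≤ W → 0 ≤ T →
      ∫⁻ x in Metric.ball x₀ ρ, ENNReal.ofReal (excess u k x ^ p) ≤ ENNReal.ofReal Y →
      ∫⁻ x in Metric.ball x₀ ρ, ENNReal.ofReal (excess u k x) ≤ ENNReal.ofReal W →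
      ∫⁻ y in (Metric.ball x₀ ρ)ᶜ, ENNReal.ofReal
        (excess u k y ^ (p - 1) * ‖y - x₀‖ ^ (-((n : ℝ) + s * p))) ≤ ENNReal.ofReal T →
      ∫⁻ z : Eucl n × Eucl n, ENNReal.ofReal
        ((|cutoff x₀ ((r + ρ) / 2) (2 / (ρ - r)) z.1 * excess u k z.1 -
            cutoff x₀ ((r + ρ) / 2) (2 / (ρ - r)) z.2 * excess u k z.2| ^ p +
          max (k - u z.2) 0 ^ (p - 1) * excess u k z.1 *
            cutoff x₀ ((r + ρ) / 2) (2 / (ρ - r)) z.1 ^ p) *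
          ‖z.1 - z.2‖ ^ (-((n : ℝ) + s * p))) ≤
      ENNReal.ofReal (C * energyBound n s p r ρ f₀ Y W T) := by
  obtain ⟨C, hC, hErr⟩ := exists_lintegral_cutoffError_le hn hs0 hs1 hp (n := n)
  set q := (n : ℝ) + s * p with hq
  have hq0 : 0 < q := by positivity
  set c : ℝ := 2 ^ (-(p + 1)) with hc
  have hc0 : 0 < c := by positivity
  set C0 : ℝ := 2 ^ p * p ^ p + 2 with hC0
  have hC00 : 0 < C0 := by positivity
  have hΛ0 : 0 < Λ := by linarith
  -- The factor Λ/c undoes the kernel's lower bound and the pointwise constant c. The first 2 comes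
  -- from the factor 1/2 in the weak formulation; 2C appears because the error is counted in both
  -- orders of the pair.
  refine ⟨max 1 (Λ / c * (2 + C0 * Λ * (2 * C))), le_max_left _ _, ?_⟩
  intro Ω hΩ hΩb K hK f f₀ hfL hff u hum hu x₀ r ρ k hr hrρ hball Y W T hY hW hT hYb hWb hTb
  have hρr : 0 < ρ - r := by linarith
  have hf0 : 0 ≤ f₀ := ENNReal.toReal_nonneg.trans hff
  set B := Metric.ball x₀ ρ with hB
  have hBm : MeasurableSet B := Metric.isOpen_ball.measurableSet
  set L := 2 / (ρ - r) with hL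
  have hL0 : 0 < L := by positivity
  set m := (r + ρ) / 2 with hm
  set η := cutoff x₀ m L with hη
  set w := excess u k with hw
  have hwm : Measurable w := measurable_excess hum k
  have hηm : Measurable η := measurable_cutoff x₀ m L
  have hη0 : ∀ x, 0 ≤ η x := cutoff_nonneg x₀ m L
  have hη1 : ∀ x, η x ≤ 1 := cutoff_le_one x₀ m L
  have hw0 : ∀ x, 0 ≤ w x := excess_nonneg u k
  have hcl : Metric.closedBall x₀ m ⊆ B := Metric.closedBall_subset_ball (by rw [hm]; linarith)
  have hηz : ∀ x ∉ Metric.closedBall x₀ m, η x = 0 := fun x hx => by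
    apply cutoff_eq_zero x₀ hL0
    rw [mem_closedBall_iff_norm, not_le] at hx
    exact hx.le
  have hηB : ∀ x ∉ B, η x = 0 := fun x hx => hηz x fun h => hx (hcl h)
  set φ : Eucl n → ℝ := fun x => η x ^ p * w x with hφ
  have hφm : Measurable φ := by fun_prop
  have hp0 : p ≠ 0 := by linarith
  have hφz : ∀ x ∉ Metric.closedBall x₀ m, φ x = 0 := fun x hx => by
    rw [hφ]; simp only; rw [hηz x hx, Real.zero_rpow hp0, zero_mul]
  have hφS : MemFracSobolev s p univ φ := memFracSobolev_cutoff_mul_excess hn hs0 hs1 hp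
    hΩ.measurableSet hΩb hum hu.1 k x₀ hL0 (hcl.trans hball)
  have hsupp : tsupport φ ⊆ Ω := by
    refine (closure_minimal ?_ Metric.isClosed_closedBall).trans (hcl.trans hball)
    intro x hx
    by_contra h
    exact hx (hφz x h)
  have hweak := hu.2 φ hφS hsupp
  set F : Eucl n × Eucl n → ℝ := fun z =>
    oddPow p (u z.1 - u z.2) * (φ z.1 - φ z.2) * K z.1 z.2 with hF
  have hFi : Integrable F := integrable_form hp hΛ hK hΩ.measurableSet hum hφm hu.1.2.2 hφS.2
    fun x hx => hφz x fun h => hx (hball (hcl h))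
  have hFint : ∫ z, F z ≤ 2 * (f₀ * W) := by
    have h1 : ∫ z, F z = 2 * ∫ x in Ω, f x * φ x := by
      rw [← hweak]; simp only [hF, oddPow]; ring
    rw [h1]
    gcongr
    refine (le_abs_self _).trans ?_
    rw [← Real.norm_eq_abs]
    refine (norm_integral_le_lintegral_norm _).trans ?_
    refine ENNReal.toReal_le_of_le_ofReal (by positivity) ?_
    have hfae : ∀ᵐ x ∂volume.restrict Ω, |f x| ≤ f₀ := by
      have h2 : ∀ᵐ x ∂volume.restrict Ω, ‖f x‖ₑ ≤ eLpNorm f ⊤ (volume.restrict Ω) := by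
        rw [eLpNorm_exponent_top]; exact ae_le_eLpNormEssSup
      filter_upwards [h2] with x hx
      refine le_trans ?_ hff
      have := ENNReal.toReal_mono hfL.2.ne hx
      rwa [toReal_enorm, Real.norm_eq_abs] at this
    calc ∫⁻ x in Ω, ENNReal.ofReal ‖f x * φ x‖ ≤
          ∫⁻ x in Ω, ENNReal.ofReal f₀ * B.indicator (fun x => ENNReal.ofReal (w x)) x := by
          refine lintegral_mono_ae ?_
          filter_upwards [hfae] with x hx
          by_cases hxB : x ∈ B
          · rw [indicator_of_mem hxB, ← ENNReal.ofReal_mul hf0]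
            apply ENNReal.ofReal_le_ofReal
            have h3 : η x ^ p ≤ 1 := Real.rpow_le_one (hη0 x) (hη1 x) (by linarith)
            have h4 : 0 ≤ η x ^ p := Real.rpow_nonneg (hη0 x) _
            rw [norm_mul, Real.norm_eq_abs, Real.norm_eq_abs, abs_of_nonneg (mul_nonneg h4 (hw0 x))]
            exact mul_le_mul hx (mul_le_of_le_one_left (hw0 x) h3) (mul_nonneg h4 (hw0 x)) hf0
          · rw [hφz x fun h => hxB (hcl h)]; simp
      _ ≤ ∫⁻ x, ENNReal.ofReal f₀ * B.indicator (fun x => ENNReal.ofReal (w x)) x :=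
          setLIntegral_le_lintegral _ _
      _ ≤ ENNReal.ofReal (f₀ * W) := by
          rw [lintegral_const_mul' _ _ ENNReal.ofReal_ne_top, lintegral_indicator hBm,
            ENNReal.ofReal_mul hf0]
          gcongr
  set E1 : Eucl n × Eucl n → ℝ := fun z => cutoffError p B w η L z.1 z.2 * ‖z.1 - z.2‖ ^ (-q)
    with hE1
  have hE1m : Measurable E1 := by
    have i1 : Measurable (B.indicator fun x => w x ^ p) := Measurable.indicator (by fun_prop) hBm
    have i2 : Measurable (Bᶜ.indicator fun x => w x ^ (p - 1)) :=
      Measurable.indicator (by fun_prop) hBm.compl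
    simp only [hE1, cutoffError]
    fun_prop
  have hE10 : ∀ z, 0 ≤ E1 z := fun z =>
    mul_nonneg (cutoffError_nonneg hL0 hw0 hη0 _ _) (by positivity)
  have hE1int : ∫⁻ z, ENNReal.ofReal (E1 z) ≤
      ENNReal.ofReal (C * energyBound n s p r ρ f₀ Y W T) :=
    hErr w hwm hw0 x₀ r ρ hr hrρ Y W T f₀ hY hW hT hf0 hYb hWb hTb
  have hX0 := energyBound_nonneg (n := n) (s := s) (p := p) hr hrρ hf0 hY hW hT
  set X := energyBound n s p r ρ f₀ Y W T with hX
  set G : Eucl n × Eucl n → ℝ := fun z =>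
    (|η z.1 * w z.1 - η z.2 * w z.2| ^ p + max (k - u z.2) 0 ^ (p - 1) * w z.1 * η z.1 ^ p) *
      ‖z.1 - z.2‖ ^ (-q) with hG
  have hG0 : ∀ z, 0 ≤ G z := fun z => by
    have := hw0 z.1
    have := hη0 z.1
    simp only [hG]; positivity
  have hswap : ∫⁻ z : Eucl n × Eucl n, ENNReal.ofReal (E1 z.swap) =
      ∫⁻ z, ENNReal.ofReal (E1 z) := by
    rw [Measure.volume_eq_prod]
    exact lintegral_prod_swap (fun z => ENNReal.ofReal (E1 z))
  -- F is the integrand of the weak form; the error is the pointwise one, symmetrised, with K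
  -- replaced by its upper bound.
  have hmain := lintegral_ofReal_le_of_le_add (G := fun z => c / Λ * G z)
    (E := fun z => C0 * Λ * (E1 z + E1 z.swap)) (e := C0 * Λ * (2 * C * X)) hFi
    (by fun_prop) (fun z => by
      have h1 := hE10 z
      have h2 := hE10 z.swap
      positivity) (fun z => by have := hG0 z; positivity) ?_
    (by positivity) ?_ hFint
  · have h1 : ∀ z, ENNReal.ofReal (c / Λ * G z) = ENNReal.ofReal (c / Λ) * ENNReal.ofReal (G z) :=
      fun z => ENNReal.ofReal_mul (by positivity)
    simp_rw [h1] at hmain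
    rw [lintegral_const_mul' _ _ ENNReal.ofReal_ne_top] at hmain
    have hfW : f₀ * W ≤ X := by
      rw [hX, energyBound]
      have h2 : 0 ≤ (ρ - r) ^ (-(s * p)) * Y := by positivity
      have h3 : 0 ≤ (ρ / (ρ - r)) ^ ((n : ℝ) + s * p) * T * W := by
        have : 0 < ρ := by linarith
        positivity
      nlinarith
    calc ∫⁻ z, ENNReal.ofReal (G z) = ENNReal.ofReal (Λ / c) *
          (ENNReal.ofReal (c / Λ) * ∫⁻ z, ENNReal.ofReal (G z)) := by
          rw [← mul_assoc, ← ENNReal.ofReal_mul (by positivity)]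
          have : Λ / c * (c / Λ) = 1 := by field_simp
          rw [this, ENNReal.ofReal_one, one_mul]
      _ ≤ ENNReal.ofReal (Λ / c) * ENNReal.ofReal (2 * (f₀ * W) + C0 * Λ * (2 * C * X)) := by
          gcongr
      _ ≤ _ := by
          rw [← ENNReal.ofReal_mul (by positivity)]
          apply ENNReal.ofReal_le_ofReal
          calc Λ / c * (2 * (f₀ * W) + C0 * Λ * (2 * C * X)) ≤
                Λ / c * (2 * X + C0 * Λ * (2 * C * X)) := by gcongr
            _ = Λ / c * (2 + C0 * Λ * (2 * C)) * X := by ring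
            _ ≤ _ := by gcongr; exact le_max_right _ _
  · filter_upwards [hK.upper, hK.lower] with z hz1 hz2
    have hκ0 : 0 ≤ ‖z.1 - z.2‖ ^ (-q) := by positivity
    have hz1' : K z.1 z.2 ≤ Λ * ‖z.1 - z.2‖ ^ (-q) := by
      rwa [Real.rpow_neg (norm_nonneg _), ← div_eq_mul_inv]
    have hz2' : Λ⁻¹ * ‖z.1 - z.2‖ ^ (-q) ≤ K z.1 z.2 := by
      rwa [Real.rpow_neg (norm_nonneg _), ← mul_inv, ← one_div]
    have hpt := caccioppoli_pointwise hp hL0 hη0 hηB (abs_cutoff_sub_le x₀ hL0) u k z.1 z.2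
    rw [← hw, ← hc, ← hC0] at hpt
    have hpt' := mul_le_mul_of_nonneg_right hpt (hK.nonneg z.1 z.2)
    have a1 : c / Λ * G z ≤ c * (|η z.1 * w z.1 - η z.2 * w z.2| ^ p +
        max (k - u z.2) 0 ^ (p - 1) * w z.1 * η z.1 ^ p) * K z.1 z.2 := by
      have h1 := hw0 z.1
      have h2 := hη0 z.1
      calc c / Λ * G z = c * (|η z.1 * w z.1 - η z.2 * w z.2| ^ p +
        max (k - u z.2) 0 ^ (p - 1) * w z.1 * η z.1 ^ p) * (Λ⁻¹ * ‖z.1 - z.2‖ ^ (-q)) := by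
            simp only [hG]; ring
        _ ≤ _ := by gcongr
    have a2 : C0 * (cutoffError p B w η L z.1 z.2 + cutoffError p B w η L z.2 z.1) * K z.1 z.2 ≤
        C0 * Λ * (E1 z + E1 z.swap) := by
      have h1 := cutoffError_nonneg (p := p) (B := B) hL0 hw0 hη0 z.1 z.2
      have h2 := cutoffError_nonneg (p := p) (B := B) hL0 hw0 hη0 z.2 z.1
      calc _ ≤ C0 * (cutoffError p B w η L z.1 z.2 + cutoffError p B w η L z.2 z.1) *
            (Λ * ‖z.1 - z.2‖ ^ (-q)) := by gcongr
        _ = _ := by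
          simp only [hE1, Prod.fst_swap, Prod.snd_swap, norm_sub_rev z.2 z.1]; ring
    have a3 : F z = oddPow p (u z.1 - u z.2) * (η z.1 ^ p * w z.1 - η z.2 ^ p * w z.2) *
        K z.1 z.2 := rfl
    rw [a3]
    linarith
  · have h1 : ∀ z : Eucl n × Eucl n, ENNReal.ofReal (C0 * Λ * (E1 z + E1 z.swap)) =
        ENNReal.ofReal (C0 * Λ) * (ENNReal.ofReal (E1 z) + ENNReal.ofReal (E1 z.swap)) :=
      fun z => by
        rw [ENNReal.ofReal_mul (by positivity), ENNReal.ofReal_add (hE10 _) (hE10 _)]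
    simp_rw [h1]
    rw [lintegral_const_mul' _ _ ENNReal.ofReal_ne_top, lintegral_add_left (by fun_prop), hswap,
      ENNReal.ofReal_mul (p := C0 * Λ) (by positivity)]
    gcongr
    calc _ ≤ ENNReal.ofReal (C * X) + ENNReal.ofReal (C * X) := by gcongr
      _ = _ := by
        rw [← ENNReal.ofReal_add (by positivity) (by positivity)]; congr 1; ring

/-! ### De Giorgi classes -/

/-- Bounds for the truncation `(u - k)₊` on a ball and for its nonlocal tail. -/
structure ExcessBounds {n : ℕ} (s p : ℝ) (u : Eucl n → ℝ) (x₀ : Eucl n) (ρ k Y W T : ℝ) :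
    Prop where
  nonneg_Y : 0 ≤ Y
  nonneg_W : 0 ≤ W
  nonneg_T : 0 ≤ T
  bound_Y : ∫⁻ x in Metric.ball x₀ ρ, ENNReal.ofReal (excess u k x ^ p) ≤ ENNReal.ofReal Y
  bound_W : ∫⁻ x in Metric.ball x₀ ρ, ENNReal.ofReal (excess u k x) ≤ ENNReal.ofReal W
  bound_T : ∫⁻ y in (Metric.ball x₀ ρ)ᶜ, ENNReal.ofReal
    (excess u k y ^ (p - 1) * ‖y - x₀‖ ^ (-((n : ℝ) + s * p))) ≤ ENNReal.ofReal T

/-- A fractional De Giorgi class of functions on `Ω`. -/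
structure IsDeGiorgi {n : ℕ} (s p C f₀ : ℝ) (Ω : Set (Eucl n)) (u : Eucl n → ℝ) : Prop where
  measurable : Measurable u
  nonneg : 0 ≤ f₀
  level_le : ∀ (x₀ : Eucl n) (r ρ k Y W T a : ℝ), 0 < r → r < ρ → Metric.ball x₀ ρ ⊆ Ω →
    ExcessBounds s p u x₀ ρ k Y W T → 0 < a →
    volume (Metric.ball x₀ ρ ∩ {x | k < u x}) ≤ ENNReal.ofReal a →
    ∫⁻ x in Metric.ball x₀ r, ENNReal.ofReal (excess u k x ^ p) ≤
      ENNReal.ofReal (C * a ^ (s * p / n) * energyBound n s p r ρ f₀ Y W T)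
  product_le : ∀ (x₀ : Eucl n) (r ρ k Y W T : ℝ), 0 < r → r < ρ → Metric.ball x₀ ρ ⊆ Ω →
    ExcessBounds s p u x₀ ρ k Y W T →
    (∫⁻ x in Metric.ball x₀ r, ENNReal.ofReal (excess u k x)) *
      ∫⁻ y in Metric.ball x₀ r, ENNReal.ofReal (max (k - u y) 0 ^ (p - 1)) ≤
    ENNReal.ofReal (C * r ^ ((n : ℝ) + s * p) * energyBound n s p r ρ f₀ Y W T)

/-- Weak solutions belong to a De Giorgi class. -/
theorem exists_isDeGiorgi {n : ℕ} (hn : 1 ≤ n) {s p Λ : ℝ} (hs0 : 0 < s) (hs1 : s < 1)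
    (hp : 1 < p) (hΛ : 1 ≤ Λ) :
    ∃ C : ℝ, 1 ≤ C ∧ ∀ (Ω : Set (Eucl n)), IsOpen Ω → Bornology.IsBounded Ω →
      ∀ (K : Eucl n → Eucl n → ℝ), IsKernel s p Λ K →
      ∀ (f : Eucl n → ℝ) (f₀ : ℝ), MemLp f ⊤ (volume.restrict Ω) →
        (eLpNorm f ⊤ (volume.restrict Ω)).toReal ≤ f₀ →
      ∀ (u : Eucl n → ℝ), Measurable u → IsWeakSolution s p K Ω f u →
      IsDeGiorgi s p C f₀ Ω u := by
  obtain ⟨C, hC, hcac⟩ := exists_caccioppoli hn hs0 hs1 hp hΛ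
  obtain ⟨C', hC', hFK⟩ := exists_faberKrahn hn (by positivity : 0 < s * p) hp (n := n)
  set q := (n : ℝ) + s * p with hq
  have hq0 : 0 < q := by positivity
  have hp1 : p - 1 ≠ 0 := by linarith
  refine ⟨max (C' * C) (2 ^ q * C), le_max_of_le_left (one_le_mul_of_one_le_of_one_le hC' hC), ?_⟩
  intro Ω hΩ hΩb K hK f f₀ hfL hff u hum hu
  have hf0 : 0 ≤ f₀ := ENNReal.toReal_nonneg.trans hff
  have hcac' := hcac Ω hΩ hΩb K hK f f₀ hfL hff u hum hu
  have hone : ∀ (x₀ : Eucl n) (r ρ : ℝ), r < ρ → ∀ x ∈ Metric.ball x₀ r,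
      cutoff x₀ ((r + ρ) / 2) (2 / (ρ - r)) x = 1 := by
    intro x₀ r ρ hr x hx
    have h0 : 0 < ρ - r := by linarith
    rw [mem_ball_iff_norm] at hx
    apply cutoff_eq_one
    rw [div_mul_eq_mul_div, one_le_div h0]
    linarith
  refine ⟨hum, hf0, ?_, ?_⟩
  · intro x₀ r ρ k Y W T a hr hrρ hball hB ha hvol
    have hmain := hcac' x₀ r ρ k hr hrρ hball Y W T hB.1 hB.2 hB.3 hB.4 hB.5 hB.6
    have hX0 := energyBound_nonneg (n := n) (s := s) (p := p) hr hrρ hf0 hB.1 hB.2 hB.3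
    set X := energyBound n s p r ρ f₀ Y W T with hX
    have hρr : 0 < ρ - r := by linarith
    set m := (r + ρ) / 2 with hm
    set L := 2 / (ρ - r) with hL
    have hL0 : 0 < L := by positivity
    set η := cutoff x₀ m L with hη
    set w := excess u k with hw
    have hwm : Measurable w := measurable_excess hum k
    have hηm : Measurable η := measurable_cutoff x₀ m L
    have hη0 : ∀ x, 0 ≤ η x := cutoff_nonneg x₀ m L
    have hw0 : ∀ x, 0 ≤ w x := excess_nonneg u k
    -- The support of η w lies in the ball intersected with the superlevel set, so Faber–Krahn
    -- applies with the given measure bound a.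
    have h1 := hFK (fun x => η x * w x) (by fun_prop) a ha (by
      refine (measure_mono fun x hx => ?_).trans hvol
      simp only [mem_ofPred_eq, mul_ne_zero_iff] at hx
      constructor
      · by_contra h
        rw [mem_ball_iff_norm, not_lt] at h
        exact hx.1 (cutoff_eq_zero x₀ hL0 (by rw [hm]; linarith))
      · by_contra h
        rw [mem_ofPred_eq, not_lt] at h
        exact hx.2 (max_eq_right (by linarith)))
    calc ∫⁻ x in Metric.ball x₀ r, ENNReal.ofReal (w x ^ p) =
          ∫⁻ x in Metric.ball x₀ r, ENNReal.ofReal (|η x * w x| ^ p) := by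
          refine setLIntegral_congr_fun Metric.isOpen_ball.measurableSet fun x hx => ?_
          rw [hη, hone x₀ r ρ hrρ x hx, one_mul, abs_of_nonneg (hw0 x)]
      _ ≤ ∫⁻ x, ENNReal.ofReal (|η x * w x| ^ p) := setLIntegral_le_lintegral _ _
      _ ≤ _ := h1
      _ ≤ ENNReal.ofReal (C' * a ^ (s * p / n)) * ENNReal.ofReal (C * X) := by
          gcongr
          refine le_trans ?_ hmain
          rw [Measure.volume_eq_prod, lintegral_prod _ (by fun_prop)]
          refine lintegral_mono fun x => lintegral_mono fun y => ?_
          simp only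
          gcongr
          have := hw0 x
          have := hη0 x
          have : 0 ≤ max (k - u y) 0 ^ (p - 1) * w x * η x ^ p := by positivity
          linarith
      _ ≤ _ := by
          rw [← ENNReal.ofReal_mul (by positivity)]
          apply ENNReal.ofReal_le_ofReal
          calc C' * a ^ (s * p / n) * (C * X) = C' * C * a ^ (s * p / n) * X := by ring
            _ ≤ _ := by gcongr; exact le_max_left _ _
  · intro x₀ r ρ k Y W T hr hrρ hball hB
    have hmain := hcac' x₀ r ρ k hr hrρ hball Y W T hB.1 hB.2 hB.3 hB.4 hB.5 hB.6
    have hX0 := energyBound_nonneg (n := n) (s := s) (p := p) hr hrρ hf0 hB.1 hB.2 hB.3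
    set X := energyBound n s p r ρ f₀ Y W T with hX
    set η := cutoff x₀ ((r + ρ) / 2) (2 / (ρ - r)) with hη
    set w := excess u k with hw
    have hwm : Measurable w := measurable_excess hum k
    have hw0 : ∀ x, 0 ≤ w x := excess_nonneg u k
    set B := Metric.ball x₀ r with hBdef
    have hBm : MeasurableSet B := Metric.isOpen_ball.measurableSet
    have hi : (∫⁻ x in B, ENNReal.ofReal (w x)) *
        ∫⁻ y in B, ENNReal.ofReal (max (k - u y) 0 ^ (p - 1)) =
        ∫⁻ z : Eucl n × Eucl n, B.indicator (fun x => ENNReal.ofReal (w x)) z.1 *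
          B.indicator (fun y => ENNReal.ofReal (max (k - u y) 0 ^ (p - 1))) z.2 := by
      rw [Measure.volume_eq_prod, lintegral_prod_mul
        (Measurable.indicator (by fun_prop) hBm).aemeasurable
        (Measurable.indicator (by fun_prop) hBm).aemeasurable,
        lintegral_indicator hBm, lintegral_indicator hBm]
    rw [hi]
    have hpt : ∀ z : Eucl n × Eucl n, B.indicator (fun x => ENNReal.ofReal (w x)) z.1 *
          B.indicator (fun y => ENNReal.ofReal (max (k - u y) 0 ^ (p - 1))) z.2 ≤
        ENNReal.ofReal ((2 * r) ^ q) * ENNReal.ofReal ((|η z.1 * w z.1 - η z.2 * w z.2| ^ p +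
          max (k - u z.2) 0 ^ (p - 1) * w z.1 * η z.1 ^ p) * ‖z.1 - z.2‖ ^ (-q)) := by
      rintro ⟨x, y⟩
      simp only
      by_cases hx : x ∈ B
      swap
      · simp [hx]
      by_cases hy : y ∈ B
      swap
      · simp [hy]
      rw [indicator_of_mem hx, indicator_of_mem hy, ← ENNReal.ofReal_mul (hw0 x),
        ← ENNReal.ofReal_mul (by positivity)]
      apply ENNReal.ofReal_le_ofReal
      rw [hη, hone x₀ r ρ hrρ x hx, hone x₀ r ρ hrρ y hy, Real.one_rpow, mul_one]
      have hwx := hw0 x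
      -- On the diagonal the kernel has the default value 0 and gives no lower bound, but there the
      -- left side vanishes: u cannot lie both above and below k.
      by_cases hxy : x = y
      · subst hxy
        have : w x * max (k - u x) 0 ^ (p - 1) = 0 := by
          rcases le_total (u x) k with h | h
          · rw [hw, excess, max_eq_right (by linarith), zero_mul]
          · rw [max_eq_right (by linarith : k - u x ≤ 0), Real.zero_rpow hp1, mul_zero]
        rw [this]
        positivity
      have hd0 : 0 < ‖x - y‖ := norm_pos_iff.2 (sub_ne_zero.2 hxy)
      have hd : ‖x - y‖ ≤ 2 * r := by
        rw [hBdef, mem_ball_iff_norm] at hx hy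
        have := norm_sub_le_norm_sub_add_norm_sub x x₀ y
        rw [norm_sub_rev x₀ y] at this
        linarith
      -- Points of the ball are at distance at most 2r, so the kernel is at least (2r)^(-q); this
      -- decouples the interaction integral into a product.
      have hk : 1 ≤ (2 * r) ^ q * ‖x - y‖ ^ (-q) := by
        have h2 := Real.rpow_le_rpow_of_nonpos hd0 hd (z := -q) (by linarith)
        rw [Real.rpow_neg (by positivity)] at h2
        have h3 : 0 < (2 * r) ^ q := by positivity
        calc 1 = (2 * r) ^ q * ((2 * r) ^ q)⁻¹ := by field_simp
          _ ≤ _ := by gcongr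
      have h4 : 0 ≤ max (k - u y) 0 ^ (p - 1) * w x := by positivity
      have h5 : 0 ≤ |1 * w x - 1 * w y| ^ p := by positivity
      calc w x * max (k - u y) 0 ^ (p - 1) = 1 * (max (k - u y) 0 ^ (p - 1) * w x) := by ring
        _ ≤ ((2 * r) ^ q * ‖x - y‖ ^ (-q)) * (|1 * w x - 1 * w y| ^ p +
            max (k - u y) 0 ^ (p - 1) * w x) := by
            apply mul_le_mul hk (by linarith) h4 (by positivity)
        _ = _ := by ring
    refine (lintegral_mono hpt).trans ?_
    rw [lintegral_const_mul' _ _ ENNReal.ofReal_ne_top]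
    refine (mul_le_mul' le_rfl hmain).trans ?_
    rw [← ENNReal.ofReal_mul (by positivity)]
    apply ENNReal.ofReal_le_ofReal
    rw [Real.mul_rpow (by norm_num) hr.le]
    calc 2 ^ q * r ^ q * (C * X) = 2 ^ q * C * r ^ q * X := by ring
      _ ≤ _ := by gcongr; exact le_max_right _ _

/-! ### De Giorgi iteration -/

lemma excess_mono {n : ℕ} (u : Eucl n → ℝ) {k l : ℝ} (h : k ≤ l) (x : Eucl n) :
    excess u l x ≤ excess u k x :=
  max_le_max (by linarith) le_rfl

/-- One step of the De Giorgi iteration. -/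
lemma IsDeGiorgi.iteration_step {n : ℕ} (hn : 1 ≤ n) {s p C A f₀ : ℝ} (hs0 : 0 < s) (hp : 1 < p)
    (hC : 1 ≤ C) (hA : 1 ≤ A) {Ω : Set (Eucl n)} {u : Eucl n → ℝ} (hu : IsDeGiorgi s p C f₀ Ω u)
    {x₀ : Eucl n} {R k d t y : ℝ} (hR : 0 < R) (hd : 0 < d) (ht : 0 < t) (ht1 : t ≤ 1)
    (hy : 0 < y) (hball : Metric.ball x₀ (2 * R) ⊆ Ω)
    (hY : ∫⁻ x in Metric.ball x₀ (R * (1 + t)), ENNReal.ofReal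
      (excess u (k + d * (1 - t)) x ^ p) ≤ ENNReal.ofReal (y * R ^ (n : ℝ) * d ^ p))
    (hT : ∫⁻ x in (Metric.ball x₀ R)ᶜ, ENNReal.ofReal
      (excess u k x ^ (p - 1) * ‖x - x₀‖ ^ (-((n : ℝ) + s * p))) ≤
      ENNReal.ofReal (A * d ^ (p - 1) * R ^ (-(s * p))))
    (hf : f₀ ≤ A * d ^ (p - 1) * R ^ (-(s * p))) :
    ∫⁻ x in Metric.ball x₀ (R * (1 + t / 2)), ENNReal.ofReal
      (excess u (k + d * (1 - t / 2)) x ^ p) ≤ ENNReal.ofReal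
        (3 * A * C * y ^ (s * p / n) * (4 / t) ^ ((n : ℝ) + s * p + p + p * (s * p / n)) *
          (y * R ^ (n : ℝ) * d ^ p)) := by
  have hn0 : (0:ℝ) < n := by exact_mod_cast hn
  have hsp : 0 < s * p := by positivity
  set q := (n : ℝ) + s * p with hq
  have hq0 : 0 < q := by positivity
  set w := excess u (k + d * (1 - t / 2)) with hw
  set w₀ := excess u (k + d * (1 - t)) with hw₀
  have hw0 : ∀ x, 0 ≤ w x := excess_nonneg _ _
  have hw00 : ∀ x, 0 ≤ w₀ x := excess_nonneg _ _
  have hle : ∀ x, w x ≤ w₀ x := fun x => excess_mono u (by nlinarith) x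
  set Y := y * R ^ (n : ℝ) * d ^ p with hYdef
  have hY0 : 0 < Y := by positivity
  -- The gap between the levels k + d(1 - t) and k + d(1 - t/2).
  set e := d * t / 2 with he
  have he0 : 0 < e := by positivity
  have hwe : ∀ x, k + d * (1 - t / 2) < u x → e ≤ w₀ x := fun x hx => by
    rw [hw₀, excess, he]
    refine le_max_of_le_left ?_
    linarith
  -- Where the higher truncation is nonzero, the lower one is at least e, so its p-th power controls
  -- first powers. The same Chebyshev argument bounds the measure of the superlevel set below.
  have hW : ∀ x, w x ≤ w₀ x ^ p * e ^ (-(p - 1)) := by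
    intro x
    rcases le_or_gt (u x) (k + d * (1 - t / 2)) with h | h
    · rw [hw, excess, max_eq_right (by linarith)]
      have := hw00 x
      positivity
    · have h1 := hwe x h
      have h2 : 0 < w₀ x := he0.trans_le h1
      have h3 : 1 ≤ w₀ x ^ (p - 1) * e ^ (-(p - 1)) := by
        rw [Real.rpow_neg he0.le, ← div_eq_mul_inv, one_le_div (by positivity)]
        exact Real.rpow_le_rpow he0.le h1 (by linarith)
      calc w x ≤ w₀ x := hle x
        _ = w₀ x * 1 := (mul_one _).symm
        _ ≤ w₀ x * (w₀ x ^ (p - 1) * e ^ (-(p - 1))) := by gcongr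
        _ = _ := by rw [← rpow_sub_one_mul_self h2.le hp]; ring
  set T := A * d ^ (p - 1) * R ^ (-(s * p)) with hTdef
  have hT0 : 0 < T := by positivity
  have hρ : R ≤ R * (1 + t) := by nlinarith
  have hρ2 : R * (1 + t) ≤ 2 * R := by nlinarith
  have hB : ExcessBounds s p u x₀ (R * (1 + t)) (k + d * (1 - t / 2)) Y (Y * e ^ (-(p - 1))) T := by
    refine ⟨hY0.le, by positivity, hT0.le, ?_, ?_, ?_⟩
    · refine (lintegral_mono fun x => ?_).trans hY
      apply ENNReal.ofReal_le_ofReal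
      exact Real.rpow_le_rpow (hw0 x) (hle x) (by linarith)
    · calc ∫⁻ x in Metric.ball x₀ (R * (1 + t)), ENNReal.ofReal (w x) ≤
            ∫⁻ x in Metric.ball x₀ (R * (1 + t)),
              ENNReal.ofReal (w₀ x ^ p) * ENNReal.ofReal (e ^ (-(p - 1))) := by
            refine lintegral_mono fun x => ?_
            rw [← ENNReal.ofReal_mul (Real.rpow_nonneg (hw00 x) _)]
            exact ENNReal.ofReal_le_ofReal (hW x)
        _ ≤ _ := by
            rw [lintegral_mul_const' _ _ ENNReal.ofReal_ne_top, ENNReal.ofReal_mul hY0.le]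
            gcongr
    · refine (lintegral_mono fun x => ?_).trans ((lintegral_mono_set
        (compl_subset_compl.2 (Metric.ball_subset_ball hρ))).trans hT)
      apply ENNReal.ofReal_le_ofReal
      gcongr
      · exact hw0 x
      · exact excess_mono u (by nlinarith) x
  set a := Y * e ^ (-p) with ha
  have ha0 : 0 < a := by positivity
  have hvol : volume (Metric.ball x₀ (R * (1 + t)) ∩ {x | k + d * (1 - t / 2) < u x}) ≤
      ENNReal.ofReal a := by
    have hm : MeasurableSet {x | k + d * (1 - t / 2) < u x} :=
      measurableSet_lt measurable_const hu.measurable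
    have h1 : ENNReal.ofReal (e ^ p) *
        volume (Metric.ball x₀ (R * (1 + t)) ∩ {x | k + d * (1 - t / 2) < u x}) ≤
        ENNReal.ofReal Y := by
      calc _ = ∫⁻ x in Metric.ball x₀ (R * (1 + t)) ∩ {x | k + d * (1 - t / 2) < u x},
            ENNReal.ofReal (e ^ p) := by rw [setLIntegral_const]
        _ ≤ ∫⁻ x in Metric.ball x₀ (R * (1 + t)) ∩ {x | k + d * (1 - t / 2) < u x},
            ENNReal.ofReal (w₀ x ^ p) := by
            refine setLIntegral_mono' (Metric.isOpen_ball.measurableSet.inter hm) fun x hx => ?_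
            apply ENNReal.ofReal_le_ofReal
            exact Real.rpow_le_rpow he0.le (hwe x hx.2) (by linarith)
        _ ≤ _ := (lintegral_mono_set inter_subset_left).trans hY
    calc _ = ENNReal.ofReal (e ^ (-p)) * (ENNReal.ofReal (e ^ p) *
          volume (Metric.ball x₀ (R * (1 + t)) ∩ {x | k + d * (1 - t / 2) < u x})) := by
          rw [← mul_assoc, ← ENNReal.ofReal_mul (by positivity), ← Real.rpow_add he0,
            neg_add_cancel, Real.rpow_zero, ENNReal.ofReal_one, one_mul]
      _ ≤ ENNReal.ofReal (e ^ (-p)) * ENNReal.ofReal Y := by gcongr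
      _ = _ := by rw [← ENNReal.ofReal_mul (by positivity), mul_comm]
  have hstep := hu.level_le x₀ (R * (1 + t / 2)) (R * (1 + t)) _ Y _ T a (by positivity)
    (by nlinarith) ((Metric.ball_subset_ball hρ2).trans hball) hB ha0 hvol
  refine hstep.trans (ENNReal.ofReal_le_ofReal ?_)
  have h4t : 1 ≤ 4 / t := by rw [one_le_div ht]; linarith
  have h4t0 : 0 < 4 / t := by positivity
  have h2t : 2 / t ≤ 4 / t := by gcongr; norm_num
  have hRsp : 0 < R ^ (-(s * p)) := by positivity
  -- All losses from the thin annulus and from the small level gap are collected in powers of 4/t;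
  -- the powers of d cancel.
  have hX : energyBound n s p (R * (1 + t / 2)) (R * (1 + t)) f₀ Y (Y * e ^ (-(p - 1))) T ≤
      3 * A * (4 / t) ^ (q + p) * R ^ (-(s * p)) * Y := by
    have e1 : R * (1 + t) - R * (1 + t / 2) = R * (t / 2) := by ring
    rw [energyBound, e1, ← hq]
    have b1 : (R * (t / 2)) ^ (-(s * p)) ≤ A * (4 / t) ^ (q + p) * R ^ (-(s * p)) := by
      rw [Real.mul_rpow hR.le (by positivity), Real.rpow_neg (by positivity : 0 ≤ t / 2),
        ← Real.inv_rpow (by positivity), inv_div, mul_comm]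
      have : (2 / t) ^ (s * p) ≤ (4 / t) ^ (q + p) :=
        (Real.rpow_le_rpow (by positivity) h2t hsp.le).trans
          (Real.rpow_le_rpow_of_exponent_le h4t (by rw [hq]; linarith))
      calc (2 / t) ^ (s * p) * R ^ (-(s * p)) ≤ (4 / t) ^ (q + p) * R ^ (-(s * p)) := by gcongr
        _ = 1 * (4 / t) ^ (q + p) * R ^ (-(s * p)) := by ring
        _ ≤ _ := by gcongr
    have b2 : (R * (1 + t) / (R * (t / 2))) ^ q ≤ (4 / t) ^ q := by
      apply Real.rpow_le_rpow (by positivity) _ hq0.le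
      rw [mul_div_mul_left _ _ hR.ne', div_le_div_iff₀ (by positivity) ht]
      nlinarith
    have b3 : e ^ (-(p - 1)) ≤ d ^ (-(p - 1)) * (4 / t) ^ (p - 1) := by
      rw [he, mul_div_assoc, Real.mul_rpow hd.le (by positivity),
        Real.rpow_neg (by positivity : 0 ≤ t / 2), ← Real.inv_rpow (by positivity), inv_div]
      have : (2 / t) ^ (p - 1) ≤ (4 / t) ^ (p - 1) :=
        Real.rpow_le_rpow (by positivity) h2t (by linarith)
      gcongr
    have b4 : 1 ≤ (4 / t) ^ q := Real.one_le_rpow h4t hq0.le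
    have b5 : (4 / t) ^ q * (4 / t) ^ (p - 1) ≤ (4 / t) ^ (q + p) := by
      rw [← Real.rpow_add h4t0]
      exact Real.rpow_le_rpow_of_exponent_le h4t (by linarith)
    have b6 : d ^ (p - 1) * d ^ (-(p - 1)) = 1 := by
      rw [← Real.rpow_add hd, add_neg_cancel, Real.rpow_zero]
    have b7 : ((R * (1 + t) / (R * (t / 2))) ^ q * T + f₀) * (Y * e ^ (-(p - 1))) ≤
        2 * A * (4 / t) ^ (q + p) * R ^ (-(s * p)) * Y := by
      calc _ ≤ ((4 / t) ^ q * T + (4 / t) ^ q * T) *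
            (Y * (d ^ (-(p - 1)) * (4 / t) ^ (p - 1))) := by
            have : f₀ ≤ (4 / t) ^ q * T := by nlinarith
            gcongr
        _ = 2 * A * ((4 / t) ^ q * (4 / t) ^ (p - 1)) * R ^ (-(s * p)) * Y *
            (d ^ (p - 1) * d ^ (-(p - 1))) := by rw [hTdef]; ring
        _ ≤ _ := by
            rw [b6, mul_one]
            gcongr
    calc _ ≤ A * (4 / t) ^ (q + p) * R ^ (-(s * p)) * Y +
          2 * A * (4 / t) ^ (q + p) * R ^ (-(s * p)) * Y := by
          apply add_le_add _ b7
          gcongr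
      _ = _ := by ring
  have hapow : a ^ (s * p / n) ≤ y ^ (s * p / n) * R ^ (s * p) * (4 / t) ^ (p * (s * p / n)) := by
    have h1 : a ≤ y * R ^ (n : ℝ) * (4 / t) ^ p := by
      rw [ha, hYdef, he, mul_div_assoc, Real.mul_rpow hd.le (by positivity),
        Real.rpow_neg (by positivity : 0 ≤ t / 2), ← Real.inv_rpow (by positivity), inv_div]
      have h2 : (2 / t) ^ p ≤ (4 / t) ^ p := Real.rpow_le_rpow (by positivity) h2t (by linarith)
      have h3 : d ^ p * d ^ (-p) = 1 := by
        rw [← Real.rpow_add hd, add_neg_cancel, Real.rpow_zero]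
      calc y * R ^ (n : ℝ) * d ^ p * (d ^ (-p) * (2 / t) ^ p) =
            y * R ^ (n : ℝ) * (2 / t) ^ p * (d ^ p * d ^ (-p)) := by ring
        _ ≤ _ := by rw [h3, mul_one]; gcongr
    refine (Real.rpow_le_rpow ha0.le h1 (by positivity)).trans (le_of_eq ?_)
    rw [Real.mul_rpow (by positivity) (by positivity), Real.mul_rpow hy.le (by positivity),
      ← Real.rpow_mul hR.le, ← Real.rpow_mul h4t0.le]
    congr 3
    field_simp
  have hX0 : 0 ≤ energyBound n s p (R * (1 + t / 2)) (R * (1 + t)) f₀ Y (Y * e ^ (-(p - 1))) T :=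
    energyBound_nonneg (by positivity) (by nlinarith) hu.nonneg hY0.le (by positivity) hT0.le
  calc _ ≤ C * (y ^ (s * p / n) * R ^ (s * p) * (4 / t) ^ (p * (s * p / n))) *
        (3 * A * (4 / t) ^ (q + p) * R ^ (-(s * p)) * Y) := by gcongr
    _ = 3 * A * C * y ^ (s * p / n) * ((4 / t) ^ (q + p) * (4 / t) ^ (p * (s * p / n))) *
        (R ^ (s * p) * R ^ (-(s * p))) * Y := by ring
    _ = _ := by
      rw [← Real.rpow_add h4t0, ← Real.rpow_add hR, add_neg_cancel, Real.rpow_zero, mul_one]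

/-- If the truncation at level `k` is small in `L ^ p` compared with `d`, then `u ≤ k + d` on
the ball of half the radius. -/
theorem exists_forall_le_of_excess_small {n : ℕ} (hn : 1 ≤ n) {s p C A : ℝ} (hs0 : 0 < s)
    (hp : 1 < p) (hC : 1 ≤ C) (hA : 1 ≤ A) :
    ∃ ε : ℝ, 0 < ε ∧ ∀ (Ω : Set (Eucl n)) (u : Eucl n → ℝ) (f₀ : ℝ), IsDeGiorgi s p C f₀ Ω u →
      ∀ (x₀ : Eucl n) (R k d : ℝ), 0 < R → 0 < d → Metric.ball x₀ (2 * R) ⊆ Ω →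
      ∫⁻ x in Metric.ball x₀ (2 * R), ENNReal.ofReal (excess u k x ^ p) ≤
        ENNReal.ofReal (ε * R ^ (n : ℝ) * d ^ p) →
      ∫⁻ x in (Metric.ball x₀ R)ᶜ, ENNReal.ofReal
        (excess u k x ^ (p - 1) * ‖x - x₀‖ ^ (-((n : ℝ) + s * p))) ≤
        ENNReal.ofReal (A * d ^ (p - 1) * R ^ (-(s * p))) →
      f₀ ≤ A * d ^ (p - 1) * R ^ (-(s * p)) →
      ∀ᵐ x ∂volume.restrict (Metric.ball x₀ R), u x ≤ k + d := by
  have hn0 : (0:ℝ) < n := by exact_mod_cast hn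
  set β := s * p / n with hβ
  have hβ0 : 0 < β := by positivity
  set γ := (n : ℝ) + s * p + p + p * β with hγ
  have hγ0 : 0 < γ := by positivity
  -- With t = 2^(-j), a step loses (2^γ)^j. The rate is chosen so that the superlinear gain λ^(βj)
  -- cancels this loss exactly.
  set lam : ℝ := 2 ^ (-(γ / β)) with hlam
  have hlam0 : 0 < lam := by positivity
  have hlam1 : lam < 1 := Real.rpow_lt_one_of_one_lt_of_neg (by norm_num) (by
    have : 0 < γ / β := by positivity
    linarith)
  have hlamβ : lam ^ β * 2 ^ γ = 1 := by
    rw [hlam, ← Real.rpow_mul (by norm_num), ← Real.rpow_add (by norm_num)]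
    have : -(γ / β) * β + γ = 0 := by field_simp; ring
    rw [this, Real.rpow_zero]
  -- With this ε each step multiplies the bound by exactly λ.
  set ε : ℝ := (lam / (3 * A * C * 4 ^ γ)) ^ (1 / β) with hε
  have hε0 : 0 < ε := by positivity
  have hεβ : 3 * A * C * 4 ^ γ * ε ^ β = lam := by
    rw [hε, ← Real.rpow_mul (by positivity), one_div_mul_cancel hβ0.ne', Real.rpow_one]
    field_simp
  refine ⟨ε, hε0, ?_⟩
  intro Ω u f₀ hu x₀ R k d hR hd hball hY hT hf
  -- Radii decrease from 2R to R while levels rise from k to k + d, so the limit gives a vanishing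
  -- excess over k + d on the ball of radius R.
  have hind : ∀ j : ℕ, ∫⁻ x in Metric.ball x₀ (R * (1 + (1 / 2) ^ j)), ENNReal.ofReal
      (excess u (k + d * (1 - (1 / 2) ^ j)) x ^ p) ≤
      ENNReal.ofReal (ε * lam ^ j * R ^ (n : ℝ) * d ^ p) := by
    intro j
    induction j with
    | zero =>
      simp only [pow_zero, sub_self, mul_zero, add_zero, mul_one]
      rw [show R * (1 + 1) = 2 * R by ring]
      exact hY
    | succ j ih =>
      have h := hu.iteration_step hn hs0 hp hC hA (t := (1 / 2) ^ j) (y := ε * lam ^ j) hR hd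
        (by positivity) (pow_le_one₀ (by norm_num) (by norm_num)) (by positivity) hball ih hT hf
      rw [show ((1:ℝ) / 2) ^ j / 2 = (1 / 2) ^ (j + 1) by rw [pow_succ]; ring] at h
      refine h.trans (le_of_eq ?_)
      congr 1
      have e1 : (4 / (1 / 2) ^ j : ℝ) ^ γ = 4 ^ γ * (2 ^ γ) ^ j := by
        rw [one_div, inv_pow, div_inv_eq_mul, Real.mul_rpow (by norm_num) (by positivity),
          ← Real.rpow_natCast, ← Real.rpow_natCast, ← Real.rpow_mul (by norm_num),
          ← Real.rpow_mul (by norm_num), mul_comm γ]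
      have e2 : (ε * lam ^ j) ^ β = ε ^ β * (lam ^ β) ^ j := by
        rw [Real.mul_rpow hε0.le (by positivity), ← Real.rpow_natCast, ← Real.rpow_natCast,
          ← Real.rpow_mul hlam0.le, ← Real.rpow_mul hlam0.le, mul_comm β]
      rw [← hβ, ← hγ, e1, e2]
      calc _ = (3 * A * C * 4 ^ γ * ε ^ β) * (lam ^ β * 2 ^ γ) ^ j *
            (ε * lam ^ j * R ^ (n : ℝ) * d ^ p) := by rw [mul_pow]; ring
        _ = _ := by rw [hεβ, hlamβ, one_pow]; ring
  have hzero : ∫⁻ x in Metric.ball x₀ R, ENNReal.ofReal (excess u (k + d) x ^ p) = 0 := by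
    apply le_antisymm _ (zero_le)
    have hlim : Filter.Tendsto (fun j : ℕ => ENNReal.ofReal (ε * lam ^ j * R ^ (n : ℝ) * d ^ p))
        Filter.atTop (nhds 0) := by
      rw [← ENNReal.ofReal_zero]
      apply ENNReal.tendsto_ofReal
      have := tendsto_pow_atTop_nhds_zero_of_lt_one hlam0.le hlam1
      simpa using ((this.const_mul ε).mul_const (R ^ (n : ℝ))).mul_const (d ^ p)
    refine ge_of_tendsto' hlim fun j => le_trans ?_ (hind j)
    have ht : (0:ℝ) < (1 / 2) ^ j := by positivity
    refine (lintegral_mono_set (Metric.ball_subset_ball (by nlinarith :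
      R ≤ R * (1 + (1 / 2) ^ j)))).trans (lintegral_mono fun x => ?_)
    apply ENNReal.ofReal_le_ofReal
    exact Real.rpow_le_rpow (excess_nonneg _ _ _) (excess_mono u (by nlinarith) x) (by linarith)
  have hwm := measurable_excess hu.measurable (k + d)
  rw [lintegral_eq_zero_iff (by fun_prop)] at hzero
  filter_upwards [hzero] with x hx
  by_contra hcon
  push Not at hcon
  have h1 : 0 < excess u (k + d) x := lt_max_of_lt_left (by linarith)
  have h2 : 0 < excess u (k + d) x ^ p := by positivity
  simp only [Pi.zero_apply, ENNReal.ofReal_eq_zero] at hx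
  linarith

/-! ### The growth lemma -/

/-- For splitting tails: the excess over a lower level is bounded by an explicit function D plus a
remainder E. -/
lemma lintegral_rpow_mul_le_of_le_add {n : ℕ} {r : ℝ} (hr : 0 ≤ r) {μ : Measure (Eucl n)}
    {w D E κ : Eucl n → ℝ} (hDm : Measurable D) (hκm : Measurable κ)
    (hw0 : ∀ x, 0 ≤ w x) (hD0 : ∀ x, 0 ≤ D x) (hE0 : ∀ x, 0 ≤ E x) (hκ0 : ∀ x, 0 ≤ κ x)
    (h : ∀ᵐ x ∂μ, w x ≤ D x + E x) :
    ∫⁻ x, ENNReal.ofReal (w x ^ r * κ x) ∂μ ≤ ENNReal.ofReal (2 ^ r) *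
      (∫⁻ x, ENNReal.ofReal (D x ^ r * κ x) ∂μ + ∫⁻ x, ENNReal.ofReal (E x ^ r * κ x) ∂μ) := by
  rw [← lintegral_add_left (by fun_prop), ← lintegral_const_mul' _ _ ENNReal.ofReal_ne_top]
  refine lintegral_mono_ae ?_
  filter_upwards [h] with x hx
  have h1 := hw0 x
  have h2 := hD0 x
  have h3 := hE0 x
  have h4 := hκ0 x
  rw [← ENNReal.ofReal_add (by positivity) (by positivity), ← ENNReal.ofReal_mul (by positivity)]
  apply ENNReal.ofReal_le_ofReal
  have h5 := (Real.rpow_le_rpow h1 hx hr).trans (add_rpow_le_two_rpow_mul h2 h3 hr)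
  calc w x ^ r * κ x ≤ 2 ^ r * (D x ^ r + E x ^ r) * κ x := by gcongr
    _ = _ := by ring

lemma excess_le_add {n : ℕ} (u : Eucl n → ℝ) (M : ℝ) {D : ℝ} (hD : 0 ≤ D) (x : Eucl n) :
    excess u (M - D) x ≤ D + excess u M x := by
  unfold excess
  refine max_le ?_ (by positivity)
  linarith [le_max_left (u x - M) 0]

lemma excess_le_of_le {n : ℕ} {u : Eucl n → ℝ} {M D : ℝ} (hD : 0 ≤ D) {x : Eucl n}
    (h : u x ≤ M) : excess u (M - D) x ≤ D :=
  max_le (by linarith) hD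

/-- If `u ≤ M` on a ball and `u ≤ M - h` on a set of measure at least half of the ball of half the
radius, then only on a small portion of that ball `u` is close to `M`. -/
theorem exists_volume_gt_le {n : ℕ} (hn : 1 ≤ n) {s p C : ℝ} (hs0 : 0 < s)
    (hp : 1 < p) (hC : 1 ≤ C) :
    ∃ m₀ : ℝ, 0 < m₀ ∧ ∀ δ : ℝ, 0 < δ → δ ≤ 1 / 4 →
      ∀ (Ω : Set (Eucl n)) (u : Eucl n → ℝ) (f₀ : ℝ), IsDeGiorgi s p C f₀ Ω u →
      ∀ (x₀ : Eucl n) (R M h : ℝ), 0 < R → 0 < h → Metric.ball x₀ (2 * R) ⊆ Ω →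
      (∀ᵐ x ∂volume.restrict (Metric.ball x₀ (2 * R)), u x ≤ M) →
      ENNReal.ofReal (unitVol n * R ^ (n : ℝ) / 2) ≤
        volume (Metric.ball x₀ R ∩ {x | u x ≤ M - h}) →
      ∫⁻ x in (Metric.ball x₀ (2 * R))ᶜ, ENNReal.ofReal
        (excess u M x ^ (p - 1) * ‖x - x₀‖ ^ (-((n : ℝ) + s * p))) ≤
        ENNReal.ofReal ((δ * h) ^ (p - 1) * R ^ (-(s * p))) →
      f₀ ≤ (δ * h) ^ (p - 1) * R ^ (-(s * p)) →
      volume (Metric.ball x₀ R ∩ {x | M - δ * h < u x}) ≤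
        ENNReal.ofReal (m₀ * δ ^ (p - 1) * R ^ (n : ℝ)) := by
  have hn0 : (0:ℝ) < n := by exact_mod_cast hn
  have hsp : 0 < s * p := by positivity
  obtain ⟨C2, hC2, hker⟩ := exists_lintegral_kernel_compl_ball_le hn hsp (n := n)
  set ω := unitVol n with hω
  have hω0 : 0 < ω := unitVol_pos n
  set q := (n : ℝ) + s * p with hq
  have hq0 : 0 < q := by positivity
  set T0 : ℝ := 2 ^ (p - 1) * (2 ^ (p - 1) * C2 + 1) with hT0
  have hT00 : 0 < T0 := by positivity
  set X0 : ℝ := 2 ^ p * ω * 2 ^ (n : ℝ) + (2 ^ q * T0 + 1) * (2 * ω * 2 ^ (n : ℝ)) with hX0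
  have hX00 : 0 < X0 := by positivity
  refine ⟨2 * 2 ^ (p - 1) * C * X0 / ω, by positivity, ?_⟩
  intro δ hδ0 hδ1 Ω u f₀ hu x₀ R M h hR hh hball hM hhalf hT hf
  set D := δ * h with hD
  have hD0 : 0 < D := by positivity
  have hRsp : 0 < R ^ (-(s * p)) := by positivity
  have hvolB : volume (Metric.ball x₀ (2 * R)) =
      ENNReal.ofReal (ω * (2 ^ (n : ℝ) * R ^ (n : ℝ))) := by
    rw [volume_ball_eq x₀ (by positivity), Real.mul_rpow (by norm_num) hR.le]
  -- The level is 2D below M, so the excess is at most 2D on the large ball and every term of the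
  -- energy bound has order D^p R^(n - sp).
  have hB : ExcessBounds s p u x₀ (2 * R) (M - 2 * D)
      ((2 * D) ^ p * (ω * (2 ^ (n : ℝ) * R ^ (n : ℝ))))
      (2 * D * (ω * (2 ^ (n : ℝ) * R ^ (n : ℝ)))) (T0 * D ^ (p - 1) * R ^ (-(s * p))) := by
    refine ⟨by positivity, by positivity, by positivity, ?_, ?_, ?_⟩
    · calc _ ≤ ∫⁻ x in Metric.ball x₀ (2 * R), ENNReal.ofReal ((2 * D) ^ p) := by
            refine lintegral_mono_ae ?_
            filter_upwards [hM] with x hx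
            apply ENNReal.ofReal_le_ofReal
            exact Real.rpow_le_rpow (excess_nonneg _ _ _)
              (excess_le_of_le (by positivity) hx) (by linarith)
        _ = _ := by
            rw [setLIntegral_const, hvolB, ← ENNReal.ofReal_mul (by positivity)]
    · calc _ ≤ ∫⁻ x in Metric.ball x₀ (2 * R), ENNReal.ofReal (2 * D) := by
            refine lintegral_mono_ae ?_
            filter_upwards [hM] with x hx
            apply ENNReal.ofReal_le_ofReal
            exact excess_le_of_le (by positivity) hx
        _ = _ := by
            rw [setLIntegral_const, hvolB, ← ENNReal.ofReal_mul (by positivity)]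
    · refine (lintegral_rpow_mul_le_of_le_add (D := fun _ => 2 * D) (E := excess u M)
        (by linarith : 0 ≤ p - 1) (by fun_prop) (by fun_prop) (excess_nonneg _ _)
        (fun _ => by positivity) (excess_nonneg _ _) (fun _ => by positivity)
        (Filter.Eventually.of_forall fun x => excess_le_add u M (by positivity) x)).trans ?_
      have h1 : ∫⁻ x in (Metric.ball x₀ (2 * R))ᶜ,
          ENNReal.ofReal ((2 * D) ^ (p - 1) * ‖x - x₀‖ ^ (-q)) ≤
          ENNReal.ofReal ((2 * D) ^ (p - 1) * (C2 * (2 * R) ^ (-(s * p)))) := by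
        simp_rw [ENNReal.ofReal_mul (by positivity : 0 ≤ (2 * D) ^ (p - 1))]
        rw [lintegral_const_mul' _ _ ENNReal.ofReal_ne_top]
        gcongr
        exact hker x₀ (2 * R) (by positivity)
      refine (mul_le_mul' le_rfl (add_le_add h1 hT)).trans ?_
      rw [← ENNReal.ofReal_add (by positivity) (by positivity), ← ENNReal.ofReal_mul (by positivity)]
      apply ENNReal.ofReal_le_ofReal
      have h2 : (2 * R) ^ (-(s * p)) ≤ R ^ (-(s * p)) :=
        Real.rpow_le_rpow_of_nonpos hR (by linarith) (by linarith)
      calc 2 ^ (p - 1) * ((2 * D) ^ (p - 1) * (C2 * (2 * R) ^ (-(s * p))) +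
            D ^ (p - 1) * R ^ (-(s * p))) ≤
            2 ^ (p - 1) * ((2 * D) ^ (p - 1) * (C2 * R ^ (-(s * p))) +
            D ^ (p - 1) * R ^ (-(s * p))) := by gcongr
        _ = _ := by rw [Real.mul_rpow (by norm_num) hD0.le, hT0]; ring
  have hprod := hu.product_le x₀ R (2 * R) _ _ _ _ hR (by linarith) hball hB
  have hX : energyBound n s p R (2 * R) f₀ ((2 * D) ^ p * (ω * (2 ^ (n : ℝ) * R ^ (n : ℝ))))
      (2 * D * (ω * (2 ^ (n : ℝ) * R ^ (n : ℝ)))) (T0 * D ^ (p - 1) * R ^ (-(s * p))) ≤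
      X0 * D ^ p * R ^ (n : ℝ) * R ^ (-(s * p)) := by
    rw [energyBound, show 2 * R - R = R by ring, mul_div_assoc, div_self hR.ne', mul_one, ← hq]
    calc _ ≤ R ^ (-(s * p)) * ((2 * D) ^ p * (ω * (2 ^ (n : ℝ) * R ^ (n : ℝ)))) +
          (2 ^ q * (T0 * D ^ (p - 1) * R ^ (-(s * p))) + D ^ (p - 1) * R ^ (-(s * p))) *
          (2 * D * (ω * (2 ^ (n : ℝ) * R ^ (n : ℝ)))) := by gcongr
      _ = _ := by
          rw [Real.mul_rpow (by norm_num) hD0.le, ← rpow_sub_one_mul_self hD0.le hp, hX0]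
          ring
  set m := volume (Metric.ball x₀ R ∩ {x | M - D < u x}) with hm
  have hball_meas : MeasurableSet (Metric.ball x₀ R) := Metric.isOpen_ball.measurableSet
  have low1 : ENNReal.ofReal D * m ≤
      ∫⁻ x in Metric.ball x₀ R, ENNReal.ofReal (excess u (M - 2 * D) x) := by
    rw [hm, ← setLIntegral_const]
    refine le_trans ?_ (lintegral_mono_set (inter_subset_left (t := {x | M - D < u x})))
    refine setLIntegral_mono' (hball_meas.inter
      (measurableSet_lt measurable_const hu.measurable)) fun x hx => ?_
    apply ENNReal.ofReal_le_ofReal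
    have : M - D < u x := hx.2
    exact le_max_of_le_left (by linarith)
  -- On the low set u lies at least h - 2D ≥ h/2 below the level, by δ ≤ 1/4. With `low1` the
  -- product is at least of order D h^(p-1) R^n times m; comparison with D^p R^(2n) yields δ^(p-1)
  -- R^n.
  have low2 : ENNReal.ofReal ((h / 2) ^ (p - 1) * (ω * R ^ (n : ℝ) / 2)) ≤
      ∫⁻ x in Metric.ball x₀ R, ENNReal.ofReal (max (M - 2 * D - u x) 0 ^ (p - 1)) := by
    rw [ENNReal.ofReal_mul (by positivity)]
    refine (mul_le_mul' le_rfl hhalf).trans ?_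
    rw [← setLIntegral_const]
    refine le_trans ?_ (lintegral_mono_set (inter_subset_left (t := {x | u x ≤ M - h})))
    refine setLIntegral_mono' (hball_meas.inter
      (measurableSet_le hu.measurable measurable_const)) fun x hx => ?_
    apply ENNReal.ofReal_le_ofReal
    have h1 : u x ≤ M - h := hx.2
    have h2 : D ≤ 1 / 4 * h := by rw [hD]; gcongr
    exact Real.rpow_le_rpow (by positivity) (le_max_of_le_left (by linarith)) (by linarith)
  have hall : ENNReal.ofReal (D * ((h / 2) ^ (p - 1) * (ω * R ^ (n : ℝ) / 2))) * m ≤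
      ENNReal.ofReal (C * R ^ q * (X0 * D ^ p * R ^ (n : ℝ) * R ^ (-(s * p)))) := by
    calc _ = (ENNReal.ofReal D * m) *
          ENNReal.ofReal ((h / 2) ^ (p - 1) * (ω * R ^ (n : ℝ) / 2)) := by
          rw [ENNReal.ofReal_mul hD0.le]; ring
      _ ≤ _ := mul_le_mul' low1 low2
      _ ≤ _ := hprod
      _ ≤ _ := ENNReal.ofReal_le_ofReal (by gcongr)
  set g := D * ((h / 2) ^ (p - 1) * (ω * R ^ (n : ℝ) / 2)) with hg
  have hg0 : 0 < g := by positivity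
  calc m = ENNReal.ofReal g⁻¹ * (ENNReal.ofReal g * m) := by
        rw [← mul_assoc, ← ENNReal.ofReal_mul (by positivity), inv_mul_cancel₀ hg0.ne',
          ENNReal.ofReal_one, one_mul]
    _ ≤ ENNReal.ofReal g⁻¹ *
        ENNReal.ofReal (C * R ^ q * (X0 * D ^ p * R ^ (n : ℝ) * R ^ (-(s * p)))) := by gcongr
    _ = _ := by
        rw [← ENNReal.ofReal_mul (by positivity)]
        congr 1
        have e1 : R ^ q * R ^ (-(s * p)) = R ^ (n : ℝ) := by
          rw [← Real.rpow_add hR]; congr 1; rw [hq]; ring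
        have e2 : C * R ^ q * (X0 * D ^ p * R ^ (n : ℝ) * R ^ (-(s * p))) =
            C * X0 * (D ^ (p - 1) * D) * R ^ (n : ℝ) * (R ^ q * R ^ (-(s * p))) := by
          rw [rpow_sub_one_mul_self hD0.le hp]; ring
        rw [e2, e1, hg, Real.div_rpow hh.le (by norm_num), hD, Real.mul_rpow hδ0.le hh.le]
        have hRn : R ^ (n : ℝ) ≠ 0 := by positivity
        have hhp : h ^ (p - 1) ≠ 0 := by positivity
        field_simp

/-- The growth lemma. -/
theorem exists_growth {n : ℕ} (hn : 1 ≤ n) {s p C : ℝ} (hs0 : 0 < s) (hp : 1 < p) (hC : 1 ≤ C) :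
    ∃ δ : ℝ, 0 < δ ∧ δ ≤ 1 / 4 ∧
      ∀ (Ω : Set (Eucl n)) (u : Eucl n → ℝ) (f₀ : ℝ), IsDeGiorgi s p C f₀ Ω u →
      ∀ (x₀ : Eucl n) (R M h : ℝ), 0 < R → 0 < h → Metric.ball x₀ (2 * R) ⊆ Ω →
      (∀ᵐ x ∂volume.restrict (Metric.ball x₀ (2 * R)), u x ≤ M) →
      ENNReal.ofReal (unitVol n * R ^ (n : ℝ) / 2) ≤
        volume (Metric.ball x₀ R ∩ {x | u x ≤ M - h}) →
      ∫⁻ x in (Metric.ball x₀ (2 * R))ᶜ, ENNReal.ofReal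
        (excess u M x ^ (p - 1) * ‖x - x₀‖ ^ (-((n : ℝ) + s * p))) ≤
        ENNReal.ofReal ((δ * h) ^ (p - 1) * R ^ (-(s * p))) →
      f₀ ≤ (δ * h) ^ (p - 1) * R ^ (-(s * p)) →
      ∀ᵐ x ∂volume.restrict (Metric.ball x₀ (R / 2)), u x ≤ M - δ * h / 2 := by
  have hn0 : (0:ℝ) < n := by exact_mod_cast hn
  have hsp : 0 < s * p := by positivity
  have hp1 : 0 < p - 1 := by linarith
  obtain ⟨C2, hC2, hker⟩ := exists_lintegral_kernel_compl_ball_le hn hsp (n := n)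
  obtain ⟨m₀, hm₀, hvol⟩ := exists_volume_gt_le hn hs0 hp hC (n := n)
  set A : ℝ := 2 ^ (p - 1) * 2 ^ (p - 1) * (C2 + 1) with hA
  have h2p : (1:ℝ) ≤ 2 ^ (p - 1) := Real.one_le_rpow (by norm_num) hp1.le
  have hA1 : 1 ≤ A :=
    one_le_mul_of_one_le_of_one_le (one_le_mul_of_one_le_of_one_le h2p h2p) (by linarith)
  obtain ⟨ε, hε, hcrit⟩ := exists_forall_le_of_excess_small hn hs0 hp hC hA1 (n := n)
  set q := (n : ℝ) + s * p with hq
  -- Small enough that the superlevel set meets the smallness threshold ε on the ball of radius R/2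
  -- with increment D/2.
  set δ : ℝ := min (1 / 4) ((ε * (1 / 2) ^ (n : ℝ) * (1 / 2) ^ p / m₀) ^ (1 / (p - 1))) with hδ
  have hδ0 : 0 < δ := lt_min (by norm_num) (by positivity)
  have hδ1 : δ ≤ 1 / 4 := min_le_left _ _
  have hδε : m₀ * δ ^ (p - 1) ≤ ε * (1 / 2) ^ (n : ℝ) * (1 / 2) ^ p := by
    have h1 : δ ^ (p - 1) ≤ ε * (1 / 2) ^ (n : ℝ) * (1 / 2) ^ p / m₀ := by
      refine (Real.rpow_le_rpow hδ0.le (min_le_right _ _) hp1.le).trans (le_of_eq ?_)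
      rw [← Real.rpow_mul (by positivity), one_div_mul_cancel hp1.ne', Real.rpow_one]
    rw [le_div_iff₀ hm₀] at h1
    linarith
  refine ⟨δ, hδ0, hδ1, ?_⟩
  intro Ω u f₀ hu x₀ R M h hR hh hball hM hhalf hT hf
  have hv := hvol δ hδ0 hδ1 Ω u f₀ hu x₀ R M h hR hh hball hM hhalf hT hf
  set D := δ * h with hD
  have hD0 : 0 < D := by positivity
  have hRsp : 0 < R ^ (-(s * p)) := by positivity
  have hsub : Metric.ball x₀ R ⊆ Metric.ball x₀ (2 * R) := Metric.ball_subset_ball (by linarith)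
  have hR2 : R ^ (-(s * p)) ≤ (R / 2) ^ (-(s * p)) :=
    Real.rpow_le_rpow_of_nonpos (by positivity) (by linarith) (by linarith)
  have hD2 : D ^ (p - 1) = 2 ^ (p - 1) * (D / 2) ^ (p - 1) := by
    rw [← Real.mul_rpow (by norm_num) (by positivity)]; congr 1; ring
  -- Starting level M - D and increment D/2 end at M - D/2.
  have hkey := hcrit Ω u f₀ hu x₀ (R / 2) (M - D) (D / 2) (by positivity) (by positivity)
    (by rw [mul_div_cancel₀ _ (by norm_num : (2:ℝ) ≠ 0)]; exact hsub.trans hball) ?_ ?_ ?_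
  · filter_upwards [hkey] with x hx
    linarith
  · rw [mul_div_cancel₀ _ (by norm_num : (2:ℝ) ≠ 0)]
    have hSm : MeasurableSet {x | M - D < u x} := measurableSet_lt measurable_const hu.measurable
    calc _ ≤ ∫⁻ x in Metric.ball x₀ R,
          {x | M - D < u x}.indicator (fun _ => ENNReal.ofReal (D ^ p)) x := by
          refine lintegral_mono_ae ?_
          filter_upwards [ae_restrict_of_ae_restrict_of_subset hsub hM] with x hx
          by_cases hxD : M - D < u x
          · rw [indicator_of_mem (by exact hxD)]
            apply ENNReal.ofReal_le_ofReal
            exact Real.rpow_le_rpow (excess_nonneg _ _ _) (excess_le_of_le hD0.le hx) (by linarith)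
          · have : excess u (M - D) x = 0 := max_eq_right (by linarith)
            rw [this, Real.zero_rpow (by linarith)]
            simp
      _ = ENNReal.ofReal (D ^ p) * volume (Metric.ball x₀ R ∩ {x | M - D < u x}) := by
          rw [lintegral_indicator hSm, setLIntegral_const, Measure.restrict_apply hSm, inter_comm]
      _ ≤ ENNReal.ofReal (D ^ p) * ENNReal.ofReal (m₀ * δ ^ (p - 1) * R ^ (n : ℝ)) := by gcongr
      _ ≤ _ := by
          rw [← ENNReal.ofReal_mul (by positivity)]
          apply ENNReal.ofReal_le_ofReal
          rw [div_eq_mul_one_div R, div_eq_mul_one_div D, Real.mul_rpow hR.le (by norm_num),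
            Real.mul_rpow hD0.le (by norm_num)]
          calc D ^ p * (m₀ * δ ^ (p - 1) * R ^ (n : ℝ)) ≤
                D ^ p * (ε * (1 / 2) ^ (n : ℝ) * (1 / 2) ^ p * R ^ (n : ℝ)) := by gcongr
            _ = _ := by ring
  -- This tail starts at radius R/2. Up to 2R the excess is at most D by the bound u ≤ M; beyond 2R
  -- the hypothesis on the tail over M is added.
  · have hbm : MeasurableSet (Metric.ball x₀ (2 * R))ᶜ := Metric.isOpen_ball.measurableSet.compl
    refine (lintegral_rpow_mul_le_of_le_add (D := fun _ => D)
        (E := (Metric.ball x₀ (2 * R))ᶜ.indicator (excess u M))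
        (by linarith : 0 ≤ p - 1) (by fun_prop) (by fun_prop) (excess_nonneg _ _)
        (fun _ => by positivity) (fun x => indicator_nonneg (fun x _ => excess_nonneg _ _ _) x)
        (fun _ => by positivity) ?_).trans ?_
    · refine ae_restrict_of_ae ?_
      rw [ae_restrict_iff' Metric.isOpen_ball.measurableSet] at hM
      filter_upwards [hM] with x hx
      by_cases hxB : x ∈ Metric.ball x₀ (2 * R)
      · rw [indicator_of_notMem (by simpa using hxB), add_zero]
        exact excess_le_of_le hD0.le (hx hxB)
      · rw [indicator_of_mem (by simpa using hxB)]
        exact excess_le_add u M hD0.le x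
    · have h1 : ∫⁻ x in (Metric.ball x₀ (R / 2))ᶜ,
          ENNReal.ofReal (D ^ (p - 1) * ‖x - x₀‖ ^ (-q)) ≤
          ENNReal.ofReal (D ^ (p - 1) * (C2 * (R / 2) ^ (-(s * p)))) := by
        simp_rw [ENNReal.ofReal_mul (by positivity : 0 ≤ D ^ (p - 1))]
        rw [lintegral_const_mul' _ _ ENNReal.ofReal_ne_top]
        gcongr
        exact hker x₀ (R / 2) (by positivity)
      have h2 : ∫⁻ x in (Metric.ball x₀ (R / 2))ᶜ, ENNReal.ofReal
          ((Metric.ball x₀ (2 * R))ᶜ.indicator (excess u M) x ^ (p - 1) * ‖x - x₀‖ ^ (-q)) ≤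
          ENNReal.ofReal (D ^ (p - 1) * R ^ (-(s * p))) := by
        refine (setLIntegral_le_lintegral _ _).trans (le_trans (le_of_eq ?_) hT)
        rw [← lintegral_indicator hbm]
        refine lintegral_congr fun x => ?_
        by_cases hxB : x ∈ (Metric.ball x₀ (2 * R))ᶜ
        · rw [indicator_of_mem hxB, indicator_of_mem hxB]
        · rw [indicator_of_notMem hxB, indicator_of_notMem hxB, Real.zero_rpow hp1.ne']
          simp
      refine (mul_le_mul' le_rfl (add_le_add h1 h2)).trans ?_
      rw [← ENNReal.ofReal_add (by positivity) (by positivity), ← ENNReal.ofReal_mul (by positivity)]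
      apply ENNReal.ofReal_le_ofReal
      calc 2 ^ (p - 1) * (D ^ (p - 1) * (C2 * (R / 2) ^ (-(s * p))) + D ^ (p - 1) * R ^ (-(s * p))) ≤
            2 ^ (p - 1) * (D ^ (p - 1) * (C2 * (R / 2) ^ (-(s * p))) +
              D ^ (p - 1) * (R / 2) ^ (-(s * p))) := by gcongr
        _ = _ := by rw [hD2, hA]; ring
  · refine hf.trans ?_
    have h3 : D ^ (p - 1) * 1 ≤ A * (D / 2) ^ (p - 1) := by
      rw [hD2, hA, mul_one]
      have h4 : 0 < (D / 2) ^ (p - 1) := by positivity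
      have h5 : (2:ℝ) ^ (p - 1) ≤ 2 ^ (p - 1) * 2 ^ (p - 1) * (C2 + 1) := by
        rw [mul_assoc]
        exact le_mul_of_one_le_right (by positivity)
          (one_le_mul_of_one_le_of_one_le h2p (by linarith))
      gcongr
    rw [mul_one] at h3
    gcongr

/-! ### Oscillation decay -/

/-- Bernoulli's inequality for the power α/β ≤ 1 of x^β. It trades the growth exponent α for a fixed
β and leaves a prefactor α/β, small with α: this is what makes the tail of the growth bound small.
-/
lemma rpow_sub_one_le_div_mul_rpow {x α β : ℝ} (hx : 1 ≤ x) (hα : 0 < α) (hαβ : α ≤ β) :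
    x ^ α - 1 ≤ α / β * x ^ β := by
  have hβ : 0 < β := by linarith
  have hxβ : 0 < x ^ β := by positivity
  have h := rpow_one_add_le_one_add_mul_self (s := x ^ β - 1) (by linarith) (p := α / β)
    (by positivity) ((div_le_one hβ).2 hαβ)
  rw [add_sub_cancel, ← Real.rpow_mul (by linarith), mul_div_cancel₀ _ hβ.ne'] at h
  have : 0 < α / β := by positivity
  linarith

/-- One step of the oscillation decay. -/
theorem exists_oscillation_step {n : ℕ} (hn : 1 ≤ n) {s p C : ℝ} (hs0 : 0 < s) (hp : 1 < p)
    (hC : 1 ≤ C) :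
    ∃ α τ : ℝ, 0 < α ∧ α < 1 ∧ α * (p - 1) ≤ s * p ∧ 0 < τ ∧
      ∀ (Ω : Set (Eucl n)) (u : Eucl n → ℝ) (f₀ : ℝ), IsDeGiorgi s p C f₀ Ω u →
      ∀ (x₀ : Eucl n) (ρ M O : ℝ) (E : Eucl n → ℝ), 0 < ρ → 0 < O → Metric.ball x₀ ρ ⊆ Ω →
      (∀ x, 0 ≤ E x) →
      (∀ᵐ x ∂volume.restrict (Metric.ball x₀ ρ), u x ≤ M) →
      (∀ᵐ x ∂volume.restrict (Metric.ball x₀ ρ)ᶜ,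
        excess u M x ≤ O * ((4 * ‖x - x₀‖ / ρ) ^ α - 1) + E x) →
      ∫⁻ x in (Metric.ball x₀ ρ)ᶜ, ENNReal.ofReal
        (E x ^ (p - 1) * ‖x - x₀‖ ^ (-((n : ℝ) + s * p))) ≤
        ENNReal.ofReal ((τ * O) ^ (p - 1) * ρ ^ (-(s * p))) →
      f₀ ≤ (τ * O) ^ (p - 1) * ρ ^ (-(s * p)) →
      ENNReal.ofReal (unitVol n * (ρ / 2) ^ (n : ℝ) / 2) ≤
        volume (Metric.ball x₀ (ρ / 2) ∩ {x | u x ≤ M - O / 2}) →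
      ∀ᵐ x ∂volume.restrict (Metric.ball x₀ (ρ / 4)), u x ≤ M - (1 - 4 ^ (-α)) * O := by
  have hsp : 0 < s * p := by positivity
  have hp1 : 0 < p - 1 := by linarith
  obtain ⟨δ, hδ0, hδ1, hgrow⟩ := exists_growth hn hs0 hp hC (n := n)
  -- Growth of order β, raised to the power p - 1, has exponent sp/2 and is still integrable against
  -- the kernel at infinity.
  set β := s * p / (2 * (p - 1)) with hβ
  have hβ0 : 0 < β := by positivity
  have hβp : β * (p - 1) = s * p / 2 := by rw [hβ]; field_simp
  obtain ⟨C3, hC3, hker⟩ := exists_lintegral_growth_kernel_le hn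
    (by linarith : s * p / 2 < s * p) (n := n)
  -- The tail splits into a growth part and E, at the cost of a factor 2^(p-1). This η gives each
  -- part half of the amount the growth lemma admits with h = O/2.
  set η : ℝ := (1 / 2) ^ (1 / (p - 1)) * (δ / 4) with hη
  have hη0 : 0 < η := by positivity
  have hηp : 2 ^ (p - 1) * η ^ (p - 1) = 1 / 2 * (δ / 2) ^ (p - 1) := by
    rw [← Real.mul_rpow (by norm_num) hη0.le, hη,
      show (2:ℝ) * ((1 / 2) ^ (1 / (p - 1)) * (δ / 4)) = (1 / 2) ^ (1 / (p - 1)) * (δ / 2) by ring,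
      Real.mul_rpow (by positivity) (by positivity), ← Real.rpow_mul (by norm_num),
      one_div_mul_cancel hp1.ne', Real.rpow_one]
  have hηδ : η ≤ δ / 4 := by
    rw [hη]
    exact mul_le_of_le_one_left (by positivity)
      (Real.rpow_le_one (by norm_num) (by norm_num) (by positivity))
  set B0 : ℝ := 4 ^ β / β * C3 ^ (1 / (p - 1)) with hB0
  have hB00 : 0 < B0 := by positivity
  -- The three bounds ensure integrable growth, a required gain 1 - 4^(-α) ≤ δ/4 within what the
  -- growth lemma supplies, and a growth tail of size at most η.
  set α : ℝ := min (min β (δ / 8)) (η / B0) with hα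
  have hα0 : 0 < α := lt_min (lt_min hβ0 (by positivity)) (by positivity)
  have hαβ : α ≤ β := (min_le_left _ _).trans (min_le_left _ _)
  have hαδ : α ≤ δ / 8 := (min_le_left _ _).trans (min_le_right _ _)
  have hαη : α * B0 ≤ η := by
    have := min_le_right (min β (δ / 8)) (η / B0)
    rwa [← hα, le_div_iff₀ hB00] at this
  have hκ0 : (α / β * 4 ^ β) ^ (p - 1) * C3 ≤ η ^ (p - 1) := by
    have h1 : (α * B0) ^ (p - 1) = (α / β * 4 ^ β) ^ (p - 1) * C3 := by
      rw [hB0, show α * (4 ^ β / β * C3 ^ (1 / (p - 1))) =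
        (α / β * 4 ^ β) * C3 ^ (1 / (p - 1)) by ring,
        Real.mul_rpow (by positivity) (by positivity), ← Real.rpow_mul (by linarith),
        one_div_mul_cancel hp1.ne', Real.rpow_one]
    rw [← h1]
    exact Real.rpow_le_rpow (by positivity) hαη hp1.le
  have h4α : 1 - (4:ℝ) ^ (-α) ≤ δ / 4 := by
    have h1 : (4:ℝ) ^ (-α) = Real.exp (Real.log 4 * (-α)) := Real.rpow_def_of_pos (by norm_num) _
    have h2 := Real.add_one_le_exp (Real.log 4 * (-α))
    have h3 : Real.log 4 ≤ 2 := by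
      rw [show (4:ℝ) = 2 ^ 2 by norm_num, Real.log_pow]
      have := Real.log_two_lt_d9
      push_cast; linarith
    rw [h1]
    nlinarith
  refine ⟨α, η, hα0, by linarith, ?_, hη0, ?_⟩
  · have : α * (p - 1) ≤ β * (p - 1) := by gcongr
    linarith
  intro Ω u f₀ hu x₀ ρ M O E hρ hO hball hE0 hM hoff hE hf hhalf
  have e2 : 2 * (ρ / 2) = ρ := by ring
  have hρ2 : ρ ^ (-(s * p)) ≤ (ρ / 2) ^ (-(s * p)) :=
    Real.rpow_le_rpow_of_nonpos (by positivity) (by linarith) (by linarith)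
  have hO2 : δ * (O / 2) = δ / 2 * O := by ring
  have key := hgrow Ω u f₀ hu x₀ (ρ / 2) M (O / 2) (by positivity) (by positivity)
    (by rwa [e2]) (by rwa [e2]) hhalf ?_ ?_
  · rw [show ρ / 2 / 2 = ρ / 4 by ring] at key
    filter_upwards [key] with x hx
    nlinarith
  · rw [e2]
    have hbm : MeasurableSet (Metric.ball x₀ ρ)ᶜ := Metric.isOpen_ball.measurableSet.compl
    set G : Eucl n → ℝ := fun x => O * (α / β * 4 ^ β) * (‖x - x₀‖ / ρ) ^ β with hG
    have hG0 : ∀ x, 0 ≤ G x := fun x => by positivity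
    refine (lintegral_rpow_mul_le_of_le_add (D := G) (E := E)
        hp1.le (by fun_prop) (by fun_prop) (excess_nonneg _ _) hG0 hE0
        (fun _ => by positivity) ?_).trans ?_
    · filter_upwards [hoff, ae_restrict_mem hbm] with x hx hxB
      refine hx.trans (add_le_add ?_ le_rfl)
      rw [mem_compl_iff, mem_ball_iff_norm, not_lt] at hxB
      have h1 : 1 ≤ ‖x - x₀‖ / ρ := by rwa [one_le_div hρ]
      have h2 := rpow_sub_one_le_div_mul_rpow (x := 4 * (‖x - x₀‖ / ρ)) (by linarith) hα0 hαβ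
      rw [mul_div_assoc]
      calc O * ((4 * (‖x - x₀‖ / ρ)) ^ α - 1) ≤ O * (α / β * (4 * (‖x - x₀‖ / ρ)) ^ β) := by
            gcongr
        _ = _ := by rw [Real.mul_rpow (by norm_num) (by positivity)]; ring
    · have h1 : ∫⁻ x in (Metric.ball x₀ ρ)ᶜ,
          ENNReal.ofReal (G x ^ (p - 1) * ‖x - x₀‖ ^ (-((n : ℝ) + s * p))) ≤
          ENNReal.ofReal ((O * (α / β * 4 ^ β)) ^ (p - 1) * (C3 * ρ ^ (-(s * p)))) := by
        have h2 : ∀ x, ENNReal.ofReal (G x ^ (p - 1) * ‖x - x₀‖ ^ (-((n : ℝ) + s * p))) =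
            ENNReal.ofReal ((O * (α / β * 4 ^ β)) ^ (p - 1)) * ENNReal.ofReal
              ((‖x - x₀‖ / ρ) ^ (s * p / 2) * ‖x - x₀‖ ^ (-((n : ℝ) + s * p))) := fun x => by
          rw [← ENNReal.ofReal_mul (by positivity)]
          congr 1
          simp only [hG]
          rw [Real.mul_rpow (by positivity) (by positivity), ← Real.rpow_mul (by positivity), hβp]
          ring
        simp_rw [h2]
        rw [lintegral_const_mul' _ _ ENNReal.ofReal_ne_top,
          ENNReal.ofReal_mul (p := (O * (α / β * 4 ^ β)) ^ (p - 1)) (by positivity)]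
        gcongr
        exact hker x₀ ρ hρ
      refine (mul_le_mul' le_rfl (add_le_add h1 hE)).trans ?_
      rw [← ENNReal.ofReal_add (by positivity) (by positivity), ← ENNReal.ofReal_mul (by positivity)]
      apply ENNReal.ofReal_le_ofReal
      rw [hO2, Real.mul_rpow hη0.le hO.le, Real.mul_rpow hO.le (by positivity),
        Real.mul_rpow (by positivity) hO.le]
      calc 2 ^ (p - 1) * (O ^ (p - 1) * (α / β * 4 ^ β) ^ (p - 1) * (C3 * ρ ^ (-(s * p))) +
            η ^ (p - 1) * O ^ (p - 1) * ρ ^ (-(s * p))) =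
            2 ^ (p - 1) * ((α / β * 4 ^ β) ^ (p - 1) * C3 + η ^ (p - 1)) *
              O ^ (p - 1) * ρ ^ (-(s * p)) := by ring
        _ ≤ 2 ^ (p - 1) * (η ^ (p - 1) + η ^ (p - 1)) * O ^ (p - 1) * (ρ / 2) ^ (-(s * p)) := by
            gcongr
        _ = 2 * (2 ^ (p - 1) * η ^ (p - 1)) * O ^ (p - 1) * (ρ / 2) ^ (-(s * p)) := by ring
        _ = _ := by rw [hηp]; ring
  · refine hf.trans ?_
    rw [hO2]
    have : η ≤ δ / 2 := by linarith
    gcongr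

/-- Decay of the oscillation of functions in De Giorgi classes. -/
theorem exists_oscillation_decay {n : ℕ} (hn : 1 ≤ n) {s p C : ℝ} (hs0 : 0 < s) (hp : 1 < p)
    (hC : 1 ≤ C) :
    ∃ α τ : ℝ, 0 < α ∧ α < 1 ∧ 0 < τ ∧
      ∀ (Ω : Set (Eucl n)) (u : Eucl n → ℝ) (f₀ : ℝ), IsDeGiorgi s p C f₀ Ω u →
      IsDeGiorgi s p C f₀ Ω (-u) →
      ∀ (x₀ : Eucl n) (R H : ℝ), 0 < R → 0 < H → Metric.ball x₀ R ⊆ Ω →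
      (∀ᵐ x ∂volume.restrict (Metric.ball x₀ R), |u x| ≤ H / 2) →
      ∫⁻ x in (Metric.ball x₀ R)ᶜ, ENNReal.ofReal
        (|u x| ^ (p - 1) * ‖x - x₀‖ ^ (-((n : ℝ) + s * p))) ≤
        ENNReal.ofReal ((τ * H) ^ (p - 1) * R ^ (-(s * p))) →
      f₀ ≤ (τ * H) ^ (p - 1) * R ^ (-(s * p)) →
      ∃ c : ℝ, |c| ≤ H / 2 ∧ ∀ j : ℕ, ∀ᵐ x ∂volume.restrict (Metric.ball x₀ (R / 4 ^ j)),
        |u x - c| ≤ H * (4 ^ (-α)) ^ j := by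
  obtain ⟨α, τ, hα0, hα1, hαp, hτ, hstep⟩ := exists_oscillation_step hn hs0 hp hC (n := n)
  refine ⟨α, τ, hα0, hα1, hτ, ?_⟩
  intro Ω u f₀ hu hu' x₀ R H hR hH hball hbd htail hf
  have hp1 : 0 < p - 1 := by linarith
  have hsp : 0 < s * p := by positivity
  set θ : ℝ := 4 ^ (-α) with hθ
  have hθ0 : 0 < θ := by positivity
  have hθ1 : θ ≤ 1 := Real.rpow_le_one_of_one_le_of_nonpos (by norm_num) (by linarith)
  have hbm : ∀ r, MeasurableSet (Metric.ball x₀ r) := fun r => Metric.isOpen_ball.measurableSet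
  set E : Eucl n → ℝ := (Metric.ball x₀ R)ᶜ.indicator fun x => |u x| with hE
  have hE0 : ∀ x, 0 ≤ E x := fun x => indicator_nonneg (fun x _ => abs_nonneg _) x
  -- One growth barrier serves all scales: rewritten at radius R/4^j its coefficient is Hθ^j. The
  -- factor 4 makes it at least Hθ^j already from a quarter of that radius on, so the barrier covers
  -- the annulus lost when the ball shrinks.
  set g : Eucl n → ℝ := fun x => H * (4 * ‖x - x₀‖ / R) ^ α + E x with hg
  have hradius : ∀ (j : ℕ) (x : Eucl n), H * (4 * ‖x - x₀‖ / R) ^ α =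
      H * θ ^ j * (4 * ‖x - x₀‖ / (R / 4 ^ j)) ^ α := by
    intro j x
    rw [show 4 * ‖x - x₀‖ / (R / 4 ^ j) = 4 ^ j * (4 * ‖x - x₀‖ / R) by field_simp,
      Real.mul_rpow (by positivity) (by positivity), hθ, ← Real.rpow_natCast, ← Real.rpow_natCast,
      ← Real.rpow_mul (by norm_num), ← Real.rpow_mul (by norm_num)]
    have : (4:ℝ) ^ (-α * j) * 4 ^ (j * α) = 1 := by
      rw [← Real.rpow_add (by norm_num)]
      have : -α * j + j * α = 0 := by ring
      rw [this, Real.rpow_zero]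
    calc _ = H * ((4:ℝ) ^ (-α * j) * 4 ^ (j * α)) * (4 * ‖x - x₀‖ / R) ^ α := by rw [this, mul_one]
      _ = _ := by ring
  -- The tail and source thresholds do not decrease along the scales, since 4^(-αj(p-1)) 4^(jsp) ≥ 1
  -- by α(p - 1) ≤ sp. A single hypothesis at radius R is therefore enough.
  have hscale : ∀ j : ℕ, (τ * H) ^ (p - 1) * R ^ (-(s * p)) ≤
      (τ * (H * θ ^ j)) ^ (p - 1) * (R / 4 ^ j) ^ (-(s * p)) := by
    intro j
    rw [show τ * (H * θ ^ j) = τ * H * θ ^ j by ring,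
      Real.mul_rpow (x := τ * H) (y := θ ^ j) (by positivity) (by positivity),
      Real.div_rpow hR.le (by positivity), ← Real.rpow_natCast θ, ← Real.rpow_natCast 4, hθ,
      ← Real.rpow_mul (x := 4) (by norm_num), ← Real.rpow_mul (x := 4) (by norm_num),
      ← Real.rpow_mul (x := 4) (by norm_num), div_eq_mul_inv,
      ← Real.rpow_neg (by norm_num)]
    have h1 : (1:ℝ) ≤ 4 ^ (-α * j * (p - 1)) * 4 ^ (-(j * -(s * p))) := by
      rw [← Real.rpow_add (by norm_num)]
      apply Real.one_le_rpow (by norm_num)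
      have hj : (0:ℝ) ≤ j := Nat.cast_nonneg j
      nlinarith
    calc _ = (τ * H) ^ (p - 1) * R ^ (-(s * p)) * 1 := by ring
      _ ≤ (τ * H) ^ (p - 1) * R ^ (-(s * p)) *
          (4 ^ (-α * j * (p - 1)) * 4 ^ (-(j * -(s * p)))) := by gcongr
      _ = _ := by ring
  have hEtail : ∀ j : ℕ, ∫⁻ x in (Metric.ball x₀ (R / 4 ^ j))ᶜ, ENNReal.ofReal
        (E x ^ (p - 1) * ‖x - x₀‖ ^ (-((n : ℝ) + s * p))) ≤
        ENNReal.ofReal ((τ * (H * θ ^ j)) ^ (p - 1) * (R / 4 ^ j) ^ (-(s * p))) := by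
    intro j
    refine (setLIntegral_le_lintegral _ _).trans (le_trans (le_of_eq ?_)
      (htail.trans (ENNReal.ofReal_le_ofReal (hscale j))))
    rw [← lintegral_indicator (hbm R).compl]
    refine lintegral_congr fun x => ?_
    by_cases hxB : x ∈ (Metric.ball x₀ R)ᶜ
    · rw [hE, indicator_of_mem hxB, indicator_of_mem hxB]
    · rw [hE, indicator_of_notMem hxB, indicator_of_notMem hxB, Real.zero_rpow hp1.ne']
      simp
  -- The number m is the lower end of the current range. The outer bounds are symmetric about the
  -- middle of the range, so that either of its ends may move.
  let Inv : ℕ → ℝ → Prop := fun j m =>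
    (∀ᵐ x ∂volume.restrict (Metric.ball x₀ (R / 4 ^ j)), m ≤ u x ∧ u x ≤ m + H * θ ^ j) ∧
    (∀ᵐ x ∂volume.restrict (Metric.ball x₀ (R / 4 ^ j))ᶜ,
      m + H * θ ^ j - g x ≤ u x ∧ u x ≤ m + g x)
  have hRj : ∀ j : ℕ, R / 4 ^ (j + 1) ≤ R / 4 ^ j := fun j => by
    rw [pow_succ, ← div_div]
    have : 0 < R / 4 ^ j := by positivity
    linarith
  have hI0 : Inv 0 (-(H / 2)) := by
    constructor
    · simp only [pow_zero, div_one, mul_one]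
      filter_upwards [hbd] with x hx
      rw [abs_le] at hx
      constructor <;> linarith
    · simp only [pow_zero, div_one, mul_one]
      filter_upwards [ae_restrict_mem (hbm R).compl] with x hx
      have h1 : E x = |u x| := by rw [hE, indicator_of_mem hx]
      rw [mem_compl_iff, mem_ball_iff_norm, not_lt] at hx
      have h2 : 1 ≤ 4 * ‖x - x₀‖ / R := by rw [one_le_div hR]; linarith
      have h3 : 1 ≤ (4 * ‖x - x₀‖ / R) ^ α := Real.one_le_rpow h2 hα0.le
      have h4 : H ≤ H * (4 * ‖x - x₀‖ / R) ^ α := le_mul_of_one_le_right hH.le h3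
      simp only [hg]
      rw [h1]
      have := neg_abs_le (u x)
      have := le_abs_self (u x)
      constructor <;> linarith
  have hnext : ∀ j m, Inv j m → ∃ m', Inv (j + 1) m' ∧ m ≤ m' ∧
      m' + H * θ ^ (j + 1) ≤ m + H * θ ^ j := by
    intro j m hI
    set ρ := R / 4 ^ j with hρ
    have hρ0 : 0 < ρ := by positivity
    have hρR : ρ ≤ R := div_le_self hR.le (one_le_pow₀ (by norm_num))
    have hρ4 : ρ / 4 = R / 4 ^ (j + 1) := by rw [hρ, pow_succ, div_div]
    set O := H * θ ^ j with hO
    have hO0 : 0 < O := by positivity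
    have hO' : H * θ ^ (j + 1) = θ * O := by rw [hO, pow_succ]; ring
    have hρball : Metric.ball x₀ ρ ⊆ Ω := (Metric.ball_subset_ball hρR).trans hball
    have hgO : ∀ x, g x = O * (4 * ‖x - x₀‖ / ρ) ^ α + E x := fun x => by
      simp only [hg]; rw [hradius j x]
    have hglow : ∀ x, ρ / 4 ≤ ‖x - x₀‖ → O ≤ g x := fun x hx => by
      rw [hgO]
      have h2 : 1 ≤ 4 * ‖x - x₀‖ / ρ := by rw [one_le_div hρ0]; linarith
      have h3 : 1 ≤ (4 * ‖x - x₀‖ / ρ) ^ α := Real.one_le_rpow h2 hα0.le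
      have h4 : O ≤ O * (4 * ‖x - x₀‖ / ρ) ^ α := le_mul_of_one_le_right hO0.le h3
      linarith [hE0 x]
    have hoffnew : ∀ m', m ≤ m' → m' + θ * O ≤ m + O →
        ∀ᵐ x ∂volume.restrict (Metric.ball x₀ (R / 4 ^ (j + 1)))ᶜ,
          m' + θ * O - g x ≤ u x ∧ u x ≤ m' + g x := by
      intro m' hm1 hm2
      have h1 := hI.1
      have h2 := hI.2
      rw [ae_restrict_iff' (hbm _)] at h1
      rw [ae_restrict_iff' (hbm _).compl] at h2
      rw [ae_restrict_iff' (hbm _).compl]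
      filter_upwards [h1, h2] with x hx1 hx2 hx
      rw [← hρ4, mem_compl_iff, mem_ball_iff_norm, not_lt] at hx
      by_cases hxB : x ∈ Metric.ball x₀ ρ
      · have h3 := hx1 hxB
        have h4 := hglow x hx
        constructor <;> linarith
      · have h3 := hx2 hxB
        constructor <;> linarith
    have h1 : (∀ᵐ x ∂volume.restrict (Metric.ball x₀ (ρ / 4)), m ≤ u x ∧ u x ≤ m + O) :=
      ae_restrict_of_ae_restrict_of_subset (Metric.ball_subset_ball (by linarith)) hI.1
    -- On at least half of the ball u lies below the midpoint of its range, or on at least half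
    -- above it. In the first case the upper end is lowered; in the second the step for -u raises
    -- the lower end.
    have hdich : ENNReal.ofReal (unitVol n * (ρ / 2) ^ (n : ℝ) / 2) ≤
        volume (Metric.ball x₀ (ρ / 2) ∩ {x | u x ≤ (m + O) - O / 2}) ∨
        ENNReal.ofReal (unitVol n * (ρ / 2) ^ (n : ℝ) / 2) ≤
        volume (Metric.ball x₀ (ρ / 2) ∩ {x | (-u) x ≤ (-m) - O / 2}) := by
      by_contra hcon
      push Not at hcon
      have h2 := ENNReal.add_lt_add hcon.1 hcon.2
      have hω := unitVol_pos n
      rw [← ENNReal.ofReal_add (by positivity) (by positivity), add_halves,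
        ← volume_ball_eq x₀ (by positivity)] at h2
      refine absurd ((measure_mono fun x hx => ?_).trans (measure_union_le _ _)) (not_le.2 h2)
      rcases le_total (u x) ((m + O) - O / 2) with h | h
      · exact Or.inl ⟨hx, h⟩
      · refine Or.inr ⟨hx, ?_⟩
        simp only [mem_ofPred_eq, Pi.neg_apply]
        linarith
    rcases hdich with hd | hd
    · have h2 := hstep Ω u f₀ hu x₀ ρ (m + O) O E hρ0 hO0 hρball hE0
        (hI.1.mono fun x hx => hx.2) ?_ (hEtail j) (hf.trans (hscale j)) hd
      · refine ⟨m, ⟨?_, ?_⟩, le_rfl, ?_⟩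
        · rw [← hρ4, hO']
          filter_upwards [h1, h2] with x hx1 hx2
          refine ⟨hx1.1, ?_⟩
          linarith
        · rw [hO']
          exact hoffnew m le_rfl (by nlinarith)
        · rw [hO']; nlinarith
      · filter_upwards [hI.2, ae_restrict_mem (hbm ρ).compl] with x hx hxB
        rw [mem_compl_iff, mem_ball_iff_norm, not_lt] at hxB
        have h3 := hglow x (by linarith)
        have h4 := hgO x
        exact max_le (by linarith [hx.2]) (by linarith)
    · have h2 := hstep Ω (-u) f₀ hu' x₀ ρ (-m) O E hρ0 hO0 hρball hE0
        (hI.1.mono fun x hx => by simpa using hx.1) ?_ (hEtail j) (hf.trans (hscale j)) hd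
      · refine ⟨m + (1 - θ) * O, ⟨?_, ?_⟩, ?_, ?_⟩
        · rw [← hρ4, hO']
          filter_upwards [h1, h2] with x hx1 hx2
          simp only [Pi.neg_apply] at hx2
          constructor <;> linarith
        · rw [hO']
          exact hoffnew _ (by nlinarith) (by linarith)
        · nlinarith
        · rw [hO']; linarith
      · filter_upwards [hI.2, ae_restrict_mem (hbm ρ).compl] with x hx hxB
        rw [mem_compl_iff, mem_ball_iff_norm, not_lt] at hxB
        have h3 := hglow x (by linarith)
        have h4 := hgO x
        refine max_le ?_ (by linarith)
        simp only [Pi.neg_apply]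
        linarith [hx.1]
  choose! nxt hnxt1 hnxt2 hnxt3 using hnext
  let m : ℕ → ℝ := fun j => Nat.rec (-(H / 2)) (fun j m => nxt j m) j
  have hm0 : m 0 = -(H / 2) := rfl
  have hmI : ∀ j, Inv j (m j) := by
    intro j
    induction j with
    | zero => exact hI0
    | succ j ih => exact hnxt1 j (m j) ih
  have hmono : Monotone m := monotone_nat_of_le_succ fun j => hnxt2 j (m j) (hmI j)
  have hanti : Antitone fun j => m j + H * θ ^ j :=
    antitone_nat_of_succ_le fun j => hnxt3 j (m j) (hmI j)
  -- The ranges are nested intervals; c is a point common to all of them.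
  have hc := hmono.ciSup_mem_iInter_Icc_of_antitone hanti fun j => by
    have : 0 < H * θ ^ j := by positivity
    simp only
    linarith
  rw [mem_iInter] at hc
  refine ⟨⨆ j, m j, ?_, fun j => ?_⟩
  · have h0 := hc 0
    rw [mem_Icc, hm0, pow_zero, mul_one] at h0
    rw [abs_le]
    constructor <;> linarith
  · have hj := hc j
    rw [mem_Icc] at hj
    filter_upwards [(hmI j).1] with x hx
    rw [abs_le]
    constructor <;> linarith

/-! ### From bounds at one scale to values at every point -/

/-- The three bounds on `u` at scale `R` about `x₀` from which the local estimates follow. -/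
structure ScaleBounds {n : ℕ} (s p f₀ : ℝ) (u : Eucl n → ℝ) (x₀ : Eucl n) (R N : ℝ) : Prop where
  energy : ∫⁻ x in Metric.ball x₀ (2 * R), ENNReal.ofReal (|u x| ^ p) ≤
    ENNReal.ofReal (N ^ p * R ^ (n : ℝ))
  tail : ∫⁻ x in (Metric.ball x₀ R)ᶜ, ENNReal.ofReal
    (|u x| ^ (p - 1) * ‖x - x₀‖ ^ (-((n : ℝ) + s * p))) ≤
    ENNReal.ofReal (N ^ (p - 1) * R ^ (-(s * p)))
  source : f₀ ≤ N ^ (p - 1) * R ^ (-(s * p))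

/-- Splitting at a = N turns an L^p bound into an integral bound for the power p - 1 without
Hölder's inequality, also when p - 1 < 1. -/
lemma rpow_sub_one_le_add_div {a N p : ℝ} (ha : 0 ≤ a) (hN : 0 < N) (hp : 1 < p) :
    a ^ (p - 1) ≤ N ^ (p - 1) + a ^ p * N⁻¹ := by
  rcases le_total a N with h | h
  · have h1 : a ^ (p - 1) ≤ N ^ (p - 1) := Real.rpow_le_rpow ha h (by linarith)
    have h2 : 0 ≤ a ^ p * N⁻¹ := by positivity
    linarith
  · have h1 : a ^ (p - 1) * N ≤ a ^ p := by
      rw [← rpow_sub_one_mul_self ha hp]; gcongr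
    have h2 : a ^ (p - 1) ≤ a ^ p * N⁻¹ := by
      rwa [← div_eq_mul_inv, le_div_iff₀ hN]
    have h3 : 0 ≤ N ^ (p - 1) := by positivity
    linarith

/-- Moving the centre of the tail. -/
lemma ScaleBounds.tail_le {n : ℕ} {s p f₀ : ℝ} (hs0 : 0 < s) (hp : 1 < p)
    {u : Eucl n → ℝ} {x₀ : Eucl n} {R N : ℝ} (hR : 0 < R) (hN : 0 < N)
    (hb : ScaleBounds s p f₀ u x₀ R N) {z : Eucl n} (hz : z ∈ Metric.ball x₀ R) :
    ∫⁻ x in (Metric.ball z (R / 2))ᶜ, ENNReal.ofReal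
      (|u x| ^ (p - 1) * ‖x - z‖ ^ (-((n : ℝ) + s * p))) ≤
    ENNReal.ofReal ((2 ^ ((n : ℝ) + s * p) * (unitVol n + 1) + 3 ^ ((n : ℝ) + s * p)) *
      N ^ (p - 1) * R ^ (-(s * p))) := by
  set q := (n : ℝ) + s * p with hq
  have hq0 : 0 < q := by positivity
  have hω := unitVol_pos n
  have hBm : MeasurableSet (Metric.ball x₀ R) := Metric.isOpen_ball.measurableSet
  have hu1 : ∫⁻ x in Metric.ball x₀ R, ENNReal.ofReal (|u x| ^ (p - 1)) ≤
      ENNReal.ofReal ((unitVol n + 1) * N ^ (p - 1) * R ^ (n : ℝ)) := by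
    calc _ ≤ ∫⁻ x in Metric.ball x₀ R, (ENNReal.ofReal (N ^ (p - 1)) +
          ENNReal.ofReal (|u x| ^ p) * ENNReal.ofReal N⁻¹) := by
          refine lintegral_mono fun x => ?_
          rw [← ENNReal.ofReal_mul (by positivity),
            ← ENNReal.ofReal_add (by positivity) (by positivity)]
          exact ENNReal.ofReal_le_ofReal (rpow_sub_one_le_add_div (abs_nonneg _) hN hp)
      _ = ENNReal.ofReal (N ^ (p - 1)) * ENNReal.ofReal (unitVol n * R ^ (n : ℝ)) +
          (∫⁻ x in Metric.ball x₀ R, ENNReal.ofReal (|u x| ^ p)) * ENNReal.ofReal N⁻¹ := by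
          rw [lintegral_add_left measurable_const, setLIntegral_const, volume_ball_eq x₀ hR,
            lintegral_mul_const' _ _ ENNReal.ofReal_ne_top]
      _ ≤ ENNReal.ofReal (N ^ (p - 1)) * ENNReal.ofReal (unitVol n * R ^ (n : ℝ)) +
          ENNReal.ofReal (N ^ p * R ^ (n : ℝ)) * ENNReal.ofReal N⁻¹ := by
          gcongr
          exact (lintegral_mono_set (Metric.ball_subset_ball (by linarith))).trans hb.energy
      _ = _ := by
          rw [← ENNReal.ofReal_mul (by positivity), ← ENNReal.ofReal_mul (by positivity),
            ← ENNReal.ofReal_add (by positivity) (by positivity)]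
          congr 1
          rw [← rpow_sub_one_mul_self hN.le hp]
          field_simp
  -- Inside the old ball |x - z| ≥ R/2 bounds the kernel and the L^p bound is used; outside, |x -
  -- x₀| ≤ 3|x - z| and the old tail is used.
  have hsplit : (Metric.ball z (R / 2))ᶜ ⊆
      (Metric.ball x₀ R \ Metric.ball z (R / 2)) ∪ ((Metric.ball x₀ R)ᶜ \ Metric.ball z (R / 2)) := by
    intro x hx
    by_cases h : x ∈ Metric.ball x₀ R
    · exact Or.inl ⟨h, hx⟩
    · exact Or.inr ⟨h, hx⟩
  have hzm : MeasurableSet (Metric.ball z (R / 2)) := Metric.isOpen_ball.measurableSet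
  have i1 : ∫⁻ x in Metric.ball x₀ R \ Metric.ball z (R / 2), ENNReal.ofReal
      (|u x| ^ (p - 1) * ‖x - z‖ ^ (-q)) ≤
      ENNReal.ofReal ((R / 2) ^ (-q)) *
        ENNReal.ofReal ((unitVol n + 1) * N ^ (p - 1) * R ^ (n : ℝ)) := by
    calc _ ≤ ∫⁻ x in Metric.ball x₀ R \ Metric.ball z (R / 2),
          ENNReal.ofReal ((R / 2) ^ (-q)) * ENNReal.ofReal (|u x| ^ (p - 1)) := by
          refine setLIntegral_mono' (hBm.diff hzm) fun x hx => ?_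
          rw [← ENNReal.ofReal_mul (by positivity), mul_comm]
          apply ENNReal.ofReal_le_ofReal
          have h1 := hx.2
          rw [mem_ball_iff_norm, not_lt] at h1
          gcongr ?_ * _
          exact Real.rpow_le_rpow_of_nonpos (by positivity) h1 (by linarith)
      _ ≤ _ := by
          rw [lintegral_const_mul' _ _ ENNReal.ofReal_ne_top]
          gcongr
          exact (lintegral_mono_set sdiff_subset).trans hu1
  have i2 : ∫⁻ x in (Metric.ball x₀ R)ᶜ \ Metric.ball z (R / 2), ENNReal.ofReal
      (|u x| ^ (p - 1) * ‖x - z‖ ^ (-q)) ≤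
      ENNReal.ofReal (3 ^ q) * ENNReal.ofReal (N ^ (p - 1) * R ^ (-(s * p))) := by
    calc _ ≤ ∫⁻ x in (Metric.ball x₀ R)ᶜ \ Metric.ball z (R / 2),
          ENNReal.ofReal (3 ^ q) * ENNReal.ofReal (|u x| ^ (p - 1) * ‖x - x₀‖ ^ (-q)) := by
          refine setLIntegral_mono' (hBm.compl.diff hzm) fun x hx => ?_
          rw [← ENNReal.ofReal_mul (by positivity)]
          apply ENNReal.ofReal_le_ofReal
          have h1 := hx.2
          have h2 := hx.1
          rw [mem_ball_iff_norm, not_lt] at h1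
          rw [mem_compl_iff, mem_ball_iff_norm, not_lt] at h2
          rw [mem_ball_iff_norm] at hz
          have h3 : ‖x - x₀‖ ≤ 3 * ‖x - z‖ := by
            have := norm_sub_le_norm_sub_add_norm_sub x z x₀
            linarith
          have h4 : 0 < ‖x - x₀‖ := hR.trans_le h2
          have h5 := Real.rpow_le_rpow_of_nonpos h4 h3 (z := -q) (by linarith)
          rw [Real.mul_rpow (by norm_num) (norm_nonneg _), Real.rpow_neg (by norm_num)] at h5
          have h6 : ‖x - z‖ ^ (-q) ≤ 3 ^ q * ‖x - x₀‖ ^ (-q) := by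
            have h7 : (0:ℝ) < 3 ^ q := by positivity
            rwa [inv_mul_le_iff₀ h7] at h5
          calc |u x| ^ (p - 1) * ‖x - z‖ ^ (-q) ≤
                |u x| ^ (p - 1) * (3 ^ q * ‖x - x₀‖ ^ (-q)) := by gcongr
            _ = _ := by ring
      _ ≤ _ := by
          rw [lintegral_const_mul' _ _ ENNReal.ofReal_ne_top]
          gcongr
          exact (lintegral_mono_set sdiff_subset).trans hb.tail
  refine (lintegral_mono_set hsplit).trans ((lintegral_union_le _ _ _).trans
    ((add_le_add i1 i2).trans ?_))
  rw [← ENNReal.ofReal_mul (by positivity), ← ENNReal.ofReal_mul (by positivity),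
    ← ENNReal.ofReal_add (by positivity) (by positivity)]
  apply ENNReal.ofReal_le_ofReal
  have e1 : (R / 2) ^ (-q) * R ^ (n : ℝ) = 2 ^ q * R ^ (-(s * p)) := by
    rw [Real.div_rpow hR.le (by norm_num), Real.rpow_neg (by norm_num : (0:ℝ) ≤ 2), div_inv_eq_mul,
      mul_right_comm, ← Real.rpow_add hR, mul_comm]
    congr 2
    rw [hq]; ring
  refine le_of_eq ?_
  calc _ = ((R / 2) ^ (-q) * R ^ (n : ℝ)) * ((unitVol n + 1) * N ^ (p - 1)) +
        3 ^ q * (N ^ (p - 1) * R ^ (-(s * p))) := by ring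
    _ = _ := by rw [e1]; ring

/-- Pointwise values and decay towards them. -/
theorem exists_value_bounds {n : ℕ} (hn : 1 ≤ n) {s p C : ℝ} (hs0 : 0 < s) (hp : 1 < p)
    (hC : 1 ≤ C) :
    ∃ α C₁ : ℝ, 0 < α ∧ α < 1 ∧ 1 ≤ C₁ ∧
      ∀ (Ω : Set (Eucl n)) (u : Eucl n → ℝ) (f₀ : ℝ), IsDeGiorgi s p C f₀ Ω u →
      IsDeGiorgi s p C f₀ Ω (-u) →
      ∀ (x₀ : Eucl n) (R N : ℝ), 0 < R → 0 < N → Metric.ball x₀ (2 * R) ⊆ Ω →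
      ScaleBounds s p f₀ u x₀ R N → ∀ z ∈ Metric.ball x₀ R,
      ∃ c : ℝ, |c| ≤ C₁ * N ∧ ∀ j : ℕ, ∀ᵐ x ∂volume.restrict (Metric.ball z (R / 2 / 4 ^ j)),
        |u x - c| ≤ C₁ * N * (4 ^ (-α)) ^ j := by
  set q := (n : ℝ) + s * p with hq
  have hp1 : 0 < p - 1 := by linarith
  have hp0 : 0 < p := by linarith
  have hω := unitVol_pos n
  set A : ℝ := 2 ^ q * (unitVol n + 1) + 3 ^ q with hA
  have hA1 : 1 ≤ A := by
    have h1 : (1:ℝ) ≤ 3 ^ q := Real.one_le_rpow (by norm_num) (by positivity)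
    have h2 : 0 < 2 ^ q * (unitVol n + 1) := by positivity
    linarith
  obtain ⟨ε, hε, hcrit⟩ := exists_forall_le_of_excess_small hn hs0 hp hC hA1 (n := n)
  obtain ⟨α, τ, hα0, hα1, hτ, hosc⟩ := exists_oscillation_decay hn hs0 hp hC (n := n)
  -- Chosen so that N^p R^n ≤ ε (R/2)^n (D0 N)^p, the smallness condition on the half ball.
  set D0 : ℝ := max 1 ((2 ^ (n : ℝ) / ε) ^ (1 / p)) with hD0
  have hD01 : 1 ≤ D0 := le_max_left _ _
  have hD0p : 2 ^ (n : ℝ) ≤ ε * D0 ^ p := by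
    have h1 : ((2 ^ (n : ℝ) / ε) ^ (1 / p)) ^ p ≤ D0 ^ p :=
      Real.rpow_le_rpow (by positivity) (le_max_right _ _) hp0.le
    rw [← Real.rpow_mul (by positivity), one_div_mul_cancel hp0.ne', Real.rpow_one,
      div_le_iff₀ hε] at h1
    linarith
  -- With H = C₁N the first entry gives |u| ≤ H/2, and the second puts the tail and the source below
  -- the thresholds of the oscillation decay.
  set C₁ : ℝ := max (2 * D0) (A ^ (1 / (p - 1)) / τ) with hC₁
  have hC₁D : 2 * D0 ≤ C₁ := le_max_left _ _
  have hC₁1 : 1 ≤ C₁ := by linarith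
  have hC₁A : A ≤ (τ * C₁) ^ (p - 1) := by
    have h1 : A ^ (1 / (p - 1)) ≤ τ * C₁ := by
      rw [← div_le_iff₀' hτ]; exact le_max_right _ _
    have h2 := Real.rpow_le_rpow (by positivity) h1 hp1.le
    rwa [← Real.rpow_mul (by positivity), one_div_mul_cancel hp1.ne', Real.rpow_one] at h2
  refine ⟨α, C₁, hα0, hα1, hC₁1, ?_⟩
  intro Ω u f₀ hu hu' x₀ R N hR hN hball hb z hz
  have hzR : Metric.ball z R ⊆ Metric.ball x₀ (2 * R) := by
    apply Metric.ball_subset_ball'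
    rw [Metric.mem_ball] at hz
    linarith
  have hzΩ : Metric.ball z (2 * (R / 2)) ⊆ Ω := by
    rw [mul_div_cancel₀ _ (by norm_num : (2:ℝ) ≠ 0)]; exact hzR.trans hball
  have htz := hb.tail_le hs0 hp hR hN hz
  rw [← hq, ← hA] at htz
  have hRsp : 0 < R ^ (-(s * p)) := by positivity
  have hR2 : R ^ (-(s * p)) ≤ (R / 2) ^ (-(s * p)) :=
    Real.rpow_le_rpow_of_nonpos (by positivity) (by linarith) (by
      have : 0 < s * p := by positivity
      linarith)
  have hND : N ^ (p - 1) ≤ (D0 * N) ^ (p - 1) :=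
    Real.rpow_le_rpow hN.le (by nlinarith) hp1.le
  have hstep : A * N ^ (p - 1) * R ^ (-(s * p)) ≤
      A * (D0 * N) ^ (p - 1) * (R / 2) ^ (-(s * p)) := by gcongr
  have hfA : f₀ ≤ A * N ^ (p - 1) * R ^ (-(s * p)) := by
    refine hb.source.trans ?_
    rw [mul_assoc]
    exact le_mul_of_one_le_left (by positivity) hA1
  -- Stated for v so as to serve both u and -u, with level 0 and increment D0 N.
  have hsup : ∀ v : Eucl n → ℝ, IsDeGiorgi s p C f₀ Ω v → (∀ x, |v x| = |u x|) →
      ∀ᵐ x ∂volume.restrict (Metric.ball z (R / 2)), v x ≤ D0 * N := by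
    intro v hv hvu
    have hex : ∀ x, excess v 0 x ≤ |u x| := fun x => by
      rw [← hvu x, excess, sub_zero]
      exact max_le (le_abs_self _) (abs_nonneg _)
    have h := hcrit Ω v f₀ hv z (R / 2) 0 (D0 * N) (by positivity) (by positivity) hzΩ ?_ ?_
      (hfA.trans hstep)
    · simpa using h
    · rw [mul_div_cancel₀ _ (by norm_num : (2:ℝ) ≠ 0)]
      refine (lintegral_mono fun x => ENNReal.ofReal_le_ofReal (Real.rpow_le_rpow
        (excess_nonneg _ _ _) (hex x) hp0.le)).trans ((lintegral_mono_set hzR).trans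
        (hb.energy.trans (ENNReal.ofReal_le_ofReal ?_)))
      rw [Real.div_rpow hR.le (by norm_num), Real.mul_rpow (by positivity) hN.le]
      have h2n : (0:ℝ) < 2 ^ (n : ℝ) := by positivity
      calc N ^ p * R ^ (n : ℝ) = 2 ^ (n : ℝ) * (N ^ p * (R ^ (n : ℝ) / 2 ^ (n : ℝ))) := by
            field_simp
        _ ≤ ε * D0 ^ p * (N ^ p * (R ^ (n : ℝ) / 2 ^ (n : ℝ))) := by gcongr
        _ = _ := by ring
    · refine (lintegral_mono fun x => ENNReal.ofReal_le_ofReal ?_).trans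
        (htz.trans (ENNReal.ofReal_le_ofReal hstep))
      have := hex x
      have := excess_nonneg v 0 x
      gcongr
  have hlin : A * N ^ (p - 1) * R ^ (-(s * p)) ≤
      (τ * (C₁ * N)) ^ (p - 1) * (R / 2) ^ (-(s * p)) := by
    rw [← mul_assoc, Real.mul_rpow (by positivity) hN.le]
    gcongr
  obtain ⟨c, hc1, hc2⟩ := hosc Ω u f₀ hu hu' z (R / 2) (C₁ * N) (by positivity) (by positivity)
    ((Metric.ball_subset_ball (by linarith)).trans hzΩ) (by
      filter_upwards [hsup u hu fun _ => rfl, hsup (-u) hu' fun x => abs_neg _] with x hx1 hx2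
      simp only [Pi.neg_apply] at hx2
      rw [abs_le]
      constructor <;> nlinarith) (htz.trans (ENNReal.ofReal_le_ofReal hlin)) (hfA.trans hlin)
  refine ⟨c, hc1.trans ?_, hc2⟩
  have : 0 < C₁ * N := by positivity
  linarith

/-! ### The precise representative and its modulus of continuity -/

/-- `c` is the essential limit of `u` at `z`. -/
def IsEssLimit {n : ℕ} (u : Eucl n → ℝ) (z : Eucl n) (c : ℝ) : Prop :=
  ∀ ε : ℝ, 0 < ε → ∃ r : ℝ, 0 < r ∧ ∀ᵐ x ∂volume.restrict (Metric.ball z r), |u x - c| ≤ ε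

lemma exists_of_ae_restrict_ball {n : ℕ} {z : Eucl n} {r : ℝ} (hr : 0 < r) {P : Eucl n → Prop}
    (h : ∀ᵐ x ∂volume.restrict (Metric.ball z r), P x) : ∃ x, P x := by
  have : (ae (volume.restrict (Metric.ball z r))).NeBot := by
    rw [ae_neBot, Ne, Measure.restrict_eq_zero]
    exact (Metric.measure_ball_pos volume z hr).ne'
  exact h.exists

lemma IsEssLimit.unique {n : ℕ} {u : Eucl n → ℝ} {z : Eucl n} {c d : ℝ} (hc : IsEssLimit u z c)
    (hd : IsEssLimit u z d) : c = d := by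
  refine eq_of_forall_dist_le fun ε hε => ?_
  obtain ⟨r, hr, h1⟩ := hc (ε / 2) (by positivity)
  obtain ⟨t, ht, h2⟩ := hd (ε / 2) (by positivity)
  obtain ⟨x, hx1, hx2⟩ := exists_of_ae_restrict_ball (lt_min hr ht)
    ((ae_restrict_of_ae_restrict_of_subset (Metric.ball_subset_ball (min_le_left r t)) h1).and
    (ae_restrict_of_ae_restrict_of_subset (Metric.ball_subset_ball (min_le_right r t)) h2))
  rw [Real.dist_eq]
  have := abs_sub_le c (u x) d
  rw [abs_sub_comm c (u x)] at this
  linarith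

open Classical in
/-- The precise representative of `u`. -/
noncomputable def preciseRep {n : ℕ} (u : Eucl n → ℝ) (z : Eucl n) : ℝ :=
  -- The value depends on z alone, so estimates from different balls concern one function. The
  -- default 0 never matters in Ω for the weak solutions considered, since an essential limit exists
  -- at each of its points.
  if h : ∃ c, IsEssLimit u z c then h.choose else 0

lemma preciseRep_eq {n : ℕ} {u : Eucl n → ℝ} {z : Eucl n} {c : ℝ} (hc : IsEssLimit u z c) :
    preciseRep u z = c := by
  have h : ∃ c, IsEssLimit u z c := ⟨c, hc⟩
  rw [preciseRep, dif_pos h]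
  exact h.choose_spec.unique hc

lemma isEssLimit_of_decay {n : ℕ} {u : Eucl n → ℝ} {z : Eucl n} {c R B θ : ℝ} (hR : 0 < R)
    (hθ0 : 0 ≤ θ) (hθ : θ < 1)
    (h : ∀ j : ℕ, ∀ᵐ x ∂volume.restrict (Metric.ball z (R / 4 ^ j)), |u x - c| ≤ B * θ ^ j) :
    IsEssLimit u z c := by
  intro ε hε
  have hlim : Filter.Tendsto (fun j : ℕ => B * θ ^ j) Filter.atTop (nhds 0) := by
    simpa using (tendsto_pow_atTop_nhds_zero_of_lt_one hθ0 hθ).const_mul B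
  obtain ⟨j, hj⟩ := (hlim.eventually (gt_mem_nhds hε)).exists
  exact ⟨R / 4 ^ j, by positivity, (h j).mono fun x hx => hx.trans hj.le⟩

lemma four_rpow_neg_lt_one {α : ℝ} (hα : 0 < α) : (4:ℝ) ^ (-α) < 1 :=
  Real.rpow_lt_one_of_one_lt_of_neg (by norm_num) (by linarith)

/-- Two points within distance `r` of each other have close values. -/
lemma abs_sub_le_of_decay {n : ℕ} {u : Eucl n → ℝ} {z z' : Eucl n} {c c' r b : ℝ} (hr : 0 < r)
    (hd : ‖z - z'‖ ≤ r) (h : ∀ᵐ x ∂volume.restrict (Metric.ball z r), |u x - c| ≤ b)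
    (h' : ∀ᵐ x ∂volume.restrict (Metric.ball z' r), |u x - c'| ≤ b) : |c - c'| ≤ 2 * b := by
  -- Both balls contain the ball of radius r/2 about the midpoint, which has positive measure, so
  -- some x satisfies both bounds.
  have hm1 : Metric.ball (midpoint ℝ z z') (r / 2) ⊆ Metric.ball z r := by
    apply Metric.ball_subset_ball'
    rw [dist_comm, dist_left_midpoint (𝕜 := ℝ), dist_eq_norm, Real.norm_of_nonneg (by norm_num)]
    linarith
  have hm2 : Metric.ball (midpoint ℝ z z') (r / 2) ⊆ Metric.ball z' r := by
    apply Metric.ball_subset_ball'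
    rw [dist_midpoint_right (𝕜 := ℝ), dist_eq_norm, Real.norm_of_nonneg (by norm_num)]
    linarith
  obtain ⟨x, hx1, hx2⟩ := exists_of_ae_restrict_ball (by positivity : 0 < r / 2)
    ((ae_restrict_of_ae_restrict_of_subset hm1 h).and
    (ae_restrict_of_ae_restrict_of_subset hm2 h'))
  have := abs_sub_le c (u x) c'
  rw [abs_sub_comm c (u x)] at this
  linarith

/-- Hölder bound from geometric decay at each point. -/
lemma abs_sub_le_rpow_of_decay {n : ℕ} {u v : Eucl n → ℝ} {z z' : Eucl n} {α B R : ℝ}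
    (hα0 : 0 < α) (hα1 : α < 1) (hB : 0 ≤ B) (hR : 0 < R)
    (hz : |v z| ≤ B) (hz' : |v z'| ≤ B)
    (h : ∀ j : ℕ, ∀ᵐ x ∂volume.restrict (Metric.ball z (R / 2 / 4 ^ j)),
      |u x - v z| ≤ B * (4 ^ (-α)) ^ j)
    (h' : ∀ j : ℕ, ∀ᵐ x ∂volume.restrict (Metric.ball z' (R / 2 / 4 ^ j)),
      |u x - v z'| ≤ B * (4 ^ (-α)) ^ j) :
    |v z - v z'| ≤ 16 * B * (‖z - z'‖ / R) ^ α := by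
  rcases eq_or_ne z z' with rfl | hne
  · simp only [sub_self, abs_zero]; positivity
  have ht : 0 < ‖z - z'‖ := norm_pos_iff.2 (sub_ne_zero.2 hne)
  have h8 : (8:ℝ) ^ α ≤ 8 := by
    conv_rhs => rw [← Real.rpow_one 8]
    exact Real.rpow_le_rpow_of_exponent_le (by norm_num) hα1.le
  suffices hs : |v z - v z'| ≤ 2 * B * (8 * (‖z - z'‖ / R)) ^ α by
    rw [Real.mul_rpow (by norm_num) (by positivity)] at hs
    refine hs.trans ?_
    calc 2 * B * (8 ^ α * (‖z - z'‖ / R) ^ α) ≤ 2 * B * (8 * (‖z - z'‖ / R) ^ α) := by gcongr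
      _ = _ := by ring
  rcases le_or_gt ‖z - z'‖ (R / 2) with hle | hgt
  -- The largest j for which |z - z'| is still at most R/2/4^j. Maximality makes 4^(-j) less than
  -- 8|z - z'|/R; the final 16 is 2 times 8, as 8^α ≤ 8.
  · obtain ⟨j, hj1, hj2⟩ := exists_nat_pow_near_of_lt_one (x := 2 * ‖z - z'‖ / R)
      (y := (1 / 4 : ℝ)) (by positivity) (by rw [div_le_one hR]; linarith) (by norm_num)
      (by norm_num)
    have hd : ‖z - z'‖ ≤ R / 2 / 4 ^ j := by
      rw [div_le_iff₀ hR, one_div, inv_pow] at hj2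
      rw [le_div_iff₀ (by positivity)]
      have h4 : (0:ℝ) < 4 ^ j := by positivity
      rw [inv_mul_eq_div, le_div_iff₀ h4] at hj2
      linarith
    have hmain := abs_sub_le_of_decay (by positivity) hd (h j) (h' j)
    refine hmain.trans ?_
    rw [← mul_assoc]
    gcongr
    have e1 : ((4:ℝ) ^ (-α)) ^ j = ((1 / 4) ^ j) ^ α := by
      rw [← Real.rpow_natCast, ← Real.rpow_natCast, ← Real.rpow_mul (by norm_num),
        ← Real.rpow_mul (by norm_num), one_div, Real.inv_rpow (by norm_num),
        ← Real.rpow_neg (by norm_num)]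
      congr 1; ring
    rw [e1]
    apply Real.rpow_le_rpow (by positivity) _ hα0.le
    rw [pow_succ] at hj1
    have : 8 * (‖z - z'‖ / R) = 4 * (2 * ‖z - z'‖ / R) := by ring
    linarith
  · have h1 : |v z - v z'| ≤ 2 * B := (abs_sub _ _).trans (by linarith)
    refine h1.trans (le_mul_of_one_le_right (by positivity) (Real.one_le_rpow ?_ hα0.le))
    have : 1 / 2 < ‖z - z'‖ / R := by rw [lt_div_iff₀ hR]; linarith
    linarith

/-! ### Invariance of the problem and scale bounds from the data -/

/-- The ball is connected and misses the frontier, so it cannot leave Ω. An empty frontier has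
`infDist` equal to 0, which the hypotheses on r exclude. -/
lemma ball_subset_of_le_infDist_frontier {n : ℕ} {Ω : Set (Eucl n)} (hΩ : IsOpen Ω) {x₀ : Eucl n}
    (hx : x₀ ∈ Ω) {r : ℝ} (hr0 : 0 < r) (hr : r ≤ Metric.infDist x₀ (frontier Ω)) :
    Metric.ball x₀ r ⊆ Ω := by
  have hconn : IsPreconnected (Metric.ball x₀ r) := (convex_ball x₀ r).isPreconnected
  refine hconn.subset_left_of_subset_union hΩ isClosed_closure.isOpen_compl
    (disjoint_compl_right.mono_left subset_closure |>.mono_right le_rfl) ?_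
    ⟨x₀, Metric.mem_ball_self hr0, hx⟩
  intro y hy
  by_contra hcon
  rw [mem_union, not_or, mem_compl_iff, not_not] at hcon
  have hyf : y ∈ frontier Ω := by
    rw [hΩ.frontier_eq]; exact ⟨hcon.2, hcon.1⟩
  have := Metric.infDist_le_dist_of_mem (x := x₀) hyf
  rw [Metric.mem_ball, dist_comm] at hy
  linarith

lemma gagliardo_neg {n : ℕ} (s p : ℝ) (D : Set (Eucl n × Eucl n)) (u : Eucl n → ℝ) :
    gagliardo s p D (-u) = gagliardo s p D u := by
  unfold gagliardo
  refine lintegral_congr fun z => ?_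
  rw [Pi.neg_apply, Pi.neg_apply, neg_sub_neg, abs_sub_comm]

lemma IsWeakSolution.neg {n : ℕ} {s p : ℝ} {K : Eucl n → Eucl n → ℝ} {Ω : Set (Eucl n)}
    {f u : Eucl n → ℝ} (h : IsWeakSolution s p K Ω f u) : IsWeakSolution s p K Ω (-f) (-u) := by
  refine ⟨⟨h.1.1.neg, h.1.2.1.neg, by rw [gagliardo_neg]; exact h.1.2.2⟩, fun φ hφ hs => ?_⟩
  have h1 := h.2 φ hφ hs
  have e1 : ∀ z : Eucl n × Eucl n, |(-u) z.1 - (-u) z.2| ^ (p - 2) * ((-u) z.1 - (-u) z.2) *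
      (φ z.1 - φ z.2) * K z.1 z.2 = -(|u z.1 - u z.2| ^ (p - 2) * (u z.1 - u z.2) *
      (φ z.1 - φ z.2) * K z.1 z.2) := fun z => by
    rw [Pi.neg_apply, Pi.neg_apply, neg_sub_neg, abs_sub_comm]; ring
  have e2 : ∀ x, (-f) x * φ x = -(f x * φ x) := fun x => by rw [Pi.neg_apply]; ring
  simp_rw [e1, e2]
  rw [integral_neg, integral_neg, ← h1]
  ring

lemma ae_prod_congr {n : ℕ} {u v : Eucl n → ℝ} (h : u =ᵐ[volume] v) :
    ∀ᵐ z : Eucl n × Eucl n, u z.1 = v z.1 ∧ u z.2 = v z.2 := by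
  rw [Measure.volume_eq_prod]
  exact (Measure.quasiMeasurePreserving_fst.ae h).and (Measure.quasiMeasurePreserving_snd.ae h)

lemma IsWeakSolution.congr_ae {n : ℕ} {s p : ℝ} {K : Eucl n → Eucl n → ℝ} {Ω : Set (Eucl n)}
    {f u v : Eucl n → ℝ} (h : IsWeakSolution s p K Ω f u) (huv : u =ᵐ[volume] v) :
    IsWeakSolution s p K Ω f v := by
  have hprod := ae_prod_congr huv
  refine ⟨⟨h.1.1.congr huv, h.1.2.1.ae_eq (ae_restrict_of_ae huv), ?_⟩, fun φ hφ hs => ?_⟩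
  · refine lt_of_eq_of_lt (lintegral_congr_ae ?_) h.1.2.2
    filter_upwards [ae_restrict_of_ae hprod] with z hz
    rw [hz.1, hz.2]
  · rw [← h.2 φ hφ hs]
    congr 1
    refine integral_congr_ae ?_
    filter_upwards [hprod] with z hz
    rw [hz.1, hz.2]

lemma MemTailSpace.congr_ae {n : ℕ} {s p : ℝ} {u v : Eucl n → ℝ} (h : MemTailSpace s p u)
    (huv : u =ᵐ[volume] v) : MemTailSpace s p v := by
  refine ⟨h.1.congr huv, h.2.congr ?_⟩
  filter_upwards [huv] with x hx
  rw [hx]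

/-- The right-hand side of the local Hölder estimate. -/
noncomputable def localSize {n : ℕ} (s p f₀ : ℝ) (u : Eucl n → ℝ) (x₀ : Eucl n) (R : ℝ) : ℝ :=
  (eLpNorm u (ENNReal.ofReal p) (volume.restrict (Metric.ball x₀ (2 * R)))).toReal /
    R ^ ((n : ℝ) / p) + tail s p u x₀ R + R ^ (s * p / (p - 1)) * f₀ ^ (1 / (p - 1))

lemma localSize_congr_ae {n : ℕ} {s p f₀ : ℝ} {u v : Eucl n → ℝ} (huv : u =ᵐ[volume] v)
    (x₀ : Eucl n) (R : ℝ) : localSize s p f₀ u x₀ R = localSize s p f₀ v x₀ R := by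
  have h1 : tail s p u x₀ R = tail s p v x₀ R := by
    unfold tail
    congr 2
    refine integral_congr_ae (ae_restrict_of_ae ?_)
    filter_upwards [huv] with x hx
    rw [hx]
  rw [localSize, localSize, h1, eLpNorm_congr_ae (ae_restrict_of_ae huv)]

lemma tail_nonneg {n : ℕ} (s p : ℝ) (u : Eucl n → ℝ) (x₀ : Eucl n) {R : ℝ} (hR : 0 < R) :
    0 ≤ tail s p u x₀ R := by
  unfold tail
  have : 0 ≤ ∫ x in (Metric.ball x₀ R)ᶜ, |u x| ^ (p - 1) / ‖x - x₀‖ ^ ((n : ℝ) + s * p) :=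
    integral_nonneg fun x => by positivity
  positivity

lemma localSize_nonneg {n : ℕ} {s p f₀ : ℝ} (hf : 0 ≤ f₀) (u : Eucl n → ℝ) (x₀ : Eucl n) {R : ℝ}
    (hR : 0 < R) : 0 ≤ localSize s p f₀ u x₀ R := by
  have := tail_nonneg s p u x₀ hR
  unfold localSize
  positivity

/-- Away from x₀ the weight 1 + |x| is at most a multiple of |x - x₀|. Without integrability the
Bochner integral in `tail` would default to 0 and bound nothing. -/
lemma MemTailSpace.integrableOn_compl_ball {n : ℕ} {s p : ℝ} (hs0 : 0 < s) (hp : 1 < p)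
    {u : Eucl n → ℝ} (h : MemTailSpace s p u) (x₀ : Eucl n) {R : ℝ} (hR : 0 < R) :
    IntegrableOn (fun x => |u x| ^ (p - 1) / ‖x - x₀‖ ^ ((n : ℝ) + s * p))
      (Metric.ball x₀ R)ᶜ := by
  set q := (n : ℝ) + s * p with hq
  have hq0 : 0 < q := by positivity
  set c := (1 + ‖x₀‖) / R + 1 with hc
  have hc0 : 0 < c := by positivity
  refine ((h.2.const_mul (c ^ q)).integrableOn (s := (Metric.ball x₀ R)ᶜ)).mono' ?_ ?_
  · have h1 : AEMeasurable u (volume.restrict (Metric.ball x₀ R)ᶜ) := h.1.restrict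
    refine AEMeasurable.aestronglyMeasurable ?_
    exact AEMeasurable.div (by fun_prop) (by fun_prop)
  · filter_upwards [ae_restrict_mem Metric.isOpen_ball.measurableSet.compl] with x hx
    rw [mem_compl_iff, mem_ball_iff_norm, not_lt] at hx
    have hx0 : 0 < ‖x - x₀‖ := hR.trans_le hx
    rw [Real.norm_of_nonneg (by positivity)]
    have h1 : 1 + ‖x‖ ≤ c * ‖x - x₀‖ := by
      have h2 : ‖x‖ ≤ ‖x - x₀‖ + ‖x₀‖ := by
        have := norm_add_le (x - x₀) x₀
        rwa [sub_add_cancel] at this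
      have h3 : 1 + ‖x₀‖ ≤ (1 + ‖x₀‖) / R * ‖x - x₀‖ := by
        rw [div_mul_eq_mul_div, le_div_iff₀ hR]
        gcongr
      rw [hc, add_mul]
      linarith
    have h4 : (1 + ‖x‖) ^ q ≤ c ^ q * ‖x - x₀‖ ^ q := by
      rw [← Real.mul_rpow hc0.le hx0.le]
      exact Real.rpow_le_rpow (by positivity) h1 hq0.le
    rw [mul_div_assoc', div_le_div_iff₀ (by positivity) (by positivity)]
    calc |u x| ^ (p - 1) * (1 + ‖x‖) ^ q ≤ |u x| ^ (p - 1) * (c ^ q * ‖x - x₀‖ ^ q) := by gcongr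
      _ = _ := by ring

/-- The three summands are nonnegative, so each is at most N; raising to the power p or p - 1 undoes
the roots. -/
lemma scaleBounds_of_localSize_le {n : ℕ} {s p f₀ : ℝ} (hs0 : 0 < s) (hp : 1 < p) (hf : 0 ≤ f₀)
    {u : Eucl n → ℝ} (hut : MemTailSpace s p u) {x₀ : Eucl n} {R N : ℝ} (hR : 0 < R)
    (huL : MemLp u (ENNReal.ofReal p) (volume.restrict (Metric.ball x₀ (2 * R))))
    (hN : localSize s p f₀ u x₀ R ≤ N) : ScaleBounds s p f₀ u x₀ R N := by
  have hp0 : 0 < p := by linarith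
  have hp1 : 0 < p - 1 := by linarith
  set a := (eLpNorm u (ENNReal.ofReal p) (volume.restrict (Metric.ball x₀ (2 * R)))).toReal with ha
  have h1 : 0 ≤ a / R ^ ((n : ℝ) / p) := by positivity
  have h2 := tail_nonneg s p u x₀ hR
  have h3 : 0 ≤ R ^ (s * p / (p - 1)) * f₀ ^ (1 / (p - 1)) := by positivity
  rw [localSize, ← ha] at hN
  have hN0 : 0 ≤ N := by linarith
  have hinv : R ^ (s * p) * R ^ (-(s * p)) = 1 := by
    rw [← Real.rpow_add hR, add_neg_cancel, Real.rpow_zero]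
  have hmove : ∀ y : ℝ, R ^ (s * p) * y ≤ N ^ (p - 1) → y ≤ N ^ (p - 1) * R ^ (-(s * p)) := by
    intro y hy
    calc y = (R ^ (s * p) * R ^ (-(s * p))) * y := by rw [hinv, one_mul]
      _ = (R ^ (s * p) * y) * R ^ (-(s * p)) := by ring
      _ ≤ _ := by gcongr
  refine ⟨?_, ?_, ?_⟩
  · have e1 : ∫⁻ x in Metric.ball x₀ (2 * R), ENNReal.ofReal (|u x| ^ p) =
        ENNReal.ofReal (a ^ p) := by
      have e2 := lintegral_rpow_enorm_eq_rpow_eLpNorm' (f := u)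
        (μ := volume.restrict (Metric.ball x₀ (2 * R))) hp0
      have e3 := eLpNorm_eq_eLpNorm' (f := u) (μ := volume.restrict (Metric.ball x₀ (2 * R)))
        (p := ENNReal.ofReal p) (by simpa using hp0) ENNReal.ofReal_ne_top
      rw [ENNReal.toReal_ofReal hp0.le] at e3
      rw [← e3, ← ENNReal.ofReal_toReal huL.2.ne, ← ha,
        ENNReal.ofReal_rpow_of_nonneg ENNReal.toReal_nonneg hp0.le] at e2
      rw [← e2]
      refine lintegral_congr fun x => ?_
      rw [← ENNReal.ofReal_rpow_of_nonneg (abs_nonneg _) hp0.le, Real.enorm_eq_ofReal_abs]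
    rw [e1]
    apply ENNReal.ofReal_le_ofReal
    have h4 : a ≤ N * R ^ ((n : ℝ) / p) := by
      rw [← div_le_iff₀ (by positivity)]; linarith
    refine (Real.rpow_le_rpow ENNReal.toReal_nonneg h4 hp0.le).trans (le_of_eq ?_)
    rw [Real.mul_rpow hN0 (by positivity), ← Real.rpow_mul hR.le, div_mul_cancel₀ _ hp0.ne']
  · have hint := hut.integrableOn_compl_ball hs0 hp x₀ hR
    have e1 : ∫⁻ x in (Metric.ball x₀ R)ᶜ, ENNReal.ofReal
        (|u x| ^ (p - 1) * ‖x - x₀‖ ^ (-((n : ℝ) + s * p))) =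
        ENNReal.ofReal (∫ x in (Metric.ball x₀ R)ᶜ,
          |u x| ^ (p - 1) / ‖x - x₀‖ ^ ((n : ℝ) + s * p)) := by
      rw [ofReal_integral_eq_lintegral_ofReal hint
        (Filter.Eventually.of_forall fun x => by positivity)]
      refine lintegral_congr fun x => ?_
      rw [Real.rpow_neg (norm_nonneg _), div_eq_mul_inv]
    rw [e1]
    apply ENNReal.ofReal_le_ofReal
    apply hmove
    have h4 : tail s p u x₀ R ≤ N := by linarith
    have h5 := Real.rpow_le_rpow h2 h4 hp1.le
    have h6 : 0 ≤ ∫ x in (Metric.ball x₀ R)ᶜ,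
        |u x| ^ (p - 1) / ‖x - x₀‖ ^ ((n : ℝ) + s * p) :=
      integral_nonneg fun x => by positivity
    rwa [tail, ← Real.rpow_mul (by positivity), one_div_mul_cancel hp1.ne', Real.rpow_one] at h5
  · apply hmove
    have h4 : R ^ (s * p / (p - 1)) * f₀ ^ (1 / (p - 1)) ≤ N := by linarith
    have h5 := Real.rpow_le_rpow h3 h4 hp1.le
    rwa [Real.mul_rpow (by positivity) (by positivity), ← Real.rpow_mul hR.le, ← Real.rpow_mul hf,
      one_div_mul_cancel hp1.ne', Real.rpow_one, div_mul_cancel₀ _ hp1.ne'] at h5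

/-! ### Almost everywhere equality, Hölder continuity and assembly -/

/-- A function whose values decay towards `v` agrees with `v` almost everywhere. -/
lemma measure_ne_eq_zero_of_decay {n : ℕ} {u v : Eucl n → ℝ} {x₀ : Eucl n} {R B θ : ℝ}
    (hR : 0 < R) (hθ0 : 0 ≤ θ) (hθ : θ < 1)
    (h : ∀ z ∈ Metric.ball x₀ R, ∀ j : ℕ,
      ∀ᵐ x ∂volume.restrict (Metric.ball z (R / 2 / 4 ^ j)), |u x - v z| ≤ B * θ ^ j) :
    volume {x | x ∈ Metric.ball x₀ R ∧ v x ≠ u x} = 0 := by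
  -- Near z almost every u x is within Bθ^j of v z, and v x is within 2Bθ^j of v z. The argument is
  -- local and needs neither differentiation of integrals nor measurability of v.
  have hS : ∀ j : ℕ, volume {x | x ∈ Metric.ball x₀ R ∧ 3 * (B * θ ^ j) < |u x - v x|} = 0 := by
    intro j
    refine measure_null_of_locally_null _ fun z hz => ?_
    have hr : 0 < R / 2 / 4 ^ j := by positivity
    refine ⟨_, inter_mem_nhdsWithin _ (Metric.ball_mem_nhds z hr), ?_⟩
    have h1 := h z hz.1 j
    rw [ae_restrict_iff' Metric.isOpen_ball.measurableSet, ae_iff] at h1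
    refine measure_mono_null (fun x hx => ?_) h1
    obtain ⟨⟨hx1, hx2⟩, hx3⟩ := hx
    rw [mem_ofPred_eq, Classical.not_imp]
    refine ⟨hx3, fun hcon => ?_⟩
    rw [mem_ball_iff_norm'] at hx3
    have h2 := abs_sub_le_of_decay hr hx3.le (h z hz.1 j) (h x hx1 j)
    have h3 := abs_sub_le (u x) (v z) (v x)
    linarith
  refine measure_mono_null (fun x hx => ?_) (measure_iUnion_null hS)
  obtain ⟨hx1, hx2⟩ := hx
  have hpos : 0 < |u x - v x| := abs_pos.2 (sub_ne_zero.2 (Ne.symm hx2))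
  have hlim : Filter.Tendsto (fun j : ℕ => 3 * (B * θ ^ j)) Filter.atTop (nhds 0) := by
    simpa using ((tendsto_pow_atTop_nhds_zero_of_lt_one hθ0 hθ).const_mul B).const_mul 3
  obtain ⟨j, hj⟩ := (hlim.eventually (gt_mem_nhds hpos)).exists
  exact mem_iUnion.2 ⟨j, hx1, hj⟩

/-- A function satisfying local Hölder bounds is Hölder continuous on compact sets. -/
lemma locallyHolder_of_local_bounds {n : ℕ} {α : ℝ≥0} (hα : 0 < α) {Ω : Set (Eucl n)}
    {v : Eucl n → ℝ}
    (h : ∀ z ∈ Ω, ∃ R L B : ℝ, 0 < R ∧ 0 ≤ L ∧ ∀ x ∈ Metric.ball z R, ∀ y ∈ Metric.ball z R,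
      |v x| ≤ B ∧ |v x - v y| ≤ L * ‖x - y‖ ^ (α : ℝ)) : LocallyHolder α Ω v := by
  have hα' : (0:ℝ) < α := hα
  intro Q hQ hQΩ
  have key : ∃ c : ℝ, 0 ≤ c ∧ ∀ w ∈ Q ×ˢ Q, |v w.1 - v w.2| ≤ c * ‖w.1 - w.2‖ ^ (α : ℝ) := by
    -- Compactness of Q × Q: near the diagonal the local Hölder bound applies, and near a pair of
    -- distinct points boundedness suffices because distances stay away from 0.
    refine (hQ.prod hQ).induction_on
      (p := fun S => ∃ c : ℝ, 0 ≤ c ∧ ∀ w ∈ S, |v w.1 - v w.2| ≤ c * ‖w.1 - w.2‖ ^ (α : ℝ))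
      ⟨0, le_rfl, fun w hw => absurd hw (notMem_empty w)⟩
      (fun S T hST ⟨c, hc, hT⟩ => ⟨c, hc, fun w hw => hT w (hST hw)⟩) ?_ ?_
    · rintro S T ⟨c, hc, hS⟩ ⟨d, hd, hT⟩
      refine ⟨max c d, le_max_of_le_left hc, fun w hw => ?_⟩
      have h0 : 0 ≤ ‖w.1 - w.2‖ ^ (α : ℝ) := by positivity
      rcases hw with hw | hw
      · exact (hS w hw).trans (mul_le_mul_of_nonneg_right (le_max_left _ _) h0)
      · exact (hT w hw).trans (mul_le_mul_of_nonneg_right (le_max_right _ _) h0)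
    · rintro ⟨x, y⟩ ⟨hx, hy⟩
      obtain ⟨R, L, B, hR, hL, hb⟩ := h x (hQΩ hx)
      obtain ⟨R', L', B', hR', hL', hb'⟩ := h y (hQΩ hy)
      rcases eq_or_ne x y with rfl | hne
      · refine ⟨Metric.ball x R ×ˢ Metric.ball x R, mem_nhdsWithin_of_mem_nhds
          (prod_mem_nhds (Metric.ball_mem_nhds x hR) (Metric.ball_mem_nhds x hR)), L, hL,
          fun w hw => (hb w.1 hw.1 w.2 hw.2).2⟩
      · have hd : 0 < ‖x - y‖ := norm_pos_iff.2 (sub_ne_zero.2 hne)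
        set m := ‖x - y‖ / 4 with hm
        have hm0 : 0 < m := by positivity
        have hB : 0 ≤ B := (abs_nonneg _).trans
          (hb x (Metric.mem_ball_self hR) x (Metric.mem_ball_self hR)).1
        have hB' : 0 ≤ B' := (abs_nonneg _).trans
          (hb' y (Metric.mem_ball_self hR') y (Metric.mem_ball_self hR')).1
        refine ⟨Metric.ball x (min R m) ×ˢ Metric.ball y (min R' m), mem_nhdsWithin_of_mem_nhds
          (prod_mem_nhds (Metric.ball_mem_nhds x (lt_min hR hm0))
            (Metric.ball_mem_nhds y (lt_min hR' hm0))), (B + B') / m ^ (α : ℝ), by positivity, ?_⟩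
        rintro ⟨a, b⟩ ⟨ha, hb2⟩
        have ha1 := Metric.ball_subset_ball (min_le_left R m) ha
        have hb1 := Metric.ball_subset_ball (min_le_left R' m) hb2
        have ha2 := Metric.ball_subset_ball (min_le_right R m) ha
        have hb3 := Metric.ball_subset_ball (min_le_right R' m) hb2
        simp only at ha1 hb1 ha2 hb3 ⊢
        rw [mem_ball_iff_norm'] at ha2
        rw [mem_ball_iff_norm] at hb3
        have hdist : m ≤ ‖a - b‖ := by
          have h1 := norm_sub_le_norm_sub_add_norm_sub x a y
          have h2 := norm_sub_le_norm_sub_add_norm_sub a b y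
          rw [hm] at *
          linarith
        have h1 := (hb a ha1 a ha1).1
        have h2 := (hb' b hb1 b hb1).1
        have h3 : m ^ (α : ℝ) ≤ ‖a - b‖ ^ (α : ℝ) := Real.rpow_le_rpow hm0.le hdist hα'.le
        calc |v a - v b| ≤ B + B' := (abs_sub _ _).trans (add_le_add h1 h2)
          _ = (B + B') / m ^ (α : ℝ) * m ^ (α : ℝ) := by field_simp
          _ ≤ _ := by gcongr
  obtain ⟨c, hc, hkey⟩ := key
  refine ⟨c.toNNReal, fun x hx y hy => ?_⟩
  have h1 := hkey (x, y) ⟨hx, hy⟩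
  simp only at h1
  rw [edist_dist, edist_dist, Real.dist_eq, dist_eq_norm, ← ENNReal.ofReal_coe_nnreal,
    Real.coe_toNNReal _ hc, ENNReal.ofReal_rpow_of_nonneg (norm_nonneg _) hα'.le,
    ← ENNReal.ofReal_mul hc]
  exact ENNReal.ofReal_le_ofReal h1

lemma holderSeminorm_le {n : ℕ} {α : ℝ≥0} {U : Set (Eucl n)} {v : Eucl n → ℝ} {L : ℝ}
    (hL : 0 ≤ L) (h : ∀ x ∈ U, ∀ y ∈ U, |v x - v y| ≤ L * ‖x - y‖ ^ (α : ℝ)) :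
    holderSeminorm α U v ≤ ENNReal.ofReal L := by
  have : HolderWith L.toNNReal α (U.domRestrict v) := by
    rintro ⟨x, hx⟩ ⟨y, hy⟩
    have h1 := h x hx y hy
    rw [edist_dist, edist_dist, Subtype.dist_eq, Set.domRestrict_apply, Set.domRestrict_apply,
      Real.dist_eq, dist_eq_norm, ← ENNReal.ofReal_coe_nnreal,
      Real.coe_toNNReal _ hL, ENNReal.ofReal_rpow_of_nonneg (norm_nonneg _) α.coe_nonneg,
      ← ENNReal.ofReal_mul hL]
    exact ENNReal.ofReal_le_ofReal h1
  exact this.eHolderNorm_le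

/-- The estimates require a positive size N, while `localSize` may vanish; they are proved for every
larger N and passed to the limit. -/
lemma le_mul_of_forall_gt {a b N₀ : ℝ} (h : ∀ N, N₀ < N → a ≤ b * N) : a ≤ b * N₀ := by
  have hlim : Filter.Tendsto (fun N : ℝ => b * N) (nhdsWithin N₀ (Ioi N₀)) (nhds (b * N₀)) :=
    ((continuous_const.mul continuous_id).tendsto N₀).mono_left nhdsWithin_le_nhds
  exact ge_of_tendsto hlim (Filter.eventually_of_mem self_mem_nhdsWithin h)

/-- Local Hölder estimates for the precise representative of a weak solution. -/
theorem exists_preciseRep_bounds {n : ℕ} (hn : 1 ≤ n) {s p Λ : ℝ} (hs0 : 0 < s) (hs1 : s < 1)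
    (hp : 1 < p) (hΛ : 1 ≤ Λ) :
    ∃ α C : ℝ, 0 < α ∧ α < 1 ∧ 1 ≤ C ∧
      ∀ (Ω : Set (Eucl n)), IsOpen Ω → Bornology.IsBounded Ω →
      ∀ (K : Eucl n → Eucl n → ℝ), IsKernel s p Λ K →
      ∀ (f : Eucl n → ℝ) (f₀ : ℝ), MemLp f ⊤ (volume.restrict Ω) →
        (eLpNorm f ⊤ (volume.restrict Ω)).toReal ≤ f₀ →
      ∀ (u : Eucl n → ℝ), Measurable u → MemTailSpace s p u → IsWeakSolution s p K Ω f u →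
      preciseRep u =ᵐ[volume.restrict Ω] u ∧
      ∀ (x₀ : Eucl n) (R : ℝ), 0 < R → Metric.ball x₀ (2 * R) ⊆ Ω →
        ∀ x ∈ Metric.ball x₀ R, |preciseRep u x| ≤ C * localSize s p f₀ u x₀ R ∧
        ∀ y ∈ Metric.ball x₀ R, |preciseRep u x - preciseRep u y| ≤
          16 * C * localSize s p f₀ u x₀ R * (‖x - y‖ / R) ^ α := by
  obtain ⟨C, hC, hDG⟩ := exists_isDeGiorgi hn hs0 hs1 hp hΛ
  obtain ⟨α, C₁, hα0, hα1, hC₁, hval⟩ := exists_value_bounds hn hs0 hp hC (n := n)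
  refine ⟨α, C₁, hα0, hα1, hC₁, ?_⟩
  intro Ω hΩ hΩb K hK f f₀ hf hff u hum hut hu
  have hf0 : 0 ≤ f₀ := ENNReal.toReal_nonneg.trans hff
  have hu1 := hDG Ω hΩ hΩb K hK f f₀ hf hff u hum hu
  have hu2 := hDG Ω hΩ hΩb K hK (-f) f₀ hf.neg (by rwa [eLpNorm_neg]) (-u) hum.neg hu.neg
  set v := preciseRep u with hv
  have hθ0 : (0:ℝ) ≤ 4 ^ (-α) := by positivity
  have hθ1 := four_rpow_neg_lt_one hα0
  have hmain : ∀ (x₀ : Eucl n) (R : ℝ), 0 < R → Metric.ball x₀ (2 * R) ⊆ Ω →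
      ∀ N, localSize s p f₀ u x₀ R < N → ∀ z ∈ Metric.ball x₀ R, |v z| ≤ C₁ * N ∧
      ∀ j : ℕ, ∀ᵐ x ∂volume.restrict (Metric.ball z (R / 2 / 4 ^ j)),
        |u x - v z| ≤ C₁ * N * (4 ^ (-α)) ^ j := by
    intro x₀ R hR hball N hN z hz
    have hN0 : 0 < N := (localSize_nonneg hf0 u x₀ hR).trans_lt hN
    have huL : MemLp u (ENNReal.ofReal p) (volume.restrict (Metric.ball x₀ (2 * R))) :=
      hu.1.2.1.mono_measure (Measure.restrict_mono hball le_rfl)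
    have hb := scaleBounds_of_localSize_le hs0 hp hf0 hut hR huL hN.le
    obtain ⟨c, hc1, hc2⟩ := hval Ω u f₀ hu1 hu2 x₀ R N hR hN0 hball hb z hz
    have : v z = c := preciseRep_eq (isEssLimit_of_decay (by positivity) hθ0 hθ1 hc2)
    rw [this]
    exact ⟨hc1, hc2⟩
  constructor
  · rw [Filter.EventuallyEq, ae_restrict_iff' hΩ.measurableSet, ae_iff]
    refine measure_null_of_locally_null _ fun z hz => ?_
    rw [mem_ofPred_eq, Classical.not_imp] at hz
    obtain ⟨r, hr, hrΩ⟩ := Metric.isOpen_iff.1 hΩ z hz.1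
    have hr2 : Metric.ball z (2 * (r / 2)) ⊆ Ω := by
      rwa [mul_div_cancel₀ _ (by norm_num : (2:ℝ) ≠ 0)]
    refine ⟨_, inter_mem_nhdsWithin _ (Metric.ball_mem_nhds z (by positivity : 0 < r / 2)), ?_⟩
    refine measure_mono_null (fun x hx => ?_) (measure_ne_eq_zero_of_decay (by positivity) hθ0 hθ1
      fun y hy => (hmain z (r / 2) (by positivity) hr2 _ (lt_add_one _) y hy).2)
    obtain ⟨hx1, hx2⟩ := hx
    rw [mem_ofPred_eq, Classical.not_imp] at hx1
    exact ⟨hx2, hx1.2⟩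
  · intro x₀ R hR hball x hx
    refine ⟨le_mul_of_forall_gt fun N hN => (hmain x₀ R hR hball N hN x hx).1, fun y hy => ?_⟩
    have h := le_mul_of_forall_gt (a := |v x - v y|) (b := 16 * C₁ * (‖x - y‖ / R) ^ α)
      (N₀ := localSize s p f₀ u x₀ R) fun N hN => by
        have hN0 : 0 < N := (localSize_nonneg hf0 u x₀ hR).trans_lt hN
        have h1 := hmain x₀ R hR hball N hN x hx
        have h2 := hmain x₀ R hR hball N hN y hy
        have h3 := abs_sub_le_rpow_of_decay hα0 hα1 (by positivity) hR h1.1 h2.1 h1.2 h2.2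
        linarith
    linarith

end NonlocalEq

theorem corollary4p3 (n : ℕ) (hn : 1 ≤ n) (s p Λ : ℝ) (hs0 : 0 < s) (hs1 : s < 1)
    (hp : 1 < p) (hΛ : 1 ≤ Λ) :
    ∃ α : ℝ≥0, 0 < α ∧ α < 1 ∧ ∃ C : ℝ, 1 ≤ C ∧
      ∀ (Ω : Set (NonlocalEq.Eucl n)), IsOpen Ω → Bornology.IsBounded Ω →
      ∀ (K : NonlocalEq.Eucl n → NonlocalEq.Eucl n → ℝ), NonlocalEq.IsKernel s p Λ K →
      ∀ (f : NonlocalEq.Eucl n → ℝ) (f₀ : ℝ), MemLp f ⊤ (volume.restrict Ω) →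
        (eLpNorm f ⊤ (volume.restrict Ω)).toReal ≤ f₀ →
      ∀ (u : NonlocalEq.Eucl n → ℝ), NonlocalEq.MemTailSpace s p u →
        NonlocalEq.IsWeakSolution s p K Ω f u →
        ∃ v : NonlocalEq.Eucl n → ℝ, v =ᵐ[volume.restrict Ω] u ∧
          NonlocalEq.LocallyHolder α Ω v ∧
          ∀ x₀ ∈ Ω, ∀ R : ℝ, 0 < R → R < Metric.infDist x₀ (frontier Ω) / 2 →
            eLpNorm u ⊤ (volume.restrict (Metric.ball x₀ R)) +
                ENNReal.ofReal (R ^ (α : ℝ)) *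
                  NonlocalEq.holderSeminorm α (Metric.ball x₀ R) v ≤
              ENNReal.ofReal (C *
                ((eLpNorm u (ENNReal.ofReal p)
                    (volume.restrict (Metric.ball x₀ (2 * R)))).toReal / R ^ ((n : ℝ) / p) +
                  NonlocalEq.tail s p u x₀ R +
                  R ^ (s * p / (p - 1)) * f₀ ^ (1 / (p - 1)))) := by
  obtain ⟨α, C, hα0, hα1, hC, hmain⟩ := NonlocalEq.exists_preciseRep_bounds hn hs0 hs1 hp hΛ
  -- 17C is C for the supremum plus 16C for the seminorm.
  refine ⟨⟨α, hα0.le⟩, hα0, hα1, 17 * C, by linarith, ?_⟩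
  intro Ω hΩ hΩb K hK f f₀ hf hff u hut hu
  have hf0 : 0 ≤ f₀ := ENNReal.toReal_nonneg.trans hff
  -- The theory above assumes Borel measurability. The equation, the tail condition and `localSize`
  -- do not change under modification on a null set.
  have hae : u =ᵐ[volume] hut.1.mk u := hut.1.ae_eq_mk
  obtain ⟨hv, hb⟩ := hmain Ω hΩ hΩb K hK f f₀ hf hff (hut.1.mk u) hut.1.measurable_mk
    (hut.congr_ae hae) (hu.congr_ae hae)
  set v := NonlocalEq.preciseRep (hut.1.mk u) with hvdef
  have hvu : v =ᵐ[volume.restrict Ω] u := hv.trans (ae_restrict_of_ae hae.symm)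
  have hholder : ∀ (x₀ : NonlocalEq.Eucl n) (R : ℝ), 0 < R → Metric.ball x₀ (2 * R) ⊆ Ω →
      ∀ x ∈ Metric.ball x₀ R, ∀ y ∈ Metric.ball x₀ R,
      |v x - v y| ≤ 16 * C * NonlocalEq.localSize s p f₀ u x₀ R / R ^ α * ‖x - y‖ ^ α := by
    intro x₀ R hR hball x hx y hy
    refine ((hb x₀ R hR hball x hx).2 y hy).trans (le_of_eq ?_)
    rw [NonlocalEq.localSize_congr_ae hae, Real.div_rpow (norm_nonneg _) hR.le]
    ring
  refine ⟨v, hvu, ?_, ?_⟩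
  · refine NonlocalEq.locallyHolder_of_local_bounds hα0 fun z hz => ?_
    obtain ⟨r, hr, hrΩ⟩ := Metric.isOpen_iff.1 hΩ z hz
    have hr2 : Metric.ball z (2 * (r / 2)) ⊆ Ω := by
      rwa [mul_div_cancel₀ _ (by norm_num : (2:ℝ) ≠ 0)]
    have hr0 : 0 < r / 2 := by positivity
    have hN := NonlocalEq.localSize_nonneg (s := s) (p := p) hf0 u z hr0
    exact ⟨r / 2, _, _, hr0, by positivity, fun x hx y hy =>
      ⟨(hb z (r / 2) hr0 hr2 x hx).1, hholder z (r / 2) hr0 hr2 x hx y hy⟩⟩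
  · intro x₀ hx₀ R hR hRd
    have hball : Metric.ball x₀ (2 * R) ⊆ Ω :=
      NonlocalEq.ball_subset_of_le_infDist_frontier hΩ hx₀ (by positivity) (by linarith)
    have hballR : Metric.ball x₀ R ⊆ Ω := (Metric.ball_subset_ball (by linarith)).trans hball
    have hN := NonlocalEq.localSize_nonneg (s := s) (p := p) hf0 u x₀ hR
    change _ ≤ ENNReal.ofReal (17 * C * NonlocalEq.localSize s p f₀ u x₀ R)
    set N := NonlocalEq.localSize s p f₀ u x₀ R with hNdef
    have h1 : eLpNorm u ⊤ (volume.restrict (Metric.ball x₀ R)) ≤ ENNReal.ofReal (C * N) := by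
      rw [eLpNorm_exponent_top]
      refine eLpNormEssSup_le_of_ae_bound ?_
      filter_upwards [ae_restrict_of_ae_restrict_of_subset hballR hvu,
        ae_restrict_mem Metric.isOpen_ball.measurableSet] with x hx hxB
      rw [← hx, Real.norm_eq_abs, hNdef, NonlocalEq.localSize_congr_ae hae]
      exact (hb x₀ R hR hball x hxB).1
    have h2 : NonlocalEq.holderSeminorm ⟨α, hα0.le⟩ (Metric.ball x₀ R) v ≤
        ENNReal.ofReal (16 * C * N / R ^ α) :=
      NonlocalEq.holderSeminorm_le (by positivity) (hholder x₀ R hR hball)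
    calc _ ≤ ENNReal.ofReal (C * N) + ENNReal.ofReal (R ^ α) *
          ENNReal.ofReal (16 * C * N / R ^ α) :=
          add_le_add h1 (mul_le_mul' le_rfl h2)
      _ = _ := by
          rw [← ENNReal.ofReal_mul (by positivity), ← ENNReal.ofReal_add (by positivity)
            (by positivity)]
          congr 1
          have : R ^ α ≠ 0 := by positivity
          field_simp
          ring
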